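/- Let $\mathbb T=\mathbb R/\mathbb Z$ with Lebesgue measure $\lambda$ and the metric $d(x,y)=\|x-y\|$ (distance of $x-y$ to the nearest integer), and let $\alpha\in[0,1)$ be irrational with bounded partial quotients. *Quasi-similar Cantor functions.* Let $(k_i)_{i\ge1}$ be a bounded sequence of natural numbers and let $D_i\subset\{0,\dots,k_i-1\}$ be sets with $m_i:=|D_i|\ge 2$, $0\in D_i$, $k_i-1\in D_i$, and no two consecutive integers in $D_i$. Let $A_0=[0,1]$, and let $A_n$ be obtained from $A_{n-1}$ by dividing each interval of $A_{n-1}$ (of length $1/(k_1\cdots k_{n-1})$) into $k_n$ intervals of equal length and keeping the closed ones whose number, counted $0,\dots,k_n-1$ from the left, lies in $D_n$. The set $\mathcal C=\bigcap_n A_n$ is a quasi-similar Cantor set. Let $f_n(x)=\frac{k_1\cdots k_n}{m_1\cdots m_n}\,|A_n\cap[0,x]|$, where $|\cdot|$ is Lebesgue measure; the functions $f_n$ converge on $[0,1]$ to a continuous non-decreasing function $c_{\mathcal C}$ with $c_{\mathcal C}(0)=0$, $c_{\mathcal C}(1)=1$. A Cantor function $f(\mathcal C)$ of $\mathcal C$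 is either $c_{\mathcal C}$ (non-decreasing) or $1-c_{\mathcal C}$ (non-increasing). *Roof function.* Let $f:\mathbb T\to(0,\infty)$ be of bounded variation and such that, for $x\in[0,1)$, $$f(x)=f_a(x)+f_j(x)+f_s(x)+\tilde S\{x\},$$ where $f_a$ is absolutely continuous on $\mathbb T$, $f_s=f(\mathcal C)$ is a Cantor function of a quasi-similar Cantor set, $f_j:\mathbb T\to\mathbb R$ is a jump function and $\tilde S\in\mathbb R$. Suppose that either 1. $f_j$ has finitely many discontinuities (it is locally constant off a finite set), and either $\tilde S>0$ and $f_s$ is non-decreasing, or $\tilde S<0$ and $f_s$ is non-increasing; or 2. $f=f_s+f_a$, that is, $f_j=0$ and $\tilde S=0$. *Special flow.* Let $f^{(n)}$, $n\in\mathbb Z$, be the cocycle over $Tx=x+\alpha$ with $f^{(0)}=0$ and $f^{(n+1)}(x)=f^{(n)}(x)+f(T^nx)$. On $X^f=\{(x,s)\in\mathbb T\times\mathbb R: 0\le s<f(x)\}$, with the normalized restriction $\mu$ of $\lambda\times$Lebesgue and the metric $d_1((x,t),(y,s))=d(x,y)+|t-s|$, let $T^f_t(x,s)=(T^nx,\,s+t-f^{(n)}(x))$,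 where $n\in\mathbb Z$ is the unique integer with $f^{(n)}(x)\le s+t<f^{(n+1)}(x)$. Then the special flow $(T^f_t)_{t\in\mathbb R}$ * is weakly mixing: if $F\in L^2(X^f,\mu)$ and $r\in\mathbb R$ satisfy, for every $t\in\mathbb R$, $F\circ T^f_t=e^{2\pi i r t}F$ $\mu$-a.e., then $F$ is a.e. constant; and * has the weak Ratner (WR) property: there is a compact set $P\subset\mathbb R\setminus\{0\}$ such that $(T^f_t)$ has the property $R(t_0,P)$ for uncountably many $t_0\in\mathbb R\setminus\{0\}$. Here a flow $(S_t)$ has the property $R(t_0,P)$ if for every $\varepsilon>0$ there is $\kappa>0$ such that for every $N\in\mathbb N$ there are $\delta>0$ and a measurable set $Z$ with $\mu(Z)>1-\varepsilon$ such that, for all $x,x'\in Z$ with $x'$ not in the orbit of $x$ and $d_1(x,x')<\delta$, there are natural numbers $M,L\ge N$ with $L/M\ge\kappa$ and $p\in P$ with $$\frac1L\left|\{n\in\mathbb Z\cap[M,M+L]:\ d_1(S_{nt_0}x,S_{nt_0+p}x')<\varepsilon\}\right|>1-\varepsilon .$$ -/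

import Mathlib

open MeasureTheory Filter Topology

noncomputable section

/-! ### Arithmetic of the rotation number -/

/-- The partial quotients `a₁, a₂, …` of the continued fraction expansion of `α` are bounded. -/
def HasBoundedPartialQuotients (α : ℝ) : Prop :=
  ∃ C : ℝ, ∀ (n : ℕ) (a : ℝ), (GenContFract.of α).partDens.get? n = some a → a ≤ C

/-! ### Quasi-similar Cantor sets and their Cantor functions -/

/-- The combinatorial data of a quasi-similar Cantor set. At step `i + 1` every interval selected
before is divided into `k i` intervals of equal length, numbered `0, …, k i - 1` from left to
right, and those with number in `D i` are selected. -/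
structure QuasiSimilarCantor where
  /-- number of parts at step `i + 1` -/
  k : ℕ → ℕ
  /-- the configuration of selected parts at step `i + 1` -/
  D : ℕ → Finset ℕ
  bounded_k : ∃ B : ℕ, ∀ i, k i ≤ B
  lt_k : ∀ i, ∀ d ∈ D i, d < k i
  two_le_card : ∀ i, 2 ≤ (D i).card
  first_mem : ∀ i, 0 ∈ D i
  last_mem : ∀ i, ∃ d ∈ D i, d + 1 = k i
  /-- the closures of two different selected parts are disjoint -/
  not_adjacent : ∀ i, ∀ d ∈ D i, d + 1 ∉ D i

namespace QuasiSimilarCantor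

variable (C : QuasiSimilarCantor)

/-- number of selected parts at step `i + 1` -/
def m (i : ℕ) : ℕ := (C.D i).card

/-- `k₁ ⋯ kₙ` -/
def kProd (n : ℕ) : ℕ := ∏ i ∈ Finset.range n, C.k i

/-- `m₁ ⋯ mₙ` -/
def mProd (n : ℕ) : ℕ := ∏ i ∈ Finset.range n, C.m i

/-- Left endpoints of the intervals selected at step `n`; each has length `1 / (k₁ ⋯ kₙ)`. -/
def leftEndpoints : ℕ → Set ℝ
  | 0 => {0}
  | n + 1 => {y | ∃ a ∈ leftEndpoints n, ∃ d ∈ C.D n, y = a + (d : ℝ) / (C.kProd (n + 1) : ℝ)}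

/-- The union `Aₙ` of the closed intervals selected at step `n`, with `A₀ = [0, 1]`. -/
def level (n : ℕ) : Set ℝ :=
  ⋃ a ∈ C.leftEndpoints n, Set.Icc a (a + 1 / (C.kProd n : ℝ))

/-- The Cantor set `⋂ Aₙ`. -/
def carrier : Set ℝ := ⋂ n, C.level n

/-- The absolutely continuous function `fₙ` with `fₙ(0) = 0`, with derivative
`(k₁ ⋯ kₙ) / (m₁ ⋯ mₙ)` inside `Aₙ` and derivative `0` off `Aₙ`. -/
def approx (n : ℕ) (x : ℝ) : ℝ :=
  (C.kProd n : ℝ) / (C.mProd n : ℝ) * volume.real (C.level n ∩ Set.Iic x)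

/-- The non-decreasing Cantor function of the Cantor set, the limit of the functions `fₙ`. -/
def cantorFunction (x : ℝ) : ℝ := limUnder atTop (fun n => C.approx n x)

end QuasiSimilarCantor

/-! ### Functions on the circle -/

/-- A function on the circle with bounded variation. -/
def IsBVOnCircle (f : UnitAddCircle → ℝ) : Prop :=
  BoundedVariationOn (fun x : ℝ => f (x : UnitAddCircle)) (Set.Icc 0 1)

/-- A function that is absolutely continuous on the circle. -/
def IsACOnCircle (f : UnitAddCircle → ℝ) : Prop :=
  AbsolutelyContinuousOnInterval (fun x : ℝ => f (x : UnitAddCircle)) 0 1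

/-- A jump function with finitely many discontinuities on the circle, i.e. a function that is
locally constant off a finite set (its values on that set are arbitrary). -/
def IsFiniteJumpFunction (f : UnitAddCircle → ℝ) : Prop :=
  ∃ F : Set UnitAddCircle, F.Finite ∧ ∀ x ∉ F, ∀ᶠ y in 𝓝 x, f y = f x

/-! ### The special flow over the rotation by `a` under the roof `f` -/

/-- The cocycle `f⁽ⁿ⁾`, `n ∈ ℤ`, over `x ↦ x + a`:
`f⁽ⁿ⁾(x) = f(x) + f(x + a) + ⋯ + f(x + (n - 1) a)` for `n ≥ 0`, and
`f⁽⁻ⁿ⁾(x) = -(f(x - a) + ⋯ + f(x - n a))`. -/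
def cocycle (a : UnitAddCircle) (f : UnitAddCircle → ℝ) : ℤ → UnitAddCircle → ℝ
  | Int.ofNat n, x => ∑ i ∈ Finset.range n, f (x + (i : ℤ) • a)
  | Int.negSucc n, x => -∑ i ∈ Finset.range (n + 1), f (x - ((i : ℤ) + 1) • a)

theorem cocycle_succ (a : UnitAddCircle) (f : UnitAddCircle → ℝ) (n : ℤ) (x : UnitAddCircle) :
    cocycle a f (n + 1) x = cocycle a f n x + f (x + n • a) := by
  rcases n with n | n
  · show cocycle a f (Int.ofNat (n + 1)) x = _
    simp only [cocycle]
    rw [Finset.sum_range_succ]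
    rfl
  · rcases n with _ | n
    · show cocycle a f (Int.ofNat 0) x = _
      simp [cocycle, sub_eq_add_neg]
    · have h : Int.negSucc (n + 1) + 1 = Int.negSucc n := by omega
      rw [h]
      simp only [cocycle]
      rw [Finset.sum_range_succ _ (n + 1)]
      have h2 : x + Int.negSucc (n + 1) • a = x - (((n + 1 : ℕ) : ℤ) + 1) • a := by
        rw [sub_eq_add_neg, ← neg_smul]
        congr 2
      rw [h2]
      ring

/-- The space `{(x, s) : 0 ≤ s < f x}` under the graph of the roof function. -/
abbrev SpecialSpace (f : UnitAddCircle → ℝ) : Type :=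
  {p : UnitAddCircle × ℝ // 0 ≤ p.2 ∧ p.2 < f p.1}

open Classical in
/-- The special flow `(x, s) ↦ (x + n a, s + t - f⁽ⁿ⁾(x))`, where `n` is the integer with
`f⁽ⁿ⁾(x) ≤ s + t < f⁽ⁿ⁺¹⁾(x)`. For a positive roof of bounded variation over an irrational
rotation such an `n` exists and is unique; the last line is a default value. -/
def specialFlow (a : UnitAddCircle) (f : UnitAddCircle → ℝ) (t : ℝ) (p : SpecialSpace f) :
    SpecialSpace f :=
  if h : ∃ n : ℤ, cocycle a f n p.1.1 ≤ p.1.2 + t ∧ p.1.2 + t < cocycle a f (n + 1) p.1.1 then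
    ⟨(p.1.1 + h.choose • a, p.1.2 + t - cocycle a f h.choose p.1.1), by
      have h1 := h.choose_spec
      rw [cocycle_succ] at h1
      exact ⟨sub_nonneg.2 h1.1, by linarith [h1.2]⟩⟩
  else p

/-- Lebesgue measure on the space under the graph, normalized to a probability measure. -/
def specialMeasure (f : UnitAddCircle → ℝ) : Measure (SpecialSpace f) :=
  let ν : Measure (SpecialSpace f) :=
    Measure.comap Subtype.val (volume : Measure (UnitAddCircle × ℝ))
  (ν Set.univ)⁻¹ • ν

/-- The metric `d₁((x, t), (y, s)) = d(x, y) + |t - s|`. -/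
def specialDist (f : UnitAddCircle → ℝ) (p q : SpecialSpace f) : ℝ :=
  dist p.1.1 q.1.1 + |p.1.2 - q.1.2|

/-! ### Dynamical properties of flows -/

/-- A flow is weakly mixing if its only square-integrable eigenfunctions are the constants. -/
def IsWeaklyMixingFlow {X : Type*} [MeasurableSpace X] (μ : Measure X) (S : ℝ → X → X) : Prop :=
  ∀ (s : ℝ) (F : X → ℂ), MemLp F 2 μ →
    (∀ t : ℝ, ∀ᵐ x ∂μ, F (S t x) = Complex.exp (2 * Real.pi * Complex.I * s * t) * F x) →
    ∃ c : ℂ, ∀ᵐ x ∂μ, F x = c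

/-- The property `R(t₀, P)` of a flow with respect to the metric `d`. Note that `κ` depends on `ε`
only, while `δ` and `Z` depend on `ε` and `N`. -/
def HasRatnerProperty {X : Type*} [MeasurableSpace X] (d : X → X → ℝ) (μ : Measure X)
    (S : ℝ → X → X) (t₀ : ℝ) (P : Set ℝ) : Prop :=
  ∀ ε : ℝ, 0 < ε → ∃ κ : ℝ, 0 < κ ∧ ∀ N : ℕ, ∃ δ : ℝ, 0 < δ ∧
    ∃ Z : Set X, MeasurableSet Z ∧ 1 - ε < μ.real Z ∧
      ∀ x ∈ Z, ∀ x' ∈ Z, (∀ t : ℝ, S t x ≠ x') → d x x' < δ →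
        ∃ M L : ℕ, N ≤ M ∧ N ≤ L ∧ κ ≤ (L : ℝ) / (M : ℝ) ∧ ∃ p ∈ P,
          1 - ε < 1 / (L : ℝ) *
            (({n : ℤ | (M : ℤ) ≤ n ∧ n ≤ (M : ℤ) + (L : ℤ) ∧
              d (S (n * t₀) x) (S (n * t₀ + p) x') < ε}.ncard : ℕ) : ℝ)

/-- The weak Ratner property: for some compact `P ⊆ ℝ \ {0}` there are uncountably many `t₀ ≠ 0`
for which the flow has the property `R(t₀, P)`. -/
def HasWeakRatnerProperty {X : Type*} [MeasurableSpace X] (d : X → X → ℝ) (μ : Measure X)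
    (S : ℝ → X → X) : Prop :=
  ∃ P : Set ℝ, IsCompact P ∧ (0 : ℝ) ∉ P ∧
    ¬ {t₀ : ℝ | t₀ ≠ 0 ∧ HasRatnerProperty d μ S t₀ P}.Countable

end

noncomputable section

/-! ### Badly approximable numbers -/

/-- `α` is badly approximable with constant `c`. -/
def BadlyApproximable (α c : ℝ) : Prop :=
  0 < c ∧ ∀ j : ℕ, 1 ≤ j → ∀ p : ℤ, c ≤ j * |j * α - p|

theorem inv_fract_of_partDens_le {v C : ℝ} (hv : Irrational v)
    (h : ∀ (n : ℕ) (a : ℝ), (GenContFract.of v).partDens.get? n = some a → a ≤ C) :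
    Irrational (Int.fract v)⁻¹ ∧ 0 < Int.fract v ∧ 1 / (C + 1) ≤ Int.fract v ∧
      ∀ (n : ℕ) (a : ℝ),
        (GenContFract.of (Int.fract v)⁻¹).partDens.get? n = some a → a ≤ C := by
  have hfi : Irrational (Int.fract v) := by
    rw [Int.fract]; exact hv.sub_intCast _
  have hpos : 0 < Int.fract v := lt_of_le_of_ne (Int.fract_nonneg v) (Ne.symm hfi.ne_zero)
  refine ⟨hfi.inv, hpos, ?_, ?_⟩
  · have h0 := h 0 (⌊(Int.fract v)⁻¹⌋ : ℝ) (by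
      have := GenContFract.of_s_head (v := v) hpos.ne'
      rw [GenContFract.partDens, Stream'.Seq.map_get?]
      change Option.map _ ((GenContFract.of v).s.head) = _
      rw [this]; rfl)
    have h1 := Int.lt_floor_add_one (Int.fract v)⁻¹
    have h2 : (Int.fract v)⁻¹ < C + 1 := by linarith
    have h3 : 0 < (Int.fract v)⁻¹ := inv_pos.2 hpos
    rw [div_le_iff₀ (by linarith)]
    have : (Int.fract v) * (Int.fract v)⁻¹ = 1 := mul_inv_cancel₀ hpos.ne'
    nlinarith
  · intro n a ha
    apply h (n + 1) a
    rw [GenContFract.partDens, Stream'.Seq.map_get?] at ha ⊢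
    rw [GenContFract.of_s_succ]
    exact ha

theorem le_mul_abs_fract_sub_of_partDens_le {C : ℝ} (hC : 1 ≤ C) (j : ℕ) :
    ∀ v : ℝ, Irrational v →
      (∀ (n : ℕ) (a : ℝ), (GenContFract.of v).partDens.get? n = some a → a ≤ C) →
      1 ≤ j → ∀ p : ℤ, 1 / (C + 1) * (1 / (C + 1)) ≤ j * |j * Int.fract v - p| := by
  induction j using Nat.strong_induction_on with
  | _ j ih =>
  intro v hv hb hj p
  obtain ⟨hw, hx0, hxC, hbw⟩ := inv_fract_of_partDens_le hv hb
  obtain ⟨hu, hy0, hyC, hbu⟩ := inv_fract_of_partDens_le hw hbw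
  set x := Int.fract v with hx
  set y := Int.fract x⁻¹ with hy
  set γ := 1 / (C + 1) with hγ
  have hγ0 : 0 < γ := by positivity
  have hγ1 : γ ≤ 1 := by rw [hγ, div_le_one (by linarith)]; linarith
  have hx1 : x < 1 := Int.fract_lt_one v
  have hy1 : y < 1 := Int.fract_lt_one _
  set a : ℤ := ⌊x⁻¹⌋ with ha
  have hxa : x⁻¹ = a + y := (Int.floor_add_fract _).symm
  have hj1 : (1 : ℝ) ≤ j := by exact_mod_cast hj
  have hxy : γ * γ ≤ x * y := mul_le_mul hxC hyC hγ0.le hx0.le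
  have hxinv : x * (a + y) = 1 := by rw [← hxa]; exact mul_inv_cancel₀ hx0.ne'
  have ha1 : (1 : ℝ) ≤ a := by
    have : (1 : ℤ) ≤ a := by
      rw [ha, Int.le_floor]; push_cast; exact (one_le_inv₀ hx0).2 hx1.le
    exact_mod_cast this
  have hkey : j * x - p = x * ((j - p * a : ℤ) - p * y) := by
    push_cast
    linear_combination (p : ℝ) * hxinv
  rcases le_or_gt p 0 with hp | hp
  · have hp' : (p : ℝ) ≤ 0 := by exact_mod_cast hp
    have : x ≤ |j * x - p| := by
      refine le_trans ?_ (le_abs_self _)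
      nlinarith
    calc γ * γ ≤ 1 * x := by nlinarith
      _ ≤ _ := mul_le_mul hj1 this hx0.le (by linarith)
  rcases le_or_gt (j : ℤ) p with hp2 | hp2
  · have hp' : (j : ℝ) ≤ p := by exact_mod_cast hp2
    have : x * y ≤ |j * x - p| := by
      rw [abs_sub_comm]
      refine le_trans ?_ (le_abs_self _)
      nlinarith
    calc γ * γ ≤ 1 * (x * y) := by linarith
      _ ≤ _ := mul_le_mul hj1 this (by positivity) (by linarith)
  lift p to ℕ using hp.le
  have hpj : p < j := by exact_mod_cast hp2
  have hp1 : 1 ≤ p := by exact_mod_cast hp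
  have hp1' : (1 : ℝ) ≤ p := by exact_mod_cast hp1
  push_cast at hkey ⊢
  rcases le_or_gt (p : ℝ) (j * x) with hle | hlt
  · have := ih p hpj x⁻¹ hw hbw hp1 (j - p * a)
    rw [← hy] at this
    push_cast at this
    rw [hkey, abs_mul, abs_of_pos hx0, abs_sub_comm]
    calc _ ≤ p * |p * y - (j - p * a)| := this
      _ ≤ (j * x) * |p * y - (j - p * a)| := mul_le_mul_of_nonneg_right hle (abs_nonneg _)
      _ = _ := by ring
  · have hpos : 0 < p * y - (j - p * a) := by
      by_contra hcon
      have : 0 ≤ x * ((j - p * a) - p * y) := mul_nonneg hx0.le (by linarith)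
      linarith
    have habs : |j * x - p| = x * (p * y - (j - p * a)) := by
      rw [hkey, abs_mul, abs_of_pos hx0, abs_sub_comm, abs_of_pos hpos]
    rcases le_or_gt ((j : ℤ) - p * a) 0 with hq | hq
    · have hq' : (j : ℝ) - p * a ≤ 0 := by exact_mod_cast hq
      rw [habs]
      have h1 : y ≤ p * y - (j - p * a) := by nlinarith
      calc γ * γ ≤ 1 * (x * y) := by linarith
        _ ≤ _ := mul_le_mul hj1 (mul_le_mul_of_nonneg_left h1 hx0.le) (by positivity) (by linarith)
    · obtain ⟨p', hp'⟩ := Int.eq_ofNat_of_zero_le hq.le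
      have hp'R : (j : ℝ) - p * a = p' := by exact_mod_cast hp'
      have hp'1 : 1 ≤ p' := by omega
      have hp'lt : (p' : ℝ) < p := by
        rw [hp'R] at hpos
        nlinarith
      have hp'j : p' < j := by
        have : p' < p := by exact_mod_cast hp'lt
        omega
      rw [hp'R] at habs hpos
      set z := Int.fract y⁻¹ with hz
      set b : ℤ := ⌊y⁻¹⌋ with hbdef
      have hyb : y⁻¹ = b + z := (Int.floor_add_fract _).symm
      have hyinv : y * (b + z) = 1 := by rw [← hyb]; exact mul_inv_cancel₀ hy0.ne'
      have := ih p' hp'j y⁻¹ hu hbu hp'1 (p - p' * b)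
      rw [← hz] at this
      push_cast at this
      have hk2 : p * y - p' = y * (p - p' * b - p' * z) := by
        linear_combination (p' : ℝ) * hyinv
      have hk3 : |p' * z - (p - p' * b)| = p - p' * b - p' * z := by
        rw [abs_sub_comm, abs_of_pos]
        · by_contra hcon
          have : y * (p - p' * b - p' * z) ≤ 0 :=
            mul_nonpos_of_nonneg_of_nonpos hy0.le (by linarith)
          linarith
      have hk4 : (p' : ℝ) ≤ j * (x * y) := by
        have e1 : p - j * x = x * (p * y - p') := by
          rw [← habs, abs_sub_comm, abs_of_pos (by linarith)]
        have : j * (x * y) - p' = (p * y - p') * (1 - x * y) := by linear_combination (-y) * e1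
        have : 0 ≤ (p * y - p') * (1 - x * y) := mul_nonneg hpos.le (by nlinarith)
        linarith
      rw [habs, hk2, ← hk3]
      calc _ ≤ p' * |p' * z - (p - p' * b)| := this
        _ ≤ (j * (x * y)) * |p' * z - (p - p' * b)| := mul_le_mul_of_nonneg_right hk4 (abs_nonneg _)
        _ = _ := by ring

theorem HasBoundedPartialQuotients.exists_badlyApproximable {α : ℝ} (hirr : Irrational α)
    (h : HasBoundedPartialQuotients α) : ∃ c, BadlyApproximable α c := by
  obtain ⟨C, hC⟩ := h
  refine ⟨1 / (max C 1 + 1) * (1 / (max C 1 + 1)), by positivity, fun j hj p => ?_⟩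
  have := le_mul_abs_fract_sub_of_partDens_le (le_max_right C 1) j α hirr
    (fun n a ha => (hC n a ha).trans (le_max_left _ _)) hj (p - j * ⌊α⌋)
  convert this using 3
  push_cast
  rw [Int.fract]
  ring

end

noncomputable section

/-! ### Orbits of a badly approximable rotation -/

theorem BadlyApproximable.exists_two_sided {α c : ℝ} (hα : BadlyApproximable α c) {Q : ℕ}
    (hQ : 1 ≤ Q) : ∃ p q : ℕ, 0 < p ∧ (p + q : ℝ) ≤ Q * (2 + 1 / c) ∧ ∃ P R : ℤ,
      0 < p * α - P ∧ p * α - P < 1 / Q ∧ 0 < R - q * α ∧ R - q * α < 1 / Q := by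
  obtain ⟨hc, hα⟩ := hα
  have hQ0 : (0 : ℝ) < Q := by exact_mod_cast hQ
  set Q' : ℕ := ⌈(Q : ℝ) / c⌉₊ with hQ'
  have hQ'1 : (Q : ℝ) / c ≤ Q' := Nat.le_ceil _
  have hQ'2 : (Q' : ℝ) < Q / c + 1 := Nat.ceil_lt_add_one (by positivity)
  have hQ'0 : 0 < Q' := by
    have : (0 : ℝ) < Q' := lt_of_lt_of_le (by positivity) hQ'1
    exact_mod_cast this
  have hQ'c : (Q : ℝ) ≤ Q' * c := (div_le_iff₀ hc).1 hQ'1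
  obtain ⟨q, hq0, hqQ, hq⟩ := Real.exists_nat_abs_mul_sub_round_le α hQ
  obtain ⟨r, hr0, hrQ, hr⟩ := Real.exists_nat_abs_mul_sub_round_le α hQ'0
  have h1 := hα q hq0 (round (q * α))
  have h2 := hα r hr0 (round (r * α))
  set θ := q * α - round (q * α) with hθ
  set η := r * α - round (r * α) with hη
  have hqR : (q : ℝ) ≤ Q := by exact_mod_cast hqQ
  have hrR : (r : ℝ) ≤ Q' := by exact_mod_cast hrQ
  have hq1 : (1 : ℝ) ≤ q := by exact_mod_cast hq0
  have hr1 : (1 : ℝ) ≤ r := by exact_mod_cast hr0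
  have hQ'R : (0 : ℝ) < Q' := by exact_mod_cast hQ'0
  have hθQ : |θ| < 1 / Q := lt_of_le_of_lt hq (by gcongr; linarith)
  have hηθ : |η| < |θ| := by
    have e1 : |η| * (Q' + 1) ≤ 1 := by rwa [le_div_iff₀ (by positivity)] at hr
    have e2 : c ≤ Q * |θ| := h1.trans (mul_le_mul_of_nonneg_right hqR (abs_nonneg _))
    by_contra hcon
    push Not at hcon
    have e3 : 1 ≤ Q' * |θ| := by
      have : c ≤ c * (Q' * |θ|) := by
        calc c ≤ Q * |θ| := e2
          _ ≤ (Q' * c) * |θ| := mul_le_mul_of_nonneg_right hQ'c (abs_nonneg _)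
          _ = _ := by ring
      nlinarith
    have e4 : 0 < |θ| := by
      by_contra h
      have : |θ| = 0 := le_antisymm (not_lt.1 h) (abs_nonneg _)
      rw [this] at e3; linarith
    nlinarith
  have hrq : q < r := by
    have e1 : |η| * (Q' + 1) ≤ 1 := by rwa [le_div_iff₀ (by positivity)] at hr
    have e2 : c * (Q' + 1) ≤ r := by
      calc c * (Q' + 1) ≤ (r * |η|) * (Q' + 1) :=
            mul_le_mul_of_nonneg_right h2 (by positivity)
        _ = r * (|η| * (Q' + 1)) := by ring
        _ ≤ r * 1 := by gcongr
        _ = r := mul_one _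
    have : (q : ℝ) < r := by nlinarith
    exact_mod_cast this
  have hsum : (q + r : ℝ) ≤ Q * (2 + 1 / c) := by
    have : (1 : ℝ) ≤ Q := by exact_mod_cast hQ
    have e : Q * (2 + 1 / c) = Q + Q + Q / c := by ring
    linarith
  have hηQ : |η| < 1 / Q := hηθ.trans hθQ
  have hθ0 : θ ≠ 0 := by
    intro h; rw [h] at h1; simp at h1; linarith
  have hη0 : η ≠ 0 := by
    intro h; rw [h] at h2; simp at h2; linarith
  have hcast : ((r - q : ℕ) : ℝ) = r - q := by rw [Nat.cast_sub hrq.le]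
  rcases lt_or_gt_of_ne hθ0 with hs | hs
  · rw [abs_of_neg hs] at hθQ hηθ
    rcases lt_or_gt_of_ne hη0 with hs' | hs'
    · rw [abs_of_neg hs'] at hηθ hηQ
      refine ⟨r - q, q, by omega, ?_, round (r * α) - round (q * α), round (q * α), ?_, ?_, ?_, ?_⟩
      · rw [hcast]; linarith
      all_goals (try rw [hcast]); push_cast; linarith
    · rw [abs_of_pos hs'] at hηθ hηQ
      refine ⟨r, q, hr0, by linarith, round (r * α), round (q * α), ?_, ?_, ?_, ?_⟩ <;> linarith
  · rw [abs_of_pos hs] at hθQ hηθ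
    rcases lt_or_gt_of_ne hη0 with hs' | hs'
    · rw [abs_of_neg hs'] at hηθ hηQ
      refine ⟨q, r, hq0, by linarith, round (q * α), round (r * α), ?_, ?_, ?_, ?_⟩ <;> linarith
    · rw [abs_of_pos hs'] at hηθ hηQ
      refine ⟨q, r - q, hq0, ?_, round (q * α), round (r * α) - round (q * α), ?_, ?_, ?_, ?_⟩
      · rw [hcast]; linarith
      all_goals (try rw [hcast]); push_cast; linarith

theorem exists_mem_Ico_of_two_sided {α : ℝ} {p q : ℕ} {P R : ℤ} {s : ℝ} (hp0 : 0 < p)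
    (hp : 0 < p * α - P) (hps : p * α - P ≤ s) (hq : 0 < R - q * α) (hqs : R - q * α ≤ s)
    (x y : ℝ) : ∃ i < p + q, ∃ k : ℤ, x + i * α + k ∈ Set.Ico y (y + s) := by
  by_contra hcon
  push Not at hcon
  set m := min (p * α - P) (R - q * α) with hm
  have hm0 : 0 < m := lt_min hp hq
  have hq1 : 0 < p + q := by omega
  set k₀ : ℤ := ⌈y - x⌉ - 1 with hk₀
  have hstart : x + k₀ < y := by
    have := Int.ceil_lt_add_one (y - x)
    rw [hk₀]; push_cast; linarith
  have key : ∀ n : ℕ, ∃ i < p + q, ∃ k : ℤ, x + i * α + k < y ∧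
      x + k₀ + n * m ≤ x + i * α + k := by
    intro n
    induction n with
    | zero => exact ⟨0, hq1, k₀, by simpa using hstart, by simp⟩
    | succ n ih =>
      obtain ⟨i, hi, k, h1, h2⟩ := ih
      rcases lt_or_ge i q with hiq | hiq
      · refine ⟨i + p, by omega, k - P, ?_, ?_⟩
        · have := hcon (i + p) (by omega) (k - P)
          by_contra h
          apply this
          push_cast at h ⊢
          exact ⟨by linarith, by linarith⟩
        · have := min_le_left (p * α - P) (R - q * α)
          push_cast
          linarith
      · obtain ⟨j, rfl⟩ := Nat.exists_eq_add_of_le hiq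
        refine ⟨j, by omega, k + R, ?_, ?_⟩
        · have := hcon j (by omega) (k + R)
          by_contra h
          apply this
          push_cast at h h1 ⊢
          exact ⟨by linarith, by linarith⟩
        · have := min_le_right (p * α - P) (R - q * α)
          push_cast at h2 ⊢
          linarith
  obtain ⟨n, hn⟩ := exists_nat_gt ((y - x - k₀) / m)
  rw [div_lt_iff₀ hm0] at hn
  obtain ⟨i, -, k, h1, h2⟩ := key n
  linarith

/-- Every arc of length `h` is hit by `n` consecutive points of the orbit if `n h` is large. -/
theorem BadlyApproximable.exists_mem_Ico {α c : ℝ} (hα : BadlyApproximable α c) {n : ℕ} {h : ℝ}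
    (h0 : 0 < h) (h1 : h ≤ 1) (hn : 2 * (2 + 1 / c) ≤ n * h) (x y : ℝ) :
    ∃ i < n, ∃ k : ℤ, x + i * α + k ∈ Set.Ico y (y + h) := by
  set Q : ℕ := ⌈1 / h⌉₊ with hQ
  have hQ1 : 1 / h ≤ Q := Nat.le_ceil _
  have hQ2 : (Q : ℝ) < 1 / h + 1 := Nat.ceil_lt_add_one (by positivity)
  have hQ0 : (0 : ℝ) < Q := lt_of_lt_of_le (by positivity) hQ1
  have hQh : 1 / (Q : ℝ) ≤ h := by
    rw [div_le_iff₀ hQ0]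
    rw [div_le_iff₀ h0] at hQ1
    linarith
  have hQ3 : (Q : ℝ) * h ≤ 2 := by
    have : (Q : ℝ) * h ≤ (1 / h + 1) * h := mul_le_mul_of_nonneg_right hQ2.le h0.le
    have e : (1 / h + 1) * h = 1 + h := by field_simp
    linarith
  obtain ⟨p, q, hp0, hpq, P, R, ha, hb, hd, he⟩ :=
    hα.exists_two_sided (Q := Q) (by exact_mod_cast hQ0)
  obtain ⟨i, hi, k, hk⟩ :=
    exists_mem_Ico_of_two_sided hp0 ha (hb.le.trans hQh) hd (he.le.trans hQh) x y
  refine ⟨i, lt_of_lt_of_le hi ?_, k, hk⟩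
  have hc := hα.1
  have : (p + q : ℝ) ≤ n := by
    have e1 : (p + q : ℝ) * h ≤ n * h := by
      calc (p + q : ℝ) * h ≤ (Q * (2 + 1 / c)) * h := mul_le_mul_of_nonneg_right hpq h0.le
        _ = (Q * h) * (2 + 1 / c) := by ring
        _ ≤ 2 * (2 + 1 / c) := mul_le_mul_of_nonneg_right hQ3 (by positivity)
        _ ≤ _ := hn
    exact le_of_mul_le_mul_right e1 h0
  exact_mod_cast this

theorem BadlyApproximable.le_abs_sub {α c : ℝ} (hα : BadlyApproximable α c) {L i j : ℕ}
    (hij : i ≠ j) (hL : ((i : ℤ) - j).natAbs ≤ L) (x : ℝ) (k : ℤ) :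
    c / L ≤ |(x + i * α) - (x + j * α) - k| := by
  have hL0 : 0 < L := by omega
  have hL' : (0 : ℝ) < L := by exact_mod_cast hL0
  have key : ∀ i j : ℕ, j < i → ((i : ℤ) - j).natAbs ≤ L → ∀ k : ℤ,
      c / L ≤ |(x + i * α) - (x + j * α) - k| := by
    intro i j hij hL k
    have h := hα.2 (i - j) (by omega) k
    have hle : ((i - j : ℕ) : ℝ) ≤ L := by
      have : i - j ≤ L := by omega
      exact_mod_cast this
    rw [div_le_iff₀ hL']
    rw [Nat.cast_sub hij.le] at h hle
    have e : (x + i * α) - (x + j * α) - k = (i - j) * α - k := by ring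
    rw [e]
    calc c ≤ _ := h
      _ ≤ L * |((i : ℝ) - j) * α - k| := mul_le_mul_of_nonneg_right hle (abs_nonneg _)
      _ = _ := mul_comm _ _
  rcases lt_or_gt_of_ne hij with h | h
  · have := key j i h (by omega) (-k)
    rw [← abs_neg]
    convert this using 2
    push_cast; ring
  · exact key i j h hL k

/-! ### Increments of a monotone quasi-periodic function along an orbit -/

/-- A continuous monotone lift `G` of a circle-valued map: the distribution function of a finite
continuous measure of mass `g` on the circle. -/
structure IsCircleDistribution (G : ℝ → ℝ) (g : ℝ) : Prop where
  mono : Monotone G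
  cont : Continuous G
  add_one : ∀ x, G (x + 1) = G x + g

namespace IsCircleDistribution

variable {G : ℝ → ℝ} {g : ℝ}

theorem add_int (hG : IsCircleDistribution G g) (x : ℝ) (k : ℤ) : G (x + k) = G x + k * g := by
  induction k using Int.induction_on with
  | zero => simp
  | succ n ih =>
    push_cast at ih ⊢
    rw [← add_assoc, hG.add_one, ih]; ring
  | pred n ih =>
    have := hG.add_one (x + ((-(n : ℤ) - 1 : ℤ) : ℝ))
    push_cast at this ih ⊢
    have e : x + (-(n : ℝ) - 1) + 1 = x + -n := by ring
    rw [e, ih] at this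
    linarith

theorem mass_nonneg (hG : IsCircleDistribution G g) : 0 ≤ g := by
  have := hG.add_one 0
  have h2 := hG.mono (show (0 : ℝ) ≤ 0 + 1 by norm_num)
  linarith

/-- The associated Stieltjes function. -/
def stieltjes (hG : IsCircleDistribution G g) : StieltjesFunction ℝ where
  toFun := G
  mono' := hG.mono
  right_continuous' _ := hG.cont.continuousWithinAt

theorem sub_fract (hG : IsCircleDistribution G g) (x a b : ℝ) :
    G (x + a) - G (x + b) = G (Int.fract x + a) - G (Int.fract x + b) := by
  have h1 := hG.add_int (Int.fract x + a) ⌊x⌋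
  have h2 := hG.add_int (Int.fract x + b) ⌊x⌋
  have e : ∀ t, Int.fract x + t + ⌊x⌋ = x + t := fun t => by
    rw [Int.fract]; ring
  rw [e] at h1 h2
  linarith

theorem sum_sub_le_of_separated (hG : IsCircleDistribution G g) {ι : Type*} (s : Finset ι)
    (y : ι → ℝ) {w : ℝ} (hw0 : 0 ≤ w) (hw1 : w ≤ 1)
    (hsep : ∀ i ∈ s, ∀ j ∈ s, i ≠ j → ∀ k : ℤ, w ≤ |y i - y j - k|) :
    ∑ i ∈ s, (G (y i + w) - G (y i)) ≤ 2 * g := by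
  set m := hG.stieltjes.measure with hm
  set I : ι → Set ℝ := fun i => Set.Ioc (Int.fract (y i)) (Int.fract (y i) + w) with hI
  have hmI : ∀ i, m (I i) = ENNReal.ofReal (G (y i + w) - G (y i)) := by
    intro i
    have := hG.sub_fract (y i) w 0
    simp only [add_zero] at this
    rw [this]
    exact hG.stieltjes.measure_Ioc _ _
  have hdisj : (s : Set ι).PairwiseDisjoint I := by
    intro i hi j hj hij
    rw [Function.onFun, Set.disjoint_left]
    rintro z ⟨h1, h2⟩ ⟨h3, h4⟩
    have := hsep i hi j hj hij (⌊y i⌋ - ⌊y j⌋)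
    have e : y i - y j - ((⌊y i⌋ - ⌊y j⌋ : ℤ) : ℝ) = Int.fract (y i) - Int.fract (y j) := by
      push_cast; rw [Int.fract, Int.fract]; ring
    rw [e] at this
    rcases le_abs.1 this with h | h <;> linarith
  have hsub : (⋃ i ∈ s, I i) ⊆ Set.Ioc 0 2 := by
    intro z hz
    simp only [Set.mem_iUnion] at hz
    obtain ⟨i, -, h1, h2⟩ := hz
    have h3 := Int.fract_nonneg (y i)
    have h4 := Int.fract_lt_one (y i)
    exact ⟨by linarith, by linarith⟩
  have hle := measure_mono (μ := m) hsub
  rw [measure_biUnion_finset hdisj (fun i _ => measurableSet_Ioc)] at hle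
  simp_rw [hmI] at hle
  rw [← ENNReal.ofReal_sum_of_nonneg
    (fun i _ => sub_nonneg.2 (hG.mono (by linarith)))] at hle
  have h02 : m (Set.Ioc 0 2) = ENNReal.ofReal (2 * g) := by
    rw [hm, StieltjesFunction.measure_Ioc]
    congr 1
    have := hG.add_int 0 2
    change G 2 - G 0 = _
    norm_num at this
    linarith
  rw [h02, ENNReal.ofReal_le_ofReal_iff (by linarith [hG.mass_nonneg])] at hle
  exact hle

theorem le_sum_sub_of_cover (hG : IsCircleDistribution G g) {ι : Type*} (s : Finset ι)
    (y : ι → ℝ) {w : ℝ} (hw0 : 0 ≤ w) (hw1 : w ≤ 1)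
    (hcov : ∀ z, ∃ i ∈ s, ∃ k : ℤ, y i + k ∈ Set.Ico z (z + w)) :
    g ≤ 2 * ∑ i ∈ s, (G (y i + w) - G (y i)) := by
  set m := hG.stieltjes.measure with hm
  set I : ℝ → ι → Set ℝ := fun e i => Set.Ioc (Int.fract (y i) + e) (Int.fract (y i) + e + w) with hI
  have hmI : ∀ e : ℤ, ∀ i, m (I e i) = ENNReal.ofReal (G (y i + w) - G (y i)) := by
    intro e i
    have := hG.sub_fract (y i) (e + w) e
    simp only [hI]
    rw [hm, StieltjesFunction.measure_Ioc]
    congr 1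
    change G _ - G _ = _
    rw [add_assoc, ← this]
    have e1 := hG.add_int (y i + w) e
    have e2 := hG.add_int (y i) e
    rw [show y i + (e + w) = y i + w + e by ring]
    linarith
  have hsub : Set.Ioc (1 : ℝ) 2 ⊆ (⋃ i ∈ s, I (0 : ℤ) i) ∪ (⋃ i ∈ s, I (1 : ℤ) i) := by
    rintro z ⟨hz1, hz2⟩
    obtain ⟨i, hi, k, hk1, hk2⟩ := hcov (z - w)
    have h3 := Int.fract_nonneg (y i)
    have h4 := Int.fract_lt_one (y i)
    have e : y i + k = Int.fract (y i) + ((⌊y i⌋ + k : ℤ) : ℝ) := by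
      push_cast; rw [Int.fract]; ring
    rw [e] at hk1 hk2
    set l := ⌊y i⌋ + k
    have hl1 : l < 2 := by
      have : (l : ℝ) < 2 := by linarith
      exact_mod_cast this
    have hl2 : -1 < l := by
      have : (-1 : ℝ) < l := by linarith
      exact_mod_cast this
    have hl : l = 0 ∨ l = 1 := by omega
    rcases hl with hl | hl
    · left
      simp only [Set.mem_iUnion]
      refine ⟨i, hi, ?_⟩
      rw [hl] at hk1 hk2
      exact ⟨by linarith, by linarith⟩
    · right
      simp only [Set.mem_iUnion]
      refine ⟨i, hi, ?_⟩
      rw [hl] at hk1 hk2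
      exact ⟨by linarith, by linarith⟩
  have hle := measure_mono (μ := m) hsub
  have hle2 := hle.trans ((measure_union_le _ _).trans
    (add_le_add (measure_biUnion_finset_le s _) (measure_biUnion_finset_le s _)))
  simp_rw [hmI] at hle2
  rw [← ENNReal.ofReal_sum_of_nonneg
    (fun i _ => sub_nonneg.2 (hG.mono (by linarith))), ← two_mul] at hle2
  have h12 : m (Set.Ioc 1 2) = ENNReal.ofReal g := by
    rw [hm, StieltjesFunction.measure_Ioc]
    congr 1
    have := hG.add_one 1
    change G 2 - G 1 = _
    norm_num at this
    linarith
  have hs0 : 0 ≤ ∑ i ∈ s, (G (y i + w) - G (y i)) :=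
    Finset.sum_nonneg (fun i _ => sub_nonneg.2 (hG.mono (by linarith)))
  rw [h12, show (2 : ENNReal) = ENNReal.ofReal 2 by simp, ← ENNReal.ofReal_mul (by norm_num),
    ENNReal.ofReal_le_ofReal_iff (by positivity)] at hle2
  exact hle2

/-- Sum of the increments over a block of the orbit whose arcs are much shorter than its gaps. -/
theorem sum_sub_le (hG : IsCircleDistribution G g) {α c : ℝ} (hα : BadlyApproximable α c)
    (A L : ℕ) {w : ℝ} (hw0 : 0 ≤ w) (hw1 : w ≤ 1) (hL : w * L ≤ c) (x : ℝ) :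
    ∑ i ∈ Finset.Ico A (A + L), (G (x + i * α + w) - G (x + i * α)) ≤ 2 * g := by
  refine hG.sum_sub_le_of_separated _ (fun i : ℕ => x + i * α) hw0 hw1 ?_
  intro i hi j hj hij k
  rw [Finset.mem_Ico] at hi hj
  refine le_trans ?_ (hα.le_abs_sub (L := L) hij (by omega) x k)
  have : 0 < L := by omega
  rw [le_div_iff₀ (by exact_mod_cast this)]
  exact hL

theorem sum_sub_le_mul (hG : IsCircleDistribution G g) {α c : ℝ} (hα : BadlyApproximable α c)
    (A L K : ℕ) {w : ℝ} (hw0 : 0 ≤ w) (hw1 : w ≤ 1) (hL : w * L ≤ c) (x : ℝ) :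
    ∑ i ∈ Finset.Ico A (A + L), (G (x + i * α + K * w) - G (x + i * α)) ≤ K * (2 * g) := by
  induction K with
  | zero => simp
  | succ K ih =>
    have h := hG.sum_sub_le hα A L hw0 hw1 hL (x + K * w)
    have e : ∀ i : ℕ, G (x + i * α + ((K + 1 : ℕ) : ℝ) * w) - G (x + i * α) =
        (G (x + i * α + K * w) - G (x + i * α)) +
          (G (x + K * w + i * α + w) - G (x + K * w + i * α)) := by
      intro i
      rw [show x + K * w + i * α = x + i * α + K * w by ring,
        show x + i * α + ((K + 1 : ℕ) : ℝ) * w = x + i * α + K * w + w by push_cast; ring]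
      ring
    simp_rw [e]
    rw [Finset.sum_add_distrib]
    push_cast
    linarith

end IsCircleDistribution

/-! ### Crossings of a finite set -/

/-- The arc `[z, z + h]` meets the set `F`. -/
def ArcMeets (F : Set UnitAddCircle) (h z : ℝ) : Prop :=
  ∃ t ∈ Set.Icc z (z + h), (t : UnitAddCircle) ∈ F

open Classical in
theorem BadlyApproximable.card_arcMeets_singleton_le {α c : ℝ} (hα : BadlyApproximable α c)
    (n : ℕ) {h : ℝ} (h0 : 0 < h) (x : ℝ) (β : UnitAddCircle) :
    (((Finset.range n).filter (fun i : ℕ => ArcMeets {β} h (x + i * α))).card : ℝ) ≤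
      n * h / c + 1 := by
  have hc := hα.1
  set s := (Finset.range n).filter (fun i : ℕ => ArcMeets {β} h (x + i * α)) with hs
  have hcard : s.card ≤ (Finset.range (⌊n * h / c⌋₊ + 1)).card := by
    refine Finset.card_le_card_of_injOn (fun i : ℕ => ⌊i * h / c⌋₊) ?_ ?_
    · intro i hi
      rw [Finset.mem_coe, hs, Finset.mem_filter, Finset.mem_range] at hi
      rw [Finset.mem_coe, Finset.mem_range, Nat.lt_succ_iff]
      apply Nat.floor_mono
      have : (i : ℝ) ≤ n := by exact_mod_cast hi.1.le
      gcongr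
    · have key : ∀ i ∈ s, ∀ j ∈ s, j < i → ⌊j * h / c⌋₊ < ⌊i * h / c⌋₊ := by
        intro i hi j hj hij
        rw [hs, Finset.mem_filter] at hi hj
        obtain ⟨-, a, ⟨ha1, ha2⟩, haβ⟩ := hi
        obtain ⟨-, b, ⟨hb1, hb2⟩, hbβ⟩ := hj
        rw [Set.mem_singleton_iff] at haβ hbβ
        have hab : ((a - b : ℝ) : UnitAddCircle) = 0 := by
          rw [AddCircle.coe_sub, haβ, hbβ, sub_self]
        obtain ⟨k, hk⟩ := (AddCircle.coe_eq_zero_iff (1 : ℝ)).1 hab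
        simp only [zsmul_eq_mul, mul_one] at hk
        have h1 := hα.2 (i - j) (by omega) k
        have hji : (j : ℝ) < i := by exact_mod_cast hij
        rw [Nat.cast_sub hij.le] at h1
        have h2 : |((i : ℝ) - j) * α - k| ≤ h := by
          rw [hk, abs_le]
          constructor <;> linarith
        have h3 : c ≤ (i - j) * h := h1.trans (mul_le_mul_of_nonneg_left h2 (by linarith))
        have h4 : j * h / c + 1 ≤ i * h / c := by
          rw [div_add_one hc.ne']
          gcongr
          linarith
        rw [← Nat.succ_le_iff, Nat.le_floor_iff (by positivity)]
        push_cast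
        exact (add_le_add_left (Nat.floor_le (by positivity)) 1).trans h4
      intro i hi j hj hij
      by_contra hne
      rcases lt_or_gt_of_ne hne with h | h
      · exact absurd hij (key j hj i hi h).ne
      · exact absurd hij (key i hi j hj h).ne'
  rw [Finset.card_range] at hcard
  calc (s.card : ℝ) ≤ ((⌊n * h / c⌋₊ + 1 : ℕ) : ℝ) := by exact_mod_cast hcard
    _ ≤ _ := by
      push_cast
      gcongr
      exact Nat.floor_le (by positivity)

open Classical in
theorem BadlyApproximable.card_arcMeets_le {α c : ℝ} (hα : BadlyApproximable α c)
    (n : ℕ) {h : ℝ} (h0 : 0 < h) (x : ℝ) (F : Finset UnitAddCircle) :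
    (((Finset.range n).filter (fun i : ℕ => ArcMeets F h (x + i * α))).card : ℝ) ≤
      F.card * (n * h / c + 1) := by
  have hsub : (Finset.range n).filter (fun i : ℕ => ArcMeets F h (x + i * α)) ⊆
      F.biUnion fun β => (Finset.range n).filter (fun i : ℕ => ArcMeets {β} h (x + i * α)) := by
    intro i hi
    rw [Finset.mem_filter] at hi
    obtain ⟨hi, t, ht, htF⟩ := hi
    rw [Finset.mem_biUnion]
    exact ⟨_, htF, Finset.mem_filter.2 ⟨hi, t, ht, rfl⟩⟩
  have h1 := (Finset.card_le_card hsub).trans Finset.card_biUnion_le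
  calc _ ≤ ((∑ β ∈ F, ((Finset.range n).filter
        (fun i : ℕ => ArcMeets {β} h (x + i * α))).card : ℕ) : ℝ) := by exact_mod_cast h1
    _ ≤ ∑ β ∈ F, (n * h / c + 1) := by
      push_cast
      exact Finset.sum_le_sum fun β _ => hα.card_arcMeets_singleton_le n h0 x β
    _ = _ := by rw [Finset.sum_const, nsmul_eq_mul]

end

noncomputable section

/-! ### Cantor functions of quasi-similar Cantor sets -/

/-- The piecewise linear function that is `0` on `(-∞, 0]`, `1` on `[1, ∞)` and `t` in between. -/
def clamp (t : ℝ) : ℝ := max 0 (min 1 t)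

theorem clamp_of_nonpos {t : ℝ} (h : t ≤ 0) : clamp t = 0 := by
  rw [clamp, max_eq_left]; exact (min_le_right _ _).trans h

theorem clamp_of_one_le {t : ℝ} (h : 1 ≤ t) : clamp t = 1 := by
  rw [clamp, min_eq_left h, max_eq_right zero_le_one]

theorem clamp_nonneg (t : ℝ) : 0 ≤ clamp t := le_max_left _ _

theorem clamp_le_one (t : ℝ) : clamp t ≤ 1 := max_le zero_le_one (min_le_left _ _)

theorem clamp_mono : Monotone clamp := fun _ _ h => max_le_max le_rfl (min_le_min le_rfl h)

theorem continuous_clamp : Continuous clamp := by unfold clamp; fun_prop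

namespace QuasiSimilarCantor

variable (C : QuasiSimilarCantor)

theorem two_le_k (i : ℕ) : 2 ≤ C.k i := by
  have h : C.D i ⊆ Finset.range (C.k i) := fun d hd => Finset.mem_range.2 (C.lt_k i d hd)
  have := (C.two_le_card i).trans (Finset.card_le_card h)
  simpa using this

theorem kProd_succ (n : ℕ) : C.kProd (n + 1) = C.kProd n * C.k n := Finset.prod_range_succ _ _

theorem mProd_succ (n : ℕ) : C.mProd (n + 1) = C.mProd n * C.m n := Finset.prod_range_succ _ _

theorem two_pow_mul_mProd_le (n i : ℕ) : 2 ^ i * C.mProd n ≤ C.mProd (n + i) := by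
  induction i with
  | zero => simp
  | succ i ih =>
    rw [← add_assoc, mProd_succ, pow_succ]
    calc 2 ^ i * 2 * C.mProd n = (2 ^ i * C.mProd n) * 2 := by ring
      _ ≤ _ := Nat.mul_le_mul ih (C.two_le_card _)

theorem mProd_pos (n : ℕ) : 0 < C.mProd n :=
  Finset.prod_pos fun i _ => lt_of_lt_of_le (by norm_num) (C.two_le_card i)

theorem kProd_pos (n : ℕ) : 0 < C.kProd n :=
  Finset.prod_pos fun i _ => lt_of_lt_of_le (by norm_num) (C.two_le_k i)

theorem two_pow_le_kProd (n : ℕ) : 2 ^ n ≤ C.kProd n := by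
  induction n with
  | zero => simp [kProd]
  | succ n ih => rw [kProd_succ, pow_succ]; exact Nat.mul_le_mul ih (C.two_le_k _)

theorem kProd_mono : Monotone C.kProd := by
  refine monotone_nat_of_le_succ fun n => ?_
  rw [kProd_succ]
  exact Nat.le_mul_of_pos_right _ (lt_of_lt_of_le (by norm_num) (C.two_le_k n))

theorem exists_kProd_add (n i : ℕ) {B : ℕ} (hB : ∀ i, C.k i ≤ B) :
    ∃ Q : ℕ, 0 < Q ∧ Q ≤ B ^ i ∧ C.kProd (n + i) = C.kProd n * Q := by
  induction i with
  | zero => exact ⟨1, by simp, by simp, by simp⟩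
  | succ i ih =>
    obtain ⟨Q, h0, h1, h2⟩ := ih
    refine ⟨Q * C.k (n + i), ?_, ?_, ?_⟩
    · exact Nat.mul_pos h0 (lt_of_lt_of_le (by norm_num) (C.two_le_k _))
    · rw [pow_succ]; exact Nat.mul_le_mul h1 (hB _)
    · rw [← add_assoc, kProd_succ, h2, mul_assoc]

/-- Numerators of the left endpoints at step `n`, over the denominator `k₁ ⋯ kₙ`. -/
def numerators : ℕ → Finset ℕ
  | 0 => {0}
  | n + 1 => (numerators n ×ˢ C.D n).image fun p => p.1 * C.k n + p.2

theorem injOn_numerators (n : ℕ) : Set.InjOn (fun p : ℕ × ℕ => p.1 * C.k n + p.2)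
    (C.numerators n ×ˢ C.D n : Finset (ℕ × ℕ)) := by
  rintro ⟨a, d⟩ h1 ⟨b, e⟩ h2 h
  simp only [Finset.coe_product, Set.mem_prod, Finset.mem_coe] at h1 h2 h
  have hd := C.lt_k n d h1.2
  have he := C.lt_k n e h2.2
  have hk : 0 < C.k n := by omega
  have hab : a = b := by
    have h3 : (a * C.k n + d) / C.k n = (b * C.k n + e) / C.k n := by rw [h]
    rwa [mul_comm a, mul_comm b, Nat.mul_add_div hk, Nat.mul_add_div hk, Nat.div_eq_of_lt hd,
      Nat.div_eq_of_lt he, add_zero, add_zero] at h3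
  subst hab
  rw [Prod.mk.injEq]
  exact ⟨rfl, by omega⟩

theorem leftEndpoints_eq (n : ℕ) :
    C.leftEndpoints n = (fun a : ℕ => (a : ℝ) / C.kProd n) '' (C.numerators n) := by
  induction n with
  | zero => simp [leftEndpoints, numerators]
  | succ n ih =>
    have hk : (C.k n : ℝ) ≠ 0 := by have := C.two_le_k n; positivity
    have hK : (C.kProd n : ℝ) ≠ 0 := by have := C.kProd_pos n; positivity
    have e : ∀ a d : ℕ, (a : ℝ) / C.kProd n + d / C.kProd (n + 1) =
        ((a * C.k n + d : ℕ) : ℝ) / C.kProd (n + 1) := by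
      intro a d
      rw [kProd_succ]; push_cast; field_simp
    ext y
    rw [leftEndpoints, ih, numerators]
    constructor
    · rintro ⟨_, ⟨a, ha, rfl⟩, d, hd, rfl⟩
      refine ⟨a * C.k n + d, ?_, (e a d).symm⟩
      rw [Finset.mem_coe, Finset.mem_image]
      exact ⟨(a, d), Finset.mem_product.2 ⟨ha, hd⟩, rfl⟩
    · rintro ⟨_, hb, rfl⟩
      rw [Finset.mem_coe, Finset.mem_image] at hb
      obtain ⟨⟨a, d⟩, had, rfl⟩ := hb
      rw [Finset.mem_product] at had
      exact ⟨_, ⟨a, had.1, rfl⟩, d, had.2, (e a d).symm⟩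

theorem approx_eq (n : ℕ) (x : ℝ) :
    C.approx n x = 1 / C.mProd n * ∑ a ∈ C.numerators n, clamp (C.kProd n * x - a) := by
  have hK : (0 : ℝ) < C.kProd n := by exact_mod_cast C.kProd_pos n
  set K : ℝ := ((C.kProd n : ℕ) : ℝ) with hKdef
  have hlev : C.level n ∩ Set.Iic x =
      ⋃ a ∈ C.numerators n, (Set.Icc ((a : ℝ) / K) ((a : ℝ) / K + 1 / K) ∩ Set.Iic x) := by
    rw [level, leftEndpoints_eq, Set.biUnion_image, Set.iUnion₂_inter]
    rfl
  have hmeas : ∀ a : ℕ, volume (Set.Icc ((a : ℝ) / K) ((a : ℝ) / K + 1 / K) ∩ Set.Iic x) =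
      ENNReal.ofReal (clamp (K * x - a) / K) := by
    intro a
    have e1 : Set.Icc ((a : ℝ) / K) ((a : ℝ) / K + 1 / K) ∩ Set.Iic x =
        Set.Icc ((a : ℝ) / K) (min ((a : ℝ) / K + 1 / K) x) := by
      ext z; simp only [Set.mem_inter_iff, Set.mem_Icc, Set.mem_Iic, le_min_iff]; tauto
    rw [e1, Real.volume_Icc]
    have e2 : min ((a : ℝ) / K + 1 / K) x - a / K = min 1 (K * x - a) / K := by
      rw [← min_div_div_right hK.le, ← min_sub_sub_right]
      congr 1
      · ring
      · field_simp
    rw [e2, clamp]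
    rcases le_total 0 (min 1 (K * x - a)) with h | h
    · rw [max_eq_right h]
    · rw [max_eq_left h, zero_div, ENNReal.ofReal_zero, ENNReal.ofReal_eq_zero]
      exact div_nonpos_of_nonpos_of_nonneg h hK.le
  have hdisj : Set.Pairwise (C.numerators n : Set ℕ) (Function.onFun (AEDisjoint volume)
      fun a : ℕ => Set.Icc ((a : ℝ) / K) ((a : ℝ) / K + 1 / K) ∩ Set.Iic x) := by
    have key : ∀ a b : ℕ, a < b → (Set.Icc ((a : ℝ) / K) ((a : ℝ) / K + 1 / K) ∩ Set.Iic x) ∩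
        (Set.Icc ((b : ℝ) / K) ((b : ℝ) / K + 1 / K) ∩ Set.Iic x) ⊆ {(b : ℝ) / K} := by
      rintro a b hab z ⟨⟨⟨-, h1⟩, -⟩, ⟨⟨h2, -⟩, -⟩⟩
      have hab' : (a : ℝ) + 1 ≤ b := by exact_mod_cast hab
      have : (a : ℝ) / K + 1 / K ≤ b / K := by rw [← add_div]; gcongr
      exact le_antisymm (h1.trans this) h2
    intro a _ b _ hab
    rcases lt_or_gt_of_ne hab with h | h
    · exact measure_mono_null (key a b h) (by simp)
    · exact AEDisjoint.symm (measure_mono_null (key b a h) (by simp))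
  have hvol : volume.real (C.level n ∩ Set.Iic x) =
      ∑ a ∈ C.numerators n, clamp (K * x - a) / K := by
    rw [hlev, Measure.real, measure_biUnion_finset₀ hdisj
      (fun a _ => (measurableSet_Icc.inter measurableSet_Iic).nullMeasurableSet)]
    simp_rw [hmeas]
    rw [← ENNReal.ofReal_sum_of_nonneg (fun a _ => div_nonneg (clamp_nonneg _) hK.le),
      ENNReal.toReal_ofReal (Finset.sum_nonneg fun a _ => div_nonneg (clamp_nonneg _) hK.le)]
  rw [approx, hvol, ← Finset.sum_div, ← hKdef]
  field_simp

/-- The distribution function of one subdivision step, rescaled to the unit interval. -/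
def stepFun (n : ℕ) (t : ℝ) : ℝ := 1 / C.m n * ∑ d ∈ C.D n, clamp (C.k n * t - d)

theorem stepFun_of_nonpos {n : ℕ} {t : ℝ} (h : t ≤ 0) : C.stepFun n t = 0 := by
  rw [stepFun, Finset.sum_eq_zero, mul_zero]
  intro d _
  apply clamp_of_nonpos
  have : (C.k n : ℝ) * t ≤ 0 := mul_nonpos_of_nonneg_of_nonpos (by positivity) h
  have : (0 : ℝ) ≤ d := by positivity
  linarith

theorem stepFun_of_one_le {n : ℕ} {t : ℝ} (h : 1 ≤ t) : C.stepFun n t = 1 := by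
  have hm : (C.m n : ℝ) ≠ 0 := by
    have : 2 ≤ C.m n := C.two_le_card n
    positivity
  rw [stepFun, Finset.sum_congr rfl (g := fun _ => (1 : ℝ)), Finset.sum_const, nsmul_eq_mul,
    mul_one, ← m, one_div, inv_mul_cancel₀ hm]
  intro d hd
  apply clamp_of_one_le
  have h1 : (d : ℝ) + 1 ≤ C.k n := by exact_mod_cast C.lt_k n d hd
  nlinarith

theorem stepFun_mem (n : ℕ) (t : ℝ) : 0 ≤ C.stepFun n t ∧ C.stepFun n t ≤ 1 := by
  have hm : (0 : ℝ) < C.m n := by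
    have : 2 ≤ C.m n := C.two_le_card n
    positivity
  constructor
  · exact mul_nonneg (by positivity) (Finset.sum_nonneg fun d _ => clamp_nonneg _)
  · rw [stepFun, one_div, inv_mul_le_iff₀ hm, mul_one]
    calc _ ≤ ∑ d ∈ C.D n, (1 : ℝ) := Finset.sum_le_sum fun d _ => clamp_le_one _
      _ = _ := by simp [m]

theorem approx_succ (n : ℕ) (x : ℝ) :
    C.approx (n + 1) x = 1 / C.mProd n * ∑ a ∈ C.numerators n, C.stepFun n (C.kProd n * x - a) := by
  rw [approx_eq, numerators, Finset.sum_image (C.injOn_numerators n), Finset.sum_product]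
  simp_rw [stepFun]
  rw [← Finset.mul_sum, ← mul_assoc, mProd_succ]
  congr 1
  · push_cast; rw [one_div_mul_one_div]
  · refine Finset.sum_congr rfl fun a _ => Finset.sum_congr rfl fun d _ => ?_
    rw [kProd_succ]; push_cast; ring_nf

theorem abs_approx_succ_sub_le (n : ℕ) (x : ℝ) :
    |C.approx (n + 1) x - C.approx n x| ≤ (1 / 2) ^ n := by
  have hM : (0 : ℝ) < C.mProd n := by exact_mod_cast C.mProd_pos n
  have hM2 : (2 : ℝ) ^ n ≤ C.mProd n := by
    have := C.two_pow_mul_mProd_le 0 n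
    simp [mProd] at this
    exact_mod_cast this
  rw [approx_succ, approx_eq, ← mul_sub, ← Finset.sum_sub_distrib, abs_mul,
    abs_of_pos (by positivity)]
  have hsum : |∑ a ∈ C.numerators n,
      (C.stepFun n (C.kProd n * x - a) - clamp (C.kProd n * x - a))| ≤ 1 := by
    have hz : ∀ a : ℕ, a ≠ ⌊C.kProd n * x⌋₊ →
        C.stepFun n (C.kProd n * x - a) - clamp (C.kProd n * x - a) = 0 := by
      intro a ha
      rcases le_or_gt (C.kProd n * x - a) 0 with h | h
      · rw [C.stepFun_of_nonpos h, clamp_of_nonpos h, sub_self]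
      rcases le_or_gt 1 (C.kProd n * x - a) with h' | h'
      · rw [C.stepFun_of_one_le h', clamp_of_one_le h', sub_self]
      · exfalso
        apply ha
        symm
        rw [Nat.floor_eq_iff (by linarith [Nat.cast_nonneg (α := ℝ) a])]
        exact ⟨by linarith, by linarith⟩
    have hb : ∀ t, |C.stepFun n t - clamp t| ≤ 1 := by
      intro t
      have := C.stepFun_mem n t
      have h1 := clamp_nonneg t
      have h2 := clamp_le_one t
      rw [abs_le]; constructor <;> linarith
    by_cases hmem : ⌊C.kProd n * x⌋₊ ∈ C.numerators n
    · rw [Finset.sum_eq_single_of_mem _ hmem (fun a _ ha => hz a ha)]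
      exact hb _
    · rw [Finset.sum_eq_zero (fun a ha => hz a (fun h => hmem (h ▸ ha))), abs_zero]
      exact zero_le_one
  calc _ ≤ 1 / (C.mProd n : ℝ) * 1 := mul_le_mul_of_nonneg_left hsum (by positivity)
    _ ≤ 1 / 2 ^ n := by rw [mul_one]; gcongr
    _ = _ := by rw [one_div_pow]

theorem tendsto_approx (x : ℝ) :
    Tendsto (fun n => C.approx n x) atTop (𝓝 (C.cantorFunction x)) := by
  have : CauchySeq fun n => C.approx n x :=
    cauchySeq_of_le_geometric (1 / 2) 1 (by norm_num) fun n => by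
      rw [dist_comm, Real.dist_eq, one_mul]; exact C.abs_approx_succ_sub_le n x
  exact this.tendsto_limUnder

theorem abs_approx_sub_cantorFunction_le (n : ℕ) (x : ℝ) :
    |C.approx n x - C.cantorFunction x| ≤ 2 * (1 / 2) ^ n := by
  have := dist_le_of_le_geometric_of_tendsto (1 / 2) 1 (by norm_num)
    (f := fun n => C.approx n x) (fun n => by
      rw [dist_comm, Real.dist_eq, one_mul]; exact C.abs_approx_succ_sub_le n x)
    (C.tendsto_approx x) n
  rw [Real.dist_eq] at this
  convert this using 1
  ring

theorem continuous_cantorFunction : Continuous C.cantorFunction := by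
  have h : TendstoUniformly C.approx C.cantorFunction atTop := by
    rw [Metric.tendstoUniformly_iff]
    intro ε hε
    have h1 : Tendsto (fun n : ℕ => 2 * (1 / 2 : ℝ) ^ n) atTop (𝓝 (2 * 0)) :=
      (tendsto_pow_atTop_nhds_zero_of_lt_one (by norm_num) (by norm_num)).const_mul 2
    rw [mul_zero] at h1
    filter_upwards [h1.eventually (gt_mem_nhds hε)] with n hn x
    rw [dist_comm, Real.dist_eq]
    exact (C.abs_approx_sub_cantorFunction_le n x).trans_lt hn
  refine h.continuous (Frequently.of_forall fun n => ?_)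
  have : C.approx n = fun x => 1 / C.mProd n * ∑ a ∈ C.numerators n, clamp (C.kProd n * x - a) :=
    funext (C.approx_eq n)
  rw [this]
  refine continuous_const.mul (continuous_finsetSum _ fun a _ => continuous_clamp.comp ?_)
  fun_prop

theorem monotone_cantorFunction : Monotone C.cantorFunction := by
  intro x y hxy
  refine le_of_tendsto_of_tendsto' (C.tendsto_approx x) (C.tendsto_approx y) fun n => ?_
  rw [approx_eq, approx_eq]
  gcongr
  apply clamp_mono
  gcongr

theorem cantorFunction_eq_approx {n : ℕ} {x : ℝ} {j : ℤ} (hj : C.kProd n * x = j) :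
    C.cantorFunction x = C.approx n x := by
  have key : ∀ i, C.approx (n + i) x = C.approx n x ∧ ∃ j : ℤ, C.kProd (n + i) * x = j := by
    intro i
    induction i with
    | zero => exact ⟨rfl, j, hj⟩
    | succ i ih =>
      obtain ⟨h1, j, hj⟩ := ih
      refine ⟨?_, j * C.k (n + i), ?_⟩
      · rw [← h1, ← add_assoc, approx_succ, approx_eq, hj]
        congr 1
        refine Finset.sum_congr rfl fun a _ => ?_
        rcases le_or_gt (j - a) 0 with h | h
        · have : (j : ℝ) - a ≤ 0 := by exact_mod_cast h
          rw [C.stepFun_of_nonpos this, clamp_of_nonpos this]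
        · have : (1 : ℝ) ≤ j - a := by exact_mod_cast h
          rw [C.stepFun_of_one_le this, clamp_of_one_le this]
      · rw [← add_assoc, kProd_succ]
        push_cast
        rw [← hj]; ring
  refine tendsto_nhds_unique (C.tendsto_approx x) ?_
  refine tendsto_const_nhds.congr' ?_
  filter_upwards [eventually_ge_atTop n] with N hN
  obtain ⟨i, rfl⟩ := Nat.exists_eq_add_of_le hN
  exact (key i).1.symm

theorem cantorFunction_zero : C.cantorFunction 0 = 0 := by
  rw [C.cantorFunction_eq_approx (n := 0) (j := 0) (by simp), approx_eq]
  simp [numerators, clamp]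

theorem cantorFunction_one : C.cantorFunction 1 = 1 := by
  rw [C.cantorFunction_eq_approx (n := 0) (j := 1) (by simp [kProd]), approx_eq]
  simp [numerators, clamp, kProd, mProd]

/-- The lift of the Cantor function to a map of degree one. -/
def cantorLift (x : ℝ) : ℝ := C.cantorFunction (Int.fract x) + ⌊x⌋

theorem cantorLift_of_mem {x : ℝ} (hx : x ∈ Set.Icc (0 : ℝ) 1) :
    C.cantorLift x = C.cantorFunction x := by
  rcases eq_or_lt_of_le hx.2 with h | h
  · rw [cantorLift, h]; simp [cantorFunction_zero, cantorFunction_one]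
  · rw [cantorLift, Int.fract_eq_self.2 ⟨hx.1, h⟩, Int.floor_eq_zero_iff.2 ⟨hx.1, h⟩]; simp

theorem isCircleDistribution_cantorLift : IsCircleDistribution C.cantorLift 1 where
  mono := by
    intro x y hxy
    have hb : ∀ t, 0 ≤ C.cantorFunction (Int.fract t) ∧ C.cantorFunction (Int.fract t) ≤ 1 := by
      intro t
      rw [← C.cantorFunction_zero, ← C.cantorFunction_one]
      exact ⟨C.monotone_cantorFunction (Int.fract_nonneg t),
        C.monotone_cantorFunction (Int.fract_lt_one t).le⟩
    rcases eq_or_lt_of_le (Int.floor_mono hxy) with h | h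
    · rw [cantorLift, cantorLift, h]
      gcongr
      apply C.monotone_cantorFunction
      rw [Int.fract, Int.fract, h]
      linarith
    · have h1 : (⌊x⌋ : ℝ) + 1 ≤ ⌊y⌋ := by exact_mod_cast h
      rw [cantorLift, cantorLift]
      linarith [(hb x).2, (hb y).1]
  cont := by
    have h1 : Continuous fun x : ℝ => (fun t => C.cantorFunction t - t) (Int.fract x) :=
      ContinuousOn.comp_fract'' (C.continuous_cantorFunction.sub continuous_id).continuousOn
        (by simp [cantorFunction_zero, cantorFunction_one])
    have h2 : C.cantorLift = fun x => (C.cantorFunction (Int.fract x) - Int.fract x) + x := by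
      ext x; rw [cantorLift, Int.fract]; ring
    rw [h2]
    exact h1.add continuous_id
  add_one x := by
    rw [cantorLift, cantorLift, Int.fract_add_one, Int.floor_add_one]; push_cast; ring

theorem cantorLift_cell (n : ℕ) (j : ℤ) :
    C.cantorLift ((j + 1 : ℤ) / C.kProd n) - C.cantorLift (j / C.kProd n) = 0 ∨
      C.cantorLift ((j + 1 : ℤ) / C.kProd n) - C.cantorLift (j / C.kProd n) = 1 / C.mProd n := by
  have hK : (0 : ℝ) < C.kProd n := by exact_mod_cast C.kProd_pos n
  have hK' : (0 : ℤ) < C.kProd n := by exact_mod_cast C.kProd_pos n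
  have hcirc := C.isCircleDistribution_cantorLift
  set K : ℤ := ((C.kProd n : ℕ) : ℤ) with hKdef
  have hKR : ((C.kProd n : ℕ) : ℝ) = (K : ℝ) := by rw [hKdef]; push_cast; rfl
  obtain ⟨r, hr⟩ := Int.eq_ofNat_of_zero_le (Int.emod_nonneg j hK'.ne')
  have hrK : (r : ℤ) < K := hr ▸ Int.emod_lt_of_pos j hK'
  have hjr : j = K * (j / K) + r := by rw [← hr]; exact (Int.mul_ediv_add_emod j K).symm
  have hred : ∀ e : ℤ, C.cantorLift ((j + e : ℤ) / C.kProd n) =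
      C.cantorLift ((r + e : ℤ) / C.kProd n) + (j / K : ℤ) := by
    intro e
    have := hcirc.add_int ((r + e : ℤ) / C.kProd n) (j / K)
    rw [mul_one] at this
    rw [← this]
    congr 1
    rw [hKR] at hK ⊢
    rw [div_add' _ _ _ hK.ne']
    congr 1
    rw [mul_comm]
    have : j + e = r + e + K * (j / K) := by linarith
    exact_mod_cast congrArg (fun z : ℤ => (z : ℝ)) this
  have h0 := hred 0
  rw [add_zero, add_zero] at h0
  rw [hred 1, h0, add_sub_add_right_eq_sub]
  have hcell : ∀ e : ℤ, 0 ≤ e → e ≤ 1 → C.cantorLift ((r + e : ℤ) / C.kProd n) =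
      1 / C.mProd n * ∑ a ∈ C.numerators n, clamp ((r + e : ℤ) - a) := by
    intro e h0 h1
    have hmem : (((r + e : ℤ) : ℝ) / C.kProd n) ∈ Set.Icc (0 : ℝ) 1 := by
      constructor
      · have : (0 : ℝ) ≤ (r + e : ℤ) := by exact_mod_cast (by omega : (0 : ℤ) ≤ r + e)
        positivity
      · rw [div_le_one hK, hKR]; exact_mod_cast (by omega : r + e ≤ K)
    have hmul : (C.kProd n : ℝ) * (((r + e : ℤ) : ℝ) / C.kProd n) = (r + e : ℤ) := by field_simp
    rw [C.cantorLift_of_mem hmem, C.cantorFunction_eq_approx hmul, approx_eq, hmul]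
  have e0 := hcell 0 le_rfl zero_le_one
  rw [add_zero] at e0
  rw [hcell 1 zero_le_one le_rfl, e0, ← mul_sub, ← Finset.sum_sub_distrib]
  have hterm : ∀ a : ℕ, clamp (((r : ℤ) + 1 : ℤ) - a) - clamp ((r : ℤ) - a) =
      if a = r then 1 else 0 := by
    intro a
    push_cast
    rcases lt_trichotomy a r with h | h | h
    · have : (a : ℝ) + 1 ≤ r := by exact_mod_cast h
      rw [if_neg h.ne, clamp_of_one_le (by linarith), clamp_of_one_le (by linarith), sub_self]
    · rw [if_pos h, h, clamp_of_one_le (by linarith), clamp_of_nonpos (by linarith), sub_zero]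
    · have : (r : ℝ) + 1 ≤ a := by exact_mod_cast h
      rw [if_neg h.ne', clamp_of_nonpos (by linarith), clamp_of_nonpos (by linarith), sub_self]
  simp_rw [hterm]
  rw [Finset.sum_ite_eq']
  split_ifs <;> simp

end QuasiSimilarCantor

/-- A circle distribution gives to every short interval a small proportion of the mass of a large
multiple of the interval. -/
def HasScaling (G : ℝ → ℝ) : Prop :=
  ∀ η : ℝ, 0 < η → ∃ K : ℝ, 1 ≤ K ∧ ∃ h₁ : ℝ, 0 < h₁ ∧ ∀ h, 0 < h → h < h₁ → ∀ y,
    G (y + h) - G y ≤ η * (G (y + K * h) - G (y - K * h))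

theorem QuasiSimilarCantor.hasScaling_cantorLift (C : QuasiSimilarCantor) :
    HasScaling C.cantorLift := by
  intro η hη
  obtain ⟨B, hB⟩ := C.bounded_k
  have hmono := C.isCircleDistribution_cantorLift.mono
  obtain ⟨i, hi⟩ : ∃ i : ℕ, (B + 1) * (1 / 2 : ℝ) ^ i ≤ η := by
    have h1 : Tendsto (fun n : ℕ => ((B : ℝ) + 1) * (1 / 2 : ℝ) ^ n) atTop (𝓝 ((B + 1) * 0)) :=
      (tendsto_pow_atTop_nhds_zero_of_lt_one (by norm_num) (by norm_num)).const_mul _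
    rw [mul_zero] at h1
    obtain ⟨i, hi⟩ := (h1.eventually (gt_mem_nhds hη)).exists
    exact ⟨i, hi.le⟩
  have hKpos : ∀ n, (0 : ℝ) < C.kProd n := fun n => by exact_mod_cast C.kProd_pos n
  refine ⟨B ^ i + B + 1, ?_, 1 / C.kProd i, by have := hKpos i; positivity, ?_⟩
  · have : (0 : ℝ) ≤ B ^ i + B := by positivity
    linarith
  intro h h0 hh y
  have hex : ∃ n, 1 / (C.kProd n : ℝ) ≤ h := by
    obtain ⟨n, hn⟩ := exists_nat_gt (1 / h)
    refine ⟨n, ?_⟩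
    rw [div_le_iff₀ (hKpos n)]
    rw [div_lt_iff₀ h0] at hn
    have : (n : ℝ) ≤ C.kProd n := by exact_mod_cast (Nat.lt_two_pow_self).le.trans (C.two_pow_le_kProd n)
    nlinarith
  classical
  set N := Nat.find hex with hN
  have hN1 : 1 / (C.kProd N : ℝ) ≤ h := Nat.find_spec hex
  have hiN : i < N := by
    by_contra hcon
    have h1 : C.kProd N ≤ C.kProd i := C.kProd_mono (not_lt.1 hcon)
    have h2 : 1 / (C.kProd i : ℝ) ≤ 1 / C.kProd N := by
      apply one_div_le_one_div_of_le (hKpos N); exact_mod_cast h1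
    linarith
  obtain ⟨n, hn⟩ := Nat.exists_eq_add_of_le hiN.le
  rw [add_comm] at hn
  have hhB : h * C.kProd N ≤ B := by
    have h1 := Nat.find_min hex (m := N - 1) (by omega)
    rw [not_le, lt_div_iff₀ (hKpos _)] at h1
    have h2 : C.kProd N = C.kProd (N - 1) * C.k (N - 1) := by
      rw [← kProd_succ]; congr 1; omega
    rw [h2]
    push_cast
    have h3 : (C.k (N - 1) : ℝ) ≤ B := by exact_mod_cast hB _
    have h4 : (0 : ℝ) ≤ C.k (N - 1) := by positivity
    nlinarith
  obtain ⟨Q, hQ0, hQB, hKQ⟩ := C.exists_kProd_add n i hB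
  rw [← hn] at hKQ
  set K : ℝ := ((C.kProd N : ℕ) : ℝ) with hK
  have hK0 : 0 < K := hKpos N
  have hKQ' : K = C.kProd n * Q := by rw [hK, hKQ]; push_cast; rfl
  have hn0 := hKpos n
  have hQB' : (Q : ℝ) ≤ B ^ i := by exact_mod_cast hQB
  have hQ0' : (0 : ℝ) < Q := by exact_mod_cast hQ0
  set W := C.cantorLift (y + (B ^ i + B + 1) * h) - C.cantorLift (y - (B ^ i + B + 1) * h) with hW
  have hW0 : 0 ≤ W := by
    rw [hW, sub_nonneg]
    apply hmono
    have : 0 ≤ ((B : ℝ) ^ i + B + 1) * h := by positivity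
    linarith
  set a : ℤ := ⌊y * K⌋ with ha
  have ha1 : (a : ℝ) ≤ y * K := Int.floor_le _
  have ha2 : y * K < a + 1 := Int.lt_floor_add_one _
  have hcell : ∀ l : ℕ, l ≤ B → C.cantorLift ((a + l + 1 : ℤ) / K) - C.cantorLift ((a + l : ℤ) / K)
      ≤ (1 / 2) ^ i * W := by
    intro l hl
    have hlB : (l : ℝ) ≤ B := by exact_mod_cast hl
    rcases C.cantorLift_cell N (a + l) with hc | hc
    · rw [← hK] at hc; rw [hc]; positivity
    · rw [← hK] at hc
      set b : ℤ := (a + l) / Q with hb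
      have hQZ : (0 : ℤ) < Q := by exact_mod_cast hQ0
      have hb1 : b * Q ≤ a + l := Int.ediv_mul_le _ hQZ.ne'
      have hb2 : a + l + 1 ≤ (b + 1) * Q := Int.lt_ediv_add_one_mul_self _ hQZ
      have hb1' : (b : ℝ) * Q ≤ (a + l : ℤ) := by exact_mod_cast hb1
      have hb2' : ((a + l + 1 : ℤ) : ℝ) ≤ (b + 1 : ℤ) * Q := by exact_mod_cast hb2
      have hleft : (b : ℝ) / C.kProd n ≤ (a + l : ℤ) / K := by
        rw [hKQ', div_le_div_iff₀ hn0 (by positivity)]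
        nlinarith
      have hright : ((a + l + 1 : ℤ) : ℝ) / K ≤ (b + 1 : ℤ) / C.kProd n := by
        rw [hKQ', div_le_div_iff₀ (by positivity) hn0]
        nlinarith
      have hlen : ((b + 1 : ℤ) : ℝ) / C.kProd n = b / C.kProd n + Q / K := by
        rw [hKQ']; push_cast; field_simp
      have hQK : (Q : ℝ) / K ≤ B ^ i * h := by
        calc (Q : ℝ) / K = Q * (1 / K) := by ring
          _ ≤ B ^ i * h := mul_le_mul hQB' hN1 (by positivity) (by positivity)
      have hB1 : (B : ℝ) * (1 / K) ≤ B * h := by gcongr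
      have hal1 : y - h ≤ ((a + l : ℤ) : ℝ) / K := by
        have : y ≤ (a + 1) / K := by rw [le_div_iff₀ hK0]; linarith
        have e : ((a + l : ℤ) : ℝ) / K = (a + 1) / K - 1 / K + l / K := by push_cast; ring
        have : (0 : ℝ) ≤ l / K := by positivity
        linarith
      have hal2 : ((a + l : ℤ) : ℝ) / K ≤ y + B * h := by
        have h1 : (a : ℝ) / K ≤ y := by rw [div_le_iff₀ hK0]; linarith
        have h2 : (l : ℝ) / K ≤ B * (1 / K) := by rw [mul_one_div]; gcongr
        have e : ((a + l : ℤ) : ℝ) / K = a / K + l / K := by push_cast; ring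
        linarith
      have hmass : C.cantorLift ((a + l + 1 : ℤ) / K) - C.cantorLift ((a + l : ℤ) / K) ≤
          C.cantorLift ((b + 1 : ℤ) / C.kProd n) - C.cantorLift (b / C.kProd n) :=
        sub_le_sub (hmono hright) (hmono hleft)
      have hanc : C.cantorLift ((b + 1 : ℤ) / C.kProd n) - C.cantorLift (b / C.kProd n) ≤ W := by
        refine sub_le_sub (hmono ?_) (hmono ?_)
        · have : ((B : ℝ) ^ i + B + 1) * h = B ^ i * h + B * h + h := by ring
          linarith
        · have : ((B : ℝ) ^ i + B + 1) * h = B ^ i * h + B * h + h := by ring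
          have : ((a + l + 1 : ℤ) : ℝ) / K = (a + l : ℤ) / K + 1 / K := by push_cast; ring
          have h3 : 0 ≤ (B : ℝ) * h := by positivity
          have : 0 < 1 / K := by positivity
          linarith
      have hM : (0 : ℝ) < C.mProd n := by exact_mod_cast C.mProd_pos n
      have hMN : (0 : ℝ) < C.mProd N := by exact_mod_cast C.mProd_pos N
      have hMM : (2 : ℝ) ^ i * C.mProd n ≤ C.mProd N := by
        rw [hn]; exact_mod_cast C.two_pow_mul_mProd_le n i
      rcases C.cantorLift_cell n b with hd | hd
      · exfalso
        rw [hd, hc] at hmass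
        have : 0 < 1 / (C.mProd N : ℝ) := by positivity
        linarith
      · rw [hd] at hanc
        rw [hc]
        calc 1 / (C.mProd N : ℝ) ≤ 1 / (2 ^ i * C.mProd n) := by gcongr
          _ = (1 / 2) ^ i * (1 / C.mProd n) := by rw [one_div_pow, one_div_mul_one_div]
          _ ≤ _ := by gcongr
  have hsum : C.cantorLift ((a + (B + 1 : ℕ) : ℤ) / K) - C.cantorLift (a / K) ≤
      (B + 1) * ((1 / 2) ^ i * W) := by
    have hs := Finset.sum_range_sub (fun l : ℕ => C.cantorLift ((a + l : ℤ) / K)) (B + 1)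
    simp only [Nat.cast_zero, add_zero] at hs
    rw [← hs]
    calc _ ≤ ∑ l ∈ Finset.range (B + 1), ((1 / 2 : ℝ) ^ i * W) := by
          refine Finset.sum_le_sum fun l hl => ?_
          have := hcell l (by rw [Finset.mem_range] at hl; omega)
          rw [add_assoc] at this
          push_cast at this ⊢
          exact this
      _ = _ := by rw [Finset.sum_const, nsmul_eq_mul, Finset.card_range]; push_cast; rfl
  have hfin : C.cantorLift (y + h) - C.cantorLift y ≤
      C.cantorLift ((a + (B + 1 : ℕ) : ℤ) / K) - C.cantorLift (a / K) := by
    refine sub_le_sub (hmono ?_) (hmono ?_)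
    · rw [le_div_iff₀ hK0]; push_cast; linarith
    · rw [div_le_iff₀ hK0]; exact ha1
  calc _ ≤ _ := hfin
    _ ≤ _ := hsum
    _ = ((B + 1) * (1 / 2) ^ i) * W := by ring
    _ ≤ _ := mul_le_mul_of_nonneg_right hi hW0

theorem HasScaling.add_linear {G : ℝ → ℝ} (hG : HasScaling G) (hmono : Monotone G) {a : ℝ}
    (ha : 0 ≤ a) : HasScaling fun x => G x + a * x := by
  intro η hη
  obtain ⟨K, hK1, h₁, hh₁, hK⟩ := hG η hη
  refine ⟨max K (1 / η), hK1.trans (le_max_left _ _), h₁, hh₁, fun h h0 hh y => ?_⟩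
  have e1 : K * h ≤ max K (1 / η) * h := by gcongr; exact le_max_left _ _
  have e2 : h ≤ η * (max K (1 / η) * h) := by
    calc h = η * (1 / η * h) := by field_simp
      _ ≤ _ := by gcongr; exact le_max_right _ _
  set K' := max K (1 / η)
  have e3 := hK h h0 hh y
  have e4 : G (y + K * h) - G (y - K * h) ≤ G (y + K' * h) - G (y - K' * h) :=
    sub_le_sub (hmono (by linarith)) (hmono (by linarith))
  have e5 := mul_le_mul_of_nonneg_left e4 hη.le
  have e6 := mul_le_mul_of_nonneg_left e2 ha
  have e7 : 0 ≤ a * (η * (K' * h)) := le_trans (by positivity) e6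
  have e8 : η * (G (y + K' * h) + a * (y + K' * h) - (G (y - K' * h) + a * (y - K' * h))) =
    η * (G (y + K' * h) - G (y - K' * h)) + 2 * (a * (η * (K' * h))) := by ring
  rw [e8]
  linarith

theorem IsCircleDistribution.add_linear {G : ℝ → ℝ} {g a : ℝ} (hG : IsCircleDistribution G g)
    (ha : 0 ≤ a) : IsCircleDistribution (fun x => G x + a * x) (g + a) where
  mono x y hxy := add_le_add (hG.mono hxy) (mul_le_mul_of_nonneg_left hxy ha)
  cont := hG.cont.add (continuous_const.mul continuous_id)
  add_one x := by simp only [hG.add_one]; ring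

end

noncomputable section

/-! ### Uniform equidistribution -/

theorem addOrderOf_coe_eq_zero_of_irrational {α : ℝ} (hα : Irrational α) :
    addOrderOf (α : UnitAddCircle) = 0 := by
  rw [addOrderOf_eq_zero_iff']
  intro n hn h
  rw [← AddCircle.coe_nsmul, AddCircle.coe_eq_zero_iff] at h
  obtain ⟨k, hk⟩ := h
  have hn' : (n : ℝ) ≠ 0 := by positivity
  apply hα
  refine ⟨(k : ℚ) / n, ?_⟩
  simp only [zsmul_eq_mul, mul_one, nsmul_eq_mul] at hk
  push_cast
  rw [hk]; field_simp

theorem UnitAddCircle.volume_real_univ :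
    (volume : Measure UnitAddCircle).real Set.univ = 1 := by
  rw [Measure.real, UnitAddCircle.measure_univ, ENNReal.toReal_one]

theorem norm_sum_fourier_sub_le {a : UnitAddCircle} (ha : addOrderOf a = 0) (k : ℤ) :
    ∃ K : ℝ, ∀ (n : ℕ) (y : UnitAddCircle),
      ‖∑ i ∈ Finset.range n, (fourier k (y + i • a) : ℂ) - n * ∫ z : UnitAddCircle, fourier k z‖
        ≤ K := by
  rcases eq_or_ne k 0 with rfl | hk
  · refine ⟨0, fun n y => ?_⟩
    simp [UnitAddCircle.volume_real_univ]
  · have hInt : ∫ z : UnitAddCircle, (fourier k z : ℂ) = 0 := by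
      have := integral_eq_zero_of_add_right_eq_neg (μ := (volume : Measure UnitAddCircle))
        (fourier_add_half_inv_index (T := (1 : ℝ)) hk zero_lt_one)
      simpa using this
    set ζ : ℂ := fourier k a with hζ
    have hζ1 : ζ ≠ 1 := by
      intro h
      rw [hζ, fourier_apply, Circle.coe_eq_one] at h
      have h2 : k • a = 0 := AddCircle.injective_toCircle one_ne_zero (by rw [h]; simp)
      exact hk ((isOfFinAddOrder_iff_zsmul_eq_zero.not.1
        (addOrderOf_eq_zero_iff.1 ha)) |> fun h3 => by
          by_contra hk0; exact h3 ⟨k, hk0, h2⟩)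
    refine ⟨2 / ‖ζ - 1‖, fun n y => ?_⟩
    have hterm : ∀ i : ℕ, (fourier k (y + i • a) : ℂ) = fourier k y * ζ ^ i := by
      intro i
      simp only [hζ, fourier_apply, smul_add, AddCircle.toCircle_add, Circle.coe_mul]
      congr 1
      rw [smul_comm, AddCircle.toCircle_nsmul, Circle.coe_pow]
    simp_rw [hterm]
    rw [hInt, mul_zero, sub_zero, ← Finset.mul_sum, geom_sum_eq hζ1, norm_mul, norm_div]
    have h1 : ‖(fourier k y : ℂ)‖ = 1 := by rw [fourier_apply]; exact Circle.norm_coe _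
    have h2 : ‖ζ‖ = 1 := by rw [hζ, fourier_apply]; exact Circle.norm_coe _
    rw [h1, one_mul]
    gcongr
    calc ‖ζ ^ n - 1‖ ≤ ‖ζ ^ n‖ + ‖(1 : ℂ)‖ := norm_sub_le _ _
      _ = 2 := by rw [norm_pow, h2, one_pow, norm_one]; norm_num

theorem exists_norm_sum_sub_le_of_continuous {a : UnitAddCircle} (ha : addOrderOf a = 0)
    (P : C(UnitAddCircle, ℂ)) {ε : ℝ} (hε : 0 < ε) :
    ∃ K : ℝ, ∀ (n : ℕ) (y : UnitAddCircle),
      ‖∑ i ∈ Finset.range n, P (y + i • a) - n * ∫ z : UnitAddCircle, P z‖ ≤ ε * n + K := by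
  have hInt : ∀ Q : C(UnitAddCircle, ℂ), Integrable Q (volume : Measure UnitAddCircle) :=
    fun Q => Q.continuous.integrable_of_hasCompactSupport (HasCompactSupport.of_compactSpace _)
  have hspan : ∀ Q ∈ Submodule.span ℂ (Set.range (fourier (T := (1 : ℝ)))),
      ∃ K : ℝ, ∀ (n : ℕ) (y : UnitAddCircle),
        ‖∑ i ∈ Finset.range n, Q (y + i • a) - n * ∫ z : UnitAddCircle, Q z‖ ≤ K := by
    intro Q hQ
    induction hQ using Submodule.span_induction with
    | mem Q h =>
      obtain ⟨k, rfl⟩ := h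
      exact norm_sum_fourier_sub_le ha k
    | zero => exact ⟨0, fun n y => by simp⟩
    | add Q R _ _ h1 h2 =>
      obtain ⟨K1, h1⟩ := h1
      obtain ⟨K2, h2⟩ := h2
      refine ⟨K1 + K2, fun n y => ?_⟩
      have e : ∑ i ∈ Finset.range n, (Q + R) (y + i • a) - n * ∫ z : UnitAddCircle, (Q + R) z =
          (∑ i ∈ Finset.range n, Q (y + i • a) - n * ∫ z : UnitAddCircle, Q z) +
          (∑ i ∈ Finset.range n, R (y + i • a) - n * ∫ z : UnitAddCircle, R z) := by
        simp only [ContinuousMap.add_apply]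
        rw [Finset.sum_add_distrib, integral_add (hInt Q) (hInt R)]
        ring
      rw [e]
      exact (norm_add_le _ _).trans (add_le_add (h1 n y) (h2 n y))
    | smul c Q _ h1 =>
      obtain ⟨K1, h1⟩ := h1
      refine ⟨‖c‖ * K1, fun n y => ?_⟩
      have e : ∑ i ∈ Finset.range n, (c • Q) (y + i • a) - n * ∫ z : UnitAddCircle, (c • Q) z =
          c * (∑ i ∈ Finset.range n, Q (y + i • a) - n * ∫ z : UnitAddCircle, Q z) := by
        simp only [ContinuousMap.smul_apply, smul_eq_mul]
        rw [← Finset.mul_sum, integral_const_mul]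
        ring
      rw [e, norm_mul]
      exact mul_le_mul_of_nonneg_left (h1 n y) (norm_nonneg _)
  have hP : P ∈ (Submodule.span ℂ (Set.range (fourier (T := (1 : ℝ))))).topologicalClosure := by
    rw [span_fourier_closure_eq_top]; trivial
  have hP' : P ∈ closure (Submodule.span ℂ (Set.range (fourier (T := (1 : ℝ)))) : Set _) := hP
  obtain ⟨Q, hQ, hPQ⟩ := Metric.mem_closure_iff.1 hP' (ε / 2) (by positivity)
  obtain ⟨K, hK⟩ := hspan Q hQ
  refine ⟨K, fun n y => ?_⟩
  have hpt : ∀ z, ‖P z - Q z‖ ≤ ε / 2 := fun z => by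
    rw [← dist_eq_norm]; exact (ContinuousMap.dist_apply_le_dist z).trans hPQ.le
  have e : ∑ i ∈ Finset.range n, P (y + i • a) - n * ∫ z : UnitAddCircle, P z =
      (∑ i ∈ Finset.range n, Q (y + i • a) - n * ∫ z : UnitAddCircle, Q z) +
      (∑ i ∈ Finset.range n, (P (y + i • a) - Q (y + i • a)) -
        n * ∫ z : UnitAddCircle, (P z - Q z)) := by
    rw [Finset.sum_sub_distrib, integral_sub (hInt P) (hInt Q)]
    ring
  rw [e]
  have b1 : ‖∑ i ∈ Finset.range n, (P (y + i • a) - Q (y + i • a))‖ ≤ n * (ε / 2) := by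
    calc _ ≤ ∑ i ∈ Finset.range n, (ε / 2) := norm_sum_le_of_le _ fun i _ => hpt _
      _ = _ := by simp
  have b2 : ‖(n : ℂ) * ∫ z : UnitAddCircle, (P z - Q z)‖ ≤ n * (ε / 2) := by
    rw [norm_mul, Complex.norm_natCast]
    gcongr
    have := norm_integral_le_of_norm_le_const (μ := (volume : Measure UnitAddCircle))
      (Eventually.of_forall hpt)
    rwa [UnitAddCircle.volume_real_univ, mul_one] at this
  have b3 := norm_sub_le (∑ i ∈ Finset.range n, (P (y + i • a) - Q (y + i • a)))
    (n * ∫ z : UnitAddCircle, (P z - Q z))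
  have b4 := norm_add_le (∑ i ∈ Finset.range n, Q (y + i • a) - n * ∫ z : UnitAddCircle, Q z)
    (∑ i ∈ Finset.range n, (P (y + i • a) - Q (y + i • a)) -
        n * ∫ z : UnitAddCircle, (P z - Q z))
  linarith [hK n y]

theorem exists_abs_sum_sub_le_of_continuous {α : ℝ} (hα : Irrational α)
    (P : C(UnitAddCircle, ℝ)) {ε : ℝ} (hε : 0 < ε) :
    ∃ K : ℝ, ∀ (n : ℕ) (y : ℝ),
      |∑ i ∈ Finset.range n, P ((y + i * α : ℝ) : UnitAddCircle) -
        n * ∫ z : UnitAddCircle, P z| ≤ ε * n + K := by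
  obtain ⟨K, hK⟩ := exists_norm_sum_sub_le_of_continuous
    (addOrderOf_coe_eq_zero_of_irrational hα)
    ((⟨Complex.ofReal, Complex.continuous_ofReal⟩ : C(ℝ, ℂ)).comp P) hε
  refine ⟨K, fun n y => ?_⟩
  have h := hK n y
  rw [← Real.norm_eq_abs, ← Complex.norm_real]
  convert h using 2
  push_cast
  congr 1
  · refine Finset.sum_congr rfl fun i _ => ?_
    rw [← AddCircle.coe_nsmul, ← AddCircle.coe_add, nsmul_eq_mul]
    rfl
  · congr 1
    exact integral_ofReal.symm

/-! ### Birkhoff sums of absolutely continuous functions -/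

theorem IsACOnCircle.exists_deriv {fa : UnitAddCircle → ℝ} (h : IsACOnCircle fa) :
    ∃ g : ℝ → ℝ, Function.Periodic g 1 ∧ (∀ a b, IntervalIntegrable g volume a b) ∧
      Measurable g ∧ ∀ a b : ℝ, fa (b : UnitAddCircle) - fa (a : UnitAddCircle) = ∫ t in a..b, g t := by
  set φ : ℝ → ℝ := fun x => fa (x : UnitAddCircle) with hφ
  have hper : Function.Periodic φ 1 := fun x => by
    simp only [hφ]
    rw [AddCircle.coe_add_period]
  have hgper : Function.Periodic (deriv φ) 1 := fun x => by
    rw [← deriv_comp_add_const]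
    congr 1
    ext y; exact hper y
  have hInt : ∀ a b, IntervalIntegrable (deriv φ) volume a b := by
    refine hgper.intervalIntegrable one_ne_zero (t := 0) ?_
    rw [zero_add]; exact AbsolutelyContinuousOnInterval.intervalIntegrable_deriv h
  refine ⟨deriv φ, hgper, hInt, measurable_deriv φ, ?_⟩
  have h0 : ∀ x ∈ Set.Icc (0 : ℝ) 1, φ x - φ 0 = ∫ t in (0 : ℝ)..x, deriv φ t := by
    intro x hx
    symm
    refine AbsolutelyContinuousOnInterval.integral_deriv_eq_sub
      (AbsolutelyContinuousOnInterval.mono h ?_)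
    rw [Set.uIcc_of_le hx.1, Set.uIcc_of_le zero_le_one]
    exact Set.Icc_subset_Icc le_rfl hx.2
  have h01 : ∫ t in (0 : ℝ)..1, deriv φ t = 0 := by
    rw [← h0 1 ⟨zero_le_one, le_rfl⟩]
    have := hper 0
    rw [zero_add] at this
    rw [this, sub_self]
  have hIper : Function.Periodic (fun x => ∫ t in (0 : ℝ)..x, deriv φ t) 1 := by
    intro x
    simp only
    rw [← intervalIntegral.integral_add_adjacent_intervals (hInt 0 x) (hInt x (x + 1)),
      hgper.intervalIntegral_add_eq x 0, zero_add, h01, add_zero]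
  have hall : ∀ x, φ x - φ 0 = ∫ t in (0 : ℝ)..x, deriv φ t := by
    intro x
    have e1 : φ x = φ (Int.fract x) := by
      have := hper.sub_zsmul_eq (x := x) ⌊x⌋
      simp only [zsmul_eq_mul, mul_one] at this
      exact this.symm
    have e2 := hIper.sub_zsmul_eq (x := x) ⌊x⌋
    simp only [zsmul_eq_mul, mul_one] at e2
    rw [e1, ← e2]
    exact h0 _ ⟨Int.fract_nonneg x, (Int.fract_lt_one x).le⟩
  intro a b
  rw [← intervalIntegral.integral_interval_sub_left (hInt 0 b) (hInt 0 a), ← hall, ← hall]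
  simp only [hφ]
  ring

theorem isCircleDistribution_integral {w : ℝ → ℝ} (hw : Function.Periodic w 1)
    (hInt : ∀ a b, IntervalIntegrable w volume a b) (h0 : ∀ x, 0 ≤ w x) :
    IsCircleDistribution (fun x => ∫ t in (0 : ℝ)..x, w t) (∫ t in (0 : ℝ)..1, w t) where
  mono x y hxy := by
    simp only
    rw [← sub_nonneg, intervalIntegral.integral_interval_sub_left (hInt 0 y) (hInt 0 x)]
    exact intervalIntegral.integral_nonneg hxy fun t _ => h0 t
  cont := intervalIntegral.continuous_primitive hInt 0
  add_one x := by
    rw [← intervalIntegral.integral_add_adjacent_intervals (hInt 0 x) (hInt x (x + 1)),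
      hw.intervalIntegral_add_eq x 0, zero_add]

theorem IsACOnCircle.exists_abs_sum_sub_le {fa : UnitAddCircle → ℝ} (h : IsACOnCircle fa)
    {α c : ℝ} (hα : Irrational α) (hc : BadlyApproximable α c) (C₁ : ℝ) {ε : ℝ} (hε : 0 < ε) :
    ∃ δ : ℝ, 0 < δ ∧ ∀ h, 0 < h → h < δ → ∀ (x : ℝ) (n : ℕ), n * h ≤ C₁ →
      |∑ i ∈ Finset.range n, (fa ((x + i * α + h : ℝ) : UnitAddCircle) -
        fa ((x + i * α : ℝ) : UnitAddCircle))| ≤ ε := by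
  obtain ⟨g, hgper, hgint, hgm, hg⟩ := h.exists_deriv
  have hc0 := hc.1
  set K : ℕ := ⌈C₁ / c⌉₊ + 1 with hK
  have hKC : C₁ ≤ K * c := by
    have := Nat.le_ceil (C₁ / c)
    rw [div_le_iff₀ hc0] at this
    rw [hK]; push_cast; linarith
  have hK0 : (0 : ℝ) < K := by rw [hK]; positivity
  set C₂ : ℝ := max C₁ 1 with hC₂
  have hC₂0 : 0 < C₂ := lt_of_lt_of_le one_pos (le_max_right _ _)
  set ε' : ℝ := min (ε / (8 * K)) (ε / (8 * C₂)) with hε'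
  have hε'0 : 0 < ε' := by rw [hε']; positivity
  have hε1 : K * (2 * ε') ≤ ε / 4 := by
    have : ε' ≤ ε / (8 * K) := min_le_left _ _
    rw [le_div_iff₀ (by positivity)] at this
    linarith
  have hε2 : C₂ * ε' ≤ ε / 8 := by
    have : ε' ≤ ε / (8 * C₂) := min_le_right _ _
    rw [le_div_iff₀ (by positivity)] at this
    linarith
  set gc : UnitAddCircle → ℝ := hgper.lift with hgc
  have hgcc : ∀ t : ℝ, gc (t : UnitAddCircle) = g t := fun t => hgper.lift_coe t
  have hgci : Integrable gc (volume : Measure UnitAddCircle) := by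
    have hm : Measurable gc := by
      have e : gc = fun z => g (AddCircle.measurableEquivIoc 1 0 z : ℝ) := by
        ext z
        have h1 : (((AddCircle.measurableEquivIoc 1 0 z : Set.Ioc (0 : ℝ) (0 + 1)) : ℝ) :
            UnitAddCircle) = z := (AddCircle.equivIoc 1 0).symm_apply_apply z
        rw [← hgcc, h1]
      rw [e]
      exact hgm.comp (measurable_subtype_coe.comp (AddCircle.measurableEquivIoc 1 0).measurable)
    refine ⟨hm.aestronglyMeasurable, ?_⟩
    rw [HasFiniteIntegral, ← UnitAddCircle.lintegral_preimage 0]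
    simp_rw [hgcc, zero_add]
    exact ((intervalIntegrable_iff_integrableOn_Ioc_of_le zero_le_one).1 (hgint 0 1)).2
  obtain ⟨P, hP, hPi⟩ := hgci.exists_boundedContinuous_lintegral_sub_le
    (ε := ENNReal.ofReal ε') (by simpa using hε'0)
  have hPc : Continuous fun t : ℝ => P (t : UnitAddCircle) :=
    P.continuous.comp (AddCircle.continuous_mk' 1)
  have hPper : Function.Periodic (fun t : ℝ => P (t : UnitAddCircle)) 1 := fun t => by
    simp only; rw [AddCircle.coe_add_period]
  have hPint : ∀ a b, IntervalIntegrable (fun t : ℝ => P (t : UnitAddCircle)) volume a b :=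
    fun a b => hPc.intervalIntegrable a b
  set r : ℝ → ℝ := fun t => g t - P (t : UnitAddCircle) with hr
  have hrint : ∀ a b, IntervalIntegrable r volume a b := fun a b => (hgint a b).sub (hPint a b)
  have hrper : Function.Periodic r 1 := fun t => by
    simp only [hr]; rw [hgper t, AddCircle.coe_add_period]
  have hrper' : Function.Periodic (fun t => |r t|) 1 := fun t => by simp only [hrper t]
  have hmass : ∫ t in (0 : ℝ)..1, |r t| ≤ ε' := by
    have e1 : ∫ t in (0 : ℝ)..(0 + 1), |r t| = ∫ z : UnitAddCircle, ‖gc z - P z‖ := by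
      rw [← UnitAddCircle.intervalIntegral_preimage 0]
      simp_rw [hgcc]
      rfl
    rw [zero_add] at e1
    have e2 := integral_norm_eq_lintegral_enorm (hgci.sub hPi).aestronglyMeasurable
    simp only [Pi.sub_apply] at e2
    rw [e1, e2]
    exact ENNReal.toReal_le_of_le_ofReal hε'0.le hP
  have hPmean : |∫ z : UnitAddCircle, P z| ≤ ε' := by
    have e1 : ∫ z : UnitAddCircle, P z = - ∫ t in (0 : ℝ)..1, r t := by
      have h1 : ∫ t in (0 : ℝ)..(0 + 1), P (t : UnitAddCircle) = ∫ z : UnitAddCircle, P z :=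
        UnitAddCircle.intervalIntegral_preimage 0 P
      have h2 : ∫ t in (0 : ℝ)..1, g t = 0 := by
        rw [← hg]
        have := AddCircle.coe_add_period (1 : ℝ) 0
        rw [zero_add] at this
        rw [this, sub_self]
      rw [hr, intervalIntegral.integral_sub (hgint _ _) (hPint _ _), h2, ← h1, zero_add]
      ring
    rw [e1, abs_neg]
    exact (intervalIntegral.abs_integral_le_integral_abs zero_le_one).trans hmass
  obtain ⟨KP, hKP⟩ := exists_abs_sum_sub_le_of_continuous hα
    (⟨P, P.continuous⟩ : C(UnitAddCircle, ℝ)) hε'0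
  simp only [ContinuousMap.coe_mk] at hKP
  refine ⟨min 1 (ε / (4 * (|KP| + 1))), by positivity, fun h h0 hδ x n hn => ?_⟩
  have hh1 : h ≤ 1 := (hδ.trans_le (min_le_left _ _)).le
  have hh2 : h * |KP| ≤ ε / 4 := by
    have := (hδ.trans_le (min_le_right _ _)).le
    rw [le_div_iff₀ (by positivity)] at this
    nlinarith
  have hn2 : n * h ≤ C₂ := hn.trans (le_max_left _ _)
  have hsplit : ∑ i ∈ Finset.range n, (fa ((x + i * α + h : ℝ) : UnitAddCircle) -
        fa ((x + i * α : ℝ) : UnitAddCircle)) =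
      ∑ i ∈ Finset.range n, (∫ t in (x + i * α)..(x + i * α + h), r t) +
        ∑ i ∈ Finset.range n, ∫ t in (x + i * α)..(x + i * α + h), P (t : UnitAddCircle) := by
    rw [← Finset.sum_add_distrib]
    refine Finset.sum_congr rfl fun i _ => ?_
    rw [hg, ← intervalIntegral.integral_add (hrint _ _) (hPint _ _)]
    simp [hr]
  have hRbound : |∑ i ∈ Finset.range n, (∫ t in (x + i * α)..(x + i * α + h), r t)| ≤ ε / 4 := by
    have hR := isCircleDistribution_integral hrper' (fun a b => (hrint a b).abs)
      (fun t => abs_nonneg _)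
    have hw : h / K * n ≤ c := by
      rw [div_mul_eq_mul_div, div_le_iff₀ hK0]; linarith
    have hw1 : h / K ≤ 1 := by
      rw [div_le_one hK0]
      have : (1 : ℝ) ≤ K := by rw [hK]; push_cast; linarith [Nat.cast_nonneg (α := ℝ) ⌈C₁ / c⌉₊]
      linarith
    have h3 := hR.sum_sub_le_mul hc 0 n K (by positivity) hw1 hw x
    rw [mul_div_cancel₀ _ hK0.ne', zero_add, ← Finset.range_eq_Ico] at h3
    calc _ ≤ ∑ i ∈ Finset.range n, |∫ t in (x + i * α)..(x + i * α + h), r t| :=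
          Finset.abs_sum_le_sum_abs _ _
      _ ≤ _ := Finset.sum_le_sum (g := fun i : ℕ => (∫ t in (0 : ℝ)..(x + i * α + h), |r t|) -
          ∫ t in (0 : ℝ)..(x + i * α), |r t|) fun i _ => by
            rw [intervalIntegral.integral_interval_sub_left ((hrint _ _).abs) ((hrint _ _).abs)]
            exact intervalIntegral.abs_integral_le_integral_abs (by linarith)
      _ ≤ _ := h3
      _ ≤ K * (2 * ε') := by gcongr
      _ ≤ _ := hε1
  have hPbound : |∑ i ∈ Finset.range n,
      ∫ t in (x + i * α)..(x + i * α + h), P (t : UnitAddCircle)| ≤ ε / 2 := by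
    have e1 : ∑ i ∈ Finset.range n,
        ∫ t in (x + i * α)..(x + i * α + h), P (t : UnitAddCircle) =
        ∫ t in x..(x + h), ∑ i ∈ Finset.range n, P ((t + i * α : ℝ) : UnitAddCircle) := by
      rw [intervalIntegral.integral_finsetSum]
      · refine Finset.sum_congr rfl fun i _ => ?_
        rw [intervalIntegral.integral_comp_add_right
          (f := fun t : ℝ => P (t : UnitAddCircle)) (i * α)]
        congr 1
        ring
      · intro i _
        exact (hPc.comp (continuous_id.add continuous_const)).intervalIntegrable _ _
    rw [e1]
    have e2 : ∀ t ∈ Set.uIoc x (x + h),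
        ‖∑ i ∈ Finset.range n, P ((t + i * α : ℝ) : UnitAddCircle)‖ ≤ 2 * ε' * n + |KP| := by
      intro t _
      have h1 := hKP n t
      rw [Real.norm_eq_abs]
      have h2 : |(n : ℝ) * ∫ z : UnitAddCircle, P z| ≤ n * ε' := by
        rw [abs_mul, Nat.abs_cast]; gcongr
      have h3 := abs_add_le (∑ i ∈ Finset.range n, P ((t + i * α : ℝ) : UnitAddCircle) -
        n * ∫ z : UnitAddCircle, P z) (n * ∫ z : UnitAddCircle, P z)
      rw [sub_add_cancel] at h3
      linarith [le_abs_self KP]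
    have h4 := intervalIntegral.norm_integral_le_of_norm_le_const e2
    rw [Real.norm_eq_abs, add_sub_cancel_left, abs_of_pos h0] at h4
    calc _ ≤ _ := h4
      _ = 2 * ((n * h) * ε') + h * |KP| := by ring
      _ ≤ 2 * (C₂ * ε') + h * |KP| := by gcongr
      _ ≤ _ := by linarith
  rw [hsplit]
  have := abs_add_le (∑ i ∈ Finset.range n, (∫ t in (x + i * α)..(x + i * α + h), r t))
    (∑ i ∈ Finset.range n, ∫ t in (x + i * α)..(x + i * α + h), P (t : UnitAddCircle))
  linarith

end

noncomputable section

/-! ### Drift of Birkhoff sums of two nearby points -/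

/-- `f` is the sum of an absolutely continuous function, a function `J` that is constant on arcs
avoiding the finite set `F`, and plus or minus a circle distribution with the scaling property. -/
structure IsDriftRoof (f fa : UnitAddCircle → ℝ) (J G : ℝ → ℝ) (σ g b : ℝ)
    (F : Finset UnitAddCircle) : Prop where
  ac : IsACOnCircle fa
  eq : ∀ x : ℝ, f (x : UnitAddCircle) = fa (x : UnitAddCircle) + J x + σ * G x
  const : ∀ x h : ℝ, 0 ≤ h → ¬ ArcMeets F h x → J (x + h) = J x
  jump_le : ∀ x h : ℝ, 0 ≤ h → h ≤ 1 → |J (x + h) - J x| ≤ b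
  dist : IsCircleDistribution G g
  scaling : HasScaling G
  mass_pos : 0 < g
  abs_sign : |σ| = 1

/-- The difference `f⁽ⁿ⁾(x + h) - f⁽ⁿ⁾(x)` of Birkhoff sums over the rotation by `α`. -/
def drift (α : ℝ) (f : UnitAddCircle → ℝ) (n : ℕ) (x h : ℝ) : ℝ :=
  ∑ i ∈ Finset.range n, (f ((x + i * α + h : ℝ) : UnitAddCircle) -
    f ((x + i * α : ℝ) : UnitAddCircle))

/-- The cumulative increment of `G` along the orbit between the times `N` and `n`. -/
def cumIncrement (α : ℝ) (G : ℝ → ℝ) (x h : ℝ) (N n : ℕ) : ℝ :=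
  ∑ i ∈ Finset.Ico N n, (G (x + i * α + h) - G (x + i * α))

theorem cumIncrement_add {α : ℝ} {G : ℝ → ℝ} {x h : ℝ} {a b d : ℕ} (hab : a ≤ b) (hbd : b ≤ d) :
    cumIncrement α G x h a b + cumIncrement α G x h b d = cumIncrement α G x h a d :=
  Finset.sum_Ico_consecutive _ hab hbd

theorem cumIncrement_nonneg {α : ℝ} {G : ℝ → ℝ} (hG : Monotone G) {x h : ℝ} (h0 : 0 ≤ h)
    (a b : ℕ) : 0 ≤ cumIncrement α G x h a b :=
  Finset.sum_nonneg fun i _ => sub_nonneg.2 (hG (by linarith))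

theorem IsCircleDistribution.cumIncrement_le_of_scaling {G : ℝ → ℝ} {g : ℝ}
    (hG : IsCircleDistribution G g) {α c : ℝ} (hc : BadlyApproximable α c) {η K h : ℝ}
    (hη : 0 ≤ η) (hK : 1 ≤ K) (h0 : 0 < h)
    (hscale : ∀ y, G (y + h) - G y ≤ η * (G (y + K * h) - G (y - K * h)))
    (hKh : 2 * K * h ≤ 1) {L : ℕ} (hL : 2 * K * h * L ≤ c) (x : ℝ) (a : ℕ) :
    cumIncrement α G x h a (a + L) ≤ 2 * g * η := by
  have h1 := hG.sum_sub_le hc a L (w := 2 * K * h) (by positivity) hKh hL (x - K * h)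
  calc cumIncrement α G x h a (a + L)
      ≤ ∑ i ∈ Finset.Ico a (a + L), η * (G (x - K * h + i * α + 2 * K * h) -
          G (x - K * h + i * α)) := by
        refine Finset.sum_le_sum fun i _ => ?_
        have := hscale (x + i * α)
        rw [show x - K * h + i * α + 2 * K * h = x + i * α + K * h by ring,
          show x - K * h + i * α = x + i * α - K * h by ring]
        exact this
    _ ≤ η * (2 * g) := by rw [← Finset.mul_sum]; gcongr
    _ = _ := by ring

/-- Times at which an increasing sequence with small steps passes the multiples of a level, with no
exceptional time between two consecutive passages. -/
theorem exists_level_interval_disjoint {E : ℕ → ℝ} {N N' : ℕ} {K : ℕ} {ℓ θ : ℝ} (hNN : N ≤ N')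
    (hE0 : E N = 0) (hstep : ∀ n, N ≤ n → E (n + 1) ≤ E n + θ)
    (hℓ : 0 < ℓ) (hθ : 0 ≤ θ) (htop : (K + 1) * ℓ ≤ E N') (s : Finset ℕ) (hs : s.card ≤ K) :
    ∃ t t' : ℕ, N ≤ t ∧ t ≤ t' ∧ t' ≤ N' ∧ |E t' - E t - ℓ| ≤ θ ∧
      ∀ i ∈ s, i < t ∨ t' ≤ i := by
  classical
  have hex : ∀ j : ℕ, j ≤ K + 1 → ∃ n, N ≤ n ∧ j * ℓ ≤ E n := by
    intro j hj
    refine ⟨N', hNN, le_trans ?_ htop⟩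
    have : (j : ℝ) ≤ K + 1 := by exact_mod_cast hj
    gcongr
  set τ : ℕ → ℕ := fun j => if hj : j ≤ K + 1 then Nat.find (hex j hj) else 0 with hτ
  have hspec : ∀ j, j ≤ K + 1 → N ≤ τ j ∧ j * ℓ ≤ E (τ j) := by
    intro j hj; simp only [hτ, dif_pos hj]; exact Nat.find_spec (hex j hj)
  have hmin : ∀ j, j ≤ K + 1 → ∀ n, N ≤ n → j * ℓ ≤ E n → τ j ≤ n := by
    intro j hj n h1 h2; simp only [hτ, dif_pos hj]; exact Nat.find_min' (hex j hj) ⟨h1, h2⟩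
  have hup : ∀ j, j ≤ K + 1 → E (τ j) ≤ j * ℓ + θ := by
    intro j hj
    rcases eq_or_lt_of_le (hspec j hj).1 with h | h
    · rw [← h, hE0]; positivity
    · obtain ⟨n, hn⟩ : ∃ n, τ j = n + 1 := ⟨τ j - 1, by omega⟩
      have h1 : E n < j * ℓ := by
        by_contra hcon
        have := hmin j hj n (by omega) (not_lt.1 hcon)
        omega
      rw [hn]
      linarith [hstep n (by omega)]
  have hmono : ∀ i j, i ≤ j → j ≤ K + 1 → τ i ≤ τ j := by
    intro i j hij hj
    refine hmin i (hij.trans hj) _ (hspec j hj).1 (le_trans ?_ (hspec j hj).2)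
    gcongr
  have hτN' : ∀ j, j ≤ K + 1 → τ j ≤ N' := by
    intro j hj
    refine hmin j hj N' hNN (le_trans ?_ htop)
    have : (j : ℝ) ≤ K + 1 := by exact_mod_cast hj
    gcongr
  obtain ⟨j, hj, hfree⟩ : ∃ j, j < K + 1 ∧ ∀ i ∈ s, i < τ j ∨ τ (j + 1) ≤ i := by
    by_contra hcon
    push Not at hcon
    choose! m hm using hcon
    have hle : (Finset.range (K + 1)).card ≤ s.card := by
      refine Finset.card_le_card_of_injOn m ?_ ?_
      · intro j hj
        exact (hm j (by simpa using hj)).1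
      · have key : ∀ i j, i < j → j < K + 1 → m i < m j := by
          intro i j hij hj
          have h1 := (hm i (by omega)).2.2
          have h2 := (hm j hj).2.1
          have h3 := hmono (i + 1) j hij hj.le
          omega
        intro i hi j hj hij
        simp only [Finset.coe_range, Set.mem_Iio] at hi hj
        by_contra hne
        rcases lt_or_gt_of_ne hne with h | h
        · exact absurd hij (key i j h hj).ne
        · exact absurd hij (key j i h hi).ne'
    rw [Finset.card_range] at hle
    omega
  refine ⟨τ j, τ (j + 1), (hspec j hj.le).1, hmono j (j + 1) (by omega) hj, hτN' _ hj, ?_, hfree⟩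
  have h1 := hspec j hj.le
  have h2 := hspec (j + 1) hj
  have h3 := hup j hj.le
  have h4 := hup (j + 1) hj
  push_cast at h2 h4
  rw [abs_le]
  constructor <;> linarith [h1.2, h2.2]

namespace IsDriftRoof

variable {f fa : UnitAddCircle → ℝ} {J G : ℝ → ℝ} {σ g b : ℝ} {F : Finset UnitAddCircle}

theorem drift_eq (hf : IsDriftRoof f fa J G σ g b F) (α : ℝ) (n : ℕ) (x h : ℝ) :
    drift α f n x h = drift α fa n x h +
      ∑ i ∈ Finset.range n, (J (x + i * α + h) - J (x + i * α)) + σ * cumIncrement α G x h 0 n := by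
  rw [drift, drift, cumIncrement, ← Finset.range_eq_Ico, Finset.mul_sum, ← Finset.sum_add_distrib,
    ← Finset.sum_add_distrib]
  refine Finset.sum_congr rfl fun i _ => ?_
  rw [hf.eq, hf.eq]
  ring

theorem drift_sub (hf : IsDriftRoof f fa J G σ g b F) {α : ℝ} {x h : ℝ} (h0 : 0 ≤ h) {m n : ℕ}
    (hmn : m ≤ n) (hfree : ∀ i, m ≤ i → i < n → ¬ ArcMeets F h (x + i * α)) :
    drift α f n x h - drift α f m x h =
      (drift α fa n x h - drift α fa m x h) + σ * cumIncrement α G x h m n := by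
  rw [hf.drift_eq, hf.drift_eq, ← cumIncrement_add (Nat.zero_le m) hmn,
    Finset.range_eq_Ico, Finset.range_eq_Ico, ← Finset.sum_Ico_consecutive _ (Nat.zero_le m) hmn]
  have : ∑ i ∈ Finset.Ico m n, (J (x + i * α + h) - J (x + i * α)) = 0 := by
    refine Finset.sum_eq_zero fun i hi => ?_
    rw [Finset.mem_Ico] at hi
    rw [hf.const _ _ h0 (hfree i hi.1 hi.2), sub_self]
  rw [this]
  ring

/-- On a time scale inverse to the distance `h` of two points, there are two long windows of time
on which the drift is nearly constant, with two values whose difference is close to `ℓ`. -/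
theorem exists_windows (hf : IsDriftRoof f fa J G σ g b F) {α c : ℝ} (hirr : Irrational α)
    (hc : BadlyApproximable α c) :
    ∃ A : ℝ, 0 < A ∧ ∃ ℓ₀ : ℝ, 0 < ℓ₀ ∧ ∃ K₀ : ℝ, ∀ ℓ, 0 < ℓ → ℓ ≤ ℓ₀ → ∀ ε, 0 < ε →
      ∃ κ : ℝ, 0 < κ ∧ ∃ δ : ℝ, 0 < δ ∧ ∀ h, 0 < h → h < δ → ∀ x : ℝ,
        ∃ W n₁ n₂ : ℕ, κ * ⌈A / h⌉₊ ≤ W ∧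
          ⌈A / h⌉₊ ≤ n₁ ∧ n₁ + W ≤ 2 * ⌈A / h⌉₊ ∧ ⌈A / h⌉₊ ≤ n₂ ∧ n₂ + W ≤ 2 * ⌈A / h⌉₊ ∧
          ∃ u v : ℝ, |u| ≤ K₀ ∧ |v| ≤ K₀ ∧ |(|u - v|) - ℓ| ≤ ε ∧
            (∀ n, n₁ ≤ n → n ≤ n₁ + W → |drift α f n x h - u| ≤ ε) ∧
            (∀ n, n₂ ≤ n → n ≤ n₂ + W → |drift α f n x h - v| ≤ ε) := by
  classical
  have hc0 := hc.1
  have hg0 := hf.mass_pos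
  set A : ℝ := 2 * (2 + 1 / c) with hA
  have hA0 : 0 < A := by positivity
  have hA1 : 1 ≤ A := by
    have : 0 < 1 / c := by positivity
    rw [hA]; linarith
  set K₁ : ℕ := ⌊(F.card : ℝ) * (4 * A / c + 1)⌋₊ with hK₁
  set K₂ : ℕ := ⌈4 * A / c⌉₊ + 1 with hK₂
  have hK₂0 : (1 : ℝ) ≤ K₂ := by
    rw [hK₂]; push_cast; linarith [Nat.cast_nonneg (α := ℝ) ⌈4 * A / c⌉₊]
  have hK₂c : 4 * A ≤ K₂ * c := by
    have := Nat.le_ceil (4 * A / c)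
    rw [div_le_iff₀ hc0] at this
    rw [hK₂]; push_cast; linarith
  have hb0 : 0 ≤ b := le_trans (abs_nonneg _) (hf.jump_le 0 0 le_rfl zero_le_one)
  refine ⟨A, hA0, g / (2 * (K₁ + 1)), by positivity, 1 + K₁ * b + K₂ * (2 * g), ?_⟩
  intro ℓ hℓ hℓ₀ ε hε
  have hℓg : (K₁ + 1) * ℓ ≤ g / 2 := by
    rw [le_div_iff₀ (by positivity)] at hℓ₀
    linarith
  set η : ℝ := min (ε / (8 * g)) (ℓ / (16 * g)) with hη
  have hη0 : 0 < η := by rw [hη]; positivity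
  have hη1 : 2 * g * η ≤ ε / 4 := by
    have : η ≤ ε / (8 * g) := min_le_left _ _
    rw [le_div_iff₀ (by positivity)] at this
    linarith
  have hη2 : 2 * g * η ≤ ℓ / 8 := by
    have : η ≤ ℓ / (16 * g) := min_le_right _ _
    rw [le_div_iff₀ (by positivity)] at this
    linarith
  obtain ⟨K, hK1, h₁, hh₁, hscale⟩ := hf.scaling η hη0
  obtain ⟨δa, hδa, hdrifta⟩ := hf.ac.exists_abs_sum_sub_le hirr hc (4 * A)
    (ε := min (ε / 8) 1) (by positivity)
  have hK0 : 0 < K := by linarith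
  refine ⟨c / (8 * K * A), by positivity,
    min (min h₁ δa) (min (1 / (2 * K)) (c / (4 * K))), by positivity, ?_⟩
  intro h h0 hδ x
  have hhh₁ : h < h₁ := hδ.trans_le ((min_le_left _ _).trans (min_le_left _ _))
  have hhδa : h < δa := hδ.trans_le ((min_le_left _ _).trans (min_le_right _ _))
  have hh2K : 2 * K * h ≤ 1 := by
    have := (hδ.trans_le ((min_le_right _ _).trans (min_le_left _ _))).le
    rw [le_div_iff₀ (by positivity)] at this
    linarith
  have hh4K : 4 * K * h ≤ c := by
    have := (hδ.trans_le ((min_le_right _ _).trans (min_le_right _ _))).le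
    rw [le_div_iff₀ (by positivity)] at this
    linarith
  have hh1 : h ≤ 1 := by nlinarith
  set N : ℕ := ⌈A / h⌉₊ with hN
  have hN1 : A ≤ N * h := by
    have := Nat.le_ceil (A / h)
    rwa [div_le_iff₀ h0] at this
  have hN2 : N * h ≤ 2 * A := by
    have := (Nat.ceil_lt_add_one (show 0 ≤ A / h by positivity)).le
    have h2 : (N : ℝ) * h ≤ (A / h + 1) * h := mul_le_mul_of_nonneg_right this h0.le
    have h3 : (A / h + 1) * h = A + h := by field_simp
    linarith
  have hn4 : ∀ n : ℕ, n ≤ 2 * N → n * h ≤ 4 * A := by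
    intro n hn
    have : (n : ℝ) ≤ 2 * N := by exact_mod_cast hn
    nlinarith
  have hfa : ∀ n : ℕ, n ≤ 2 * N → |drift α fa n x h| ≤ min (ε / 8) 1 :=
    fun n hn => hdrifta h h0 hhδa x n (hn4 n hn)
  set W : ℕ := ⌊c / (2 * K * h)⌋₊ with hW
  have hW1 : 2 * K * h * W ≤ c := by
    have := Nat.floor_le (show 0 ≤ c / (2 * K * h) by positivity)
    rw [le_div_iff₀ (by positivity)] at this
    linarith
  have hW2 : c / (4 * K * h) ≤ W := by
    have h1 := (Nat.lt_floor_add_one (c / (2 * K * h))).le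
    have h2 : 1 ≤ c / (4 * K * h) := by rw [le_div_iff₀ (by positivity)]; linarith
    have h3 : c / (2 * K * h) = c / (4 * K * h) + c / (4 * K * h) := by field_simp; norm_num
    rw [← hW] at h1
    linarith
  have hblock : ∀ a n : ℕ, a ≤ n → n ≤ a + W → cumIncrement α G x h a n ≤ 2 * g * η := by
    intro a n han hn
    obtain ⟨L, rfl⟩ := Nat.exists_eq_add_of_le han
    refine hf.dist.cumIncrement_le_of_scaling hc hη0.le hK1 h0 (hscale h h0 hhh₁) hh2K ?_ x a
    have : (L : ℝ) ≤ W := by exact_mod_cast (by omega : L ≤ W)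
    calc 2 * K * h * L ≤ 2 * K * h * W := by gcongr
      _ ≤ c := hW1
  have hWpos : 1 ≤ W := by
    have h2 : 1 ≤ c / (4 * K * h) := by rw [le_div_iff₀ (by positivity)]; linarith
    exact_mod_cast h2.trans hW2
  set s : Finset ℕ := (Finset.range (2 * N)).filter (fun i : ℕ => ArcMeets F h (x + i * α)) with hs
  have hscard : s.card ≤ K₁ := by
    have h1 := hc.card_arcMeets_le (2 * N) h0 x F
    rw [hK₁, Nat.le_floor_iff (by positivity)]
    refine h1.trans ?_
    have := hn4 (2 * N) le_rfl
    gcongr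
  have hcover : g / 2 ≤ cumIncrement α G x h N (2 * N) := by
    have h1 := hf.dist.le_sum_sub_of_cover (Finset.range N) (fun i : ℕ => x + N * α + i * α)
      h0.le hh1 (fun z => by
        obtain ⟨i, hi, k, hk⟩ := hc.exists_mem_Ico h0 hh1 hN1 (x + N * α) z
        exact ⟨i, Finset.mem_range.2 hi, k, hk⟩)
    have h2 : cumIncrement α G x h N (2 * N) = ∑ i ∈ Finset.range N,
        (G (x + N * α + i * α + h) - G (x + N * α + i * α)) := by
      rw [cumIncrement, Finset.sum_Ico_eq_sum_range]
      refine Finset.sum_congr (by congr 1; omega) fun i _ => ?_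
      push_cast
      ring_nf
    rw [h2]
    linarith
  obtain ⟨t, t', hNt, htt', ht', hE, hfree⟩ := exists_level_interval_disjoint
    (E := fun n => cumIncrement α G x h N n) (N := N) (N' := 2 * N) (K := K₁) (ℓ := ℓ)
    (θ := 2 * g * η) (by omega) (by simp [cumIncrement])
    (fun n hn => by
      rw [← cumIncrement_add hn (Nat.le_succ n)]
      gcongr
      exact hblock n (n + 1) (by omega) (by omega)) hℓ (by positivity) (hℓg.trans hcover) s hscard
  have hEtt : cumIncrement α G x h N t' - cumIncrement α G x h N t =
      cumIncrement α G x h t t' := by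
    rw [← cumIncrement_add hNt htt']; ring
  rw [hEtt] at hE
  have hlen : t + W ≤ t' := by
    by_contra hcon
    have := hblock t t' htt' (by omega)
    rw [abs_le] at hE
    linarith
  have hfree' : ∀ i, t ≤ i → i < t' → ¬ ArcMeets F h (x + i * α) := by
    intro i h1 h2 h3
    have : i ∈ s := by
      rw [hs, Finset.mem_filter, Finset.mem_range]; exact ⟨by omega, h3⟩
    rcases hfree i this with h | h <;> omega
  have hfadiff : ∀ m n : ℕ, m ≤ 2 * N → n ≤ 2 * N →
      |drift α fa n x h - drift α fa m x h| ≤ ε / 4 := by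
    intro m n hm hn
    have h1 := (hfa m hm).trans (min_le_left _ _)
    have h2 := (hfa n hn).trans (min_le_left _ _)
    have := abs_sub (drift α fa n x h) (drift α fa m x h)
    linarith
  have hdiff : ∀ m n, t ≤ m → m ≤ n → n ≤ t' →
      |drift α f n x h - drift α f m x h - σ * cumIncrement α G x h m n| ≤ ε / 4 := by
    intro m n h1 h2 h3
    rw [hf.drift_sub h0.le h2 (fun i hi hi' => hfree' i (by omega) (by omega)), add_sub_cancel_right]
    exact hfadiff m n (by omega) (by omega)
  have hwin : ∀ m n, t ≤ m → m ≤ n → n ≤ t' → n ≤ m + W →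
      |drift α f n x h - drift α f m x h| ≤ ε := by
    intro m n h1 h2 h3 h4
    have e1 := hdiff m n h1 h2 h3
    have e2 : |σ * cumIncrement α G x h m n| ≤ ε / 4 := by
      rw [abs_mul, hf.abs_sign, one_mul, abs_of_nonneg (cumIncrement_nonneg hf.dist.mono h0.le m n)]
      exact (hblock m n h2 h4).trans hη1
    have e3 := abs_add_le (drift α f n x h - drift α f m x h - σ * cumIncrement α G x h m n)
      (σ * cumIncrement α G x h m n)
    rw [sub_add_cancel] at e3
    linarith
  have hbound : ∀ n, n ≤ 2 * N → |drift α f n x h| ≤ 1 + K₁ * b + K₂ * (2 * g) := by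
    intro n hn
    rw [hf.drift_eq]
    have e1 := (hfa n hn).trans (min_le_right _ _)
    have e2 : |∑ i ∈ Finset.range n, (J (x + i * α + h) - J (x + i * α))| ≤ K₁ * b := by
      have hterm : ∀ i ∈ Finset.range n, |J (x + i * α + h) - J (x + i * α)| ≤
          if i ∈ s then b else 0 := by
        intro i hi
        rw [Finset.mem_range] at hi
        split_ifs with his
        · exact hf.jump_le _ _ h0.le hh1
        · have : ¬ ArcMeets F h (x + i * α) := fun h3 => his (by
            rw [hs, Finset.mem_filter, Finset.mem_range]; exact ⟨by omega, h3⟩)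
          rw [hf.const _ _ h0.le this, sub_self, abs_zero]
      calc _ ≤ ∑ i ∈ Finset.range n, |J (x + i * α + h) - J (x + i * α)| :=
            Finset.abs_sum_le_sum_abs _ _
        _ ≤ ∑ i ∈ Finset.range n, (if i ∈ s then b else 0) := Finset.sum_le_sum hterm
        _ = ((Finset.range n).filter (· ∈ s)).card * b := by
            rw [← Finset.sum_filter, Finset.sum_const, nsmul_eq_mul]
        _ ≤ K₁ * b := by
            gcongr
            refine le_trans (Finset.card_le_card ?_) hscard
            intro i hi
            exact (Finset.mem_filter.1 hi).2
    have e3 : |σ * cumIncrement α G x h 0 n| ≤ K₂ * (2 * g) := by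
      rw [abs_mul, hf.abs_sign, one_mul, abs_of_nonneg (cumIncrement_nonneg hf.dist.mono h0.le 0 n)]
      have hw1 : h / K₂ ≤ 1 := by rw [div_le_one (by linarith)]; linarith
      have hw : h / K₂ * n ≤ c := by
        rw [div_mul_eq_mul_div, div_le_iff₀ (by linarith)]
        linarith [hn4 n hn]
      have h3 := hf.dist.sum_sub_le_mul hc 0 n K₂ (by positivity) hw1 hw x
      rw [mul_div_cancel₀ _ (by linarith : (K₂ : ℝ) ≠ 0), zero_add] at h3
      exact h3
    have e4 := abs_add_le (drift α fa n x h +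
      ∑ i ∈ Finset.range n, (J (x + i * α + h) - J (x + i * α))) (σ * cumIncrement α G x h 0 n)
    have e5 := abs_add_le (drift α fa n x h)
      (∑ i ∈ Finset.range n, (J (x + i * α + h) - J (x + i * α)))
    linarith
  refine ⟨W, t, t' - W, ?_, hNt, by omega, by omega, by omega, drift α f t x h,
    drift α f t' x h, hbound t (by omega), hbound t' (by omega), ?_, ?_, ?_⟩
  · refine le_trans ?_ hW2
    rw [div_mul_eq_mul_div, div_le_div_iff₀ (by positivity) (by positivity)]
    have : c * N * (4 * K * h) = 4 * K * c * (N * h) := by ring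
    rw [this]
    calc 4 * K * c * (N * h) ≤ 4 * K * c * (2 * A) := by gcongr
      _ = _ := by ring
  · have e1 := hdiff t t' le_rfl htt' le_rfl
    have e2 : |(|σ * cumIncrement α G x h t t'|) - ℓ| ≤ ε / 4 := by
      rw [abs_mul, hf.abs_sign, one_mul, abs_of_nonneg (cumIncrement_nonneg hf.dist.mono h0.le _ _)]
      exact hE.trans hη1
    have e3 := abs_abs_sub_abs_le (drift α f t' x h - drift α f t x h)
      (σ * cumIncrement α G x h t t')
    rw [abs_sub_comm (drift α f t x h)]
    rw [abs_le] at e2 ⊢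
    have e4 := abs_le.1 (e3.trans e1)
    constructor <;> linarith [e2.1, e2.2, e4.1, e4.2]
  · intro n h1 h2
    exact hwin t n le_rfl h1 (by omega) h2
  · intro n h1 h2
    rw [abs_sub_comm]
    exact hwin n t' (by omega) (by omega) le_rfl (by omega)

end IsDriftRoof

end

noncomputable section

/-! ### The cocycle of a positive function -/

variable {a : UnitAddCircle} {f : UnitAddCircle → ℝ}

theorem cocycle_zero (x : UnitAddCircle) : cocycle a f 0 x = 0 := by
  change cocycle a f (Int.ofNat 0) x = 0
  simp [cocycle]

theorem cocycle_natCast (n : ℕ) (x : UnitAddCircle) :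
    cocycle a f n x = ∑ i ∈ Finset.range n, f (x + (i : ℤ) • a) := rfl

theorem cocycle_add (m n : ℤ) (x : UnitAddCircle) :
    cocycle a f (m + n) x = cocycle a f m x + cocycle a f n (x + m • a) := by
  induction n using Int.induction_on with
  | zero => simp [cocycle_zero]
  | succ n ih =>
    rw [← add_assoc, cocycle_succ, ih, cocycle_succ, add_assoc, add_assoc x, ← add_zsmul]
  | pred n ih =>
    have h1 := cocycle_succ a f (m + (-(n : ℤ) - 1)) x
    have h2 := cocycle_succ a f (-(n : ℤ) - 1) (x + m • a)
    rw [show m + (-(n : ℤ) - 1) + 1 = m + -(n : ℤ) by ring, ih] at h1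
    rw [show (-(n : ℤ) - 1 + 1) = -(n : ℤ) by ring] at h2
    rw [add_assoc x, ← add_zsmul] at h2
    linarith

theorem cocycle_neg (n : ℤ) (x : UnitAddCircle) :
    cocycle a f (-n) x = - cocycle a f n (x - n • a) := by
  have := cocycle_add (a := a) (f := f) n (-n) (x - n • a)
  rw [add_neg_cancel, cocycle_zero, sub_add_cancel] at this
  linarith

theorem strictMono_cocycle (hpos : ∀ x, 0 < f x) (x : UnitAddCircle) :
    StrictMono fun n : ℤ => cocycle a f n x :=
  strictMono_int_of_lt_succ fun n => by
    rw [cocycle_succ]; linarith [hpos (x + n • a)]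

theorem drift_eq_cocycle_sub (α : ℝ) (n : ℕ) (x h : ℝ) :
    drift α f n x h = cocycle (α : UnitAddCircle) f n ((x + h : ℝ) : UnitAddCircle) -
      cocycle (α : UnitAddCircle) f n (x : UnitAddCircle) := by
  rw [drift, cocycle_natCast, cocycle_natCast, ← Finset.sum_sub_distrib]
  refine Finset.sum_congr rfl fun i _ => ?_
  rw [← AddCircle.coe_zsmul, ← AddCircle.coe_add, ← AddCircle.coe_add, zsmul_eq_mul]
  push_cast
  rw [show x + i * α + h = x + h + i * α by ring]

/-- Conditions on a roof function under which the special flow is well defined and preserves the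
normalized measure: it is positive, measurable, bounded, and its cocycle grows linearly. -/
structure IsFlowRoof (a : UnitAddCircle) (f : UnitAddCircle → ℝ) (M c₀ c₁ : ℝ) : Prop where
  pos : ∀ x, 0 < f x
  meas : Measurable f
  le : ∀ x, f x ≤ M
  growth_pos : 0 < c₀
  growth : ∀ (n : ℕ) (x : UnitAddCircle), c₀ * n - c₁ ≤ cocycle a f n x

namespace IsFlowRoof

variable {M c₀ c₁ : ℝ}

theorem exists_index (hf : IsFlowRoof a f M c₀ c₁) (x : UnitAddCircle) (s : ℝ) :
    ∃ n : ℤ, cocycle a f n x ≤ s ∧ s < cocycle a f (n + 1) x := by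
  have hmono := strictMono_cocycle (a := a) hf.pos x
  have hc₀ := hf.growth_pos
  obtain ⟨m, hm⟩ := exists_nat_gt ((s + c₁) / c₀)
  obtain ⟨k, hk⟩ := exists_nat_gt ((c₁ - s) / c₀)
  rw [div_lt_iff₀ hc₀] at hm hk
  have hup : s < cocycle a f m x := by
    have := hf.growth m x
    linarith
  have hlow : cocycle a f (-(k : ℤ)) x ≤ s := by
    rw [cocycle_neg]
    have := hf.growth k (x - (k : ℤ) • a)
    linarith
  obtain ⟨n, hn, hmax⟩ := Int.exists_greatest_of_bdd (P := fun n => cocycle a f n x ≤ s)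
    ⟨m, fun z hz => by
      by_contra hcon
      have : cocycle a f m x ≤ cocycle a f z x := hmono.monotone (not_le.1 hcon).le
      linarith⟩ ⟨_, hlow⟩
  refine ⟨n, hn, ?_⟩
  by_contra hcon
  have := hmax (n + 1) (not_lt.1 hcon)
  omega

theorem index_unique (hf : IsFlowRoof a f M c₀ c₁) {x : UnitAddCircle} {s : ℝ} {m n : ℤ}
    (hm : cocycle a f m x ≤ s ∧ s < cocycle a f (m + 1) x)
    (hn : cocycle a f n x ≤ s ∧ s < cocycle a f (n + 1) x) : m = n := by
  have hmono := strictMono_cocycle (a := a) hf.pos x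
  by_contra hne
  rcases lt_or_gt_of_ne hne with h | h
  · have : cocycle a f (m + 1) x ≤ cocycle a f n x := hmono.monotone (by omega : m + 1 ≤ n)
    linarith
  · have : cocycle a f (n + 1) x ≤ cocycle a f m x := hmono.monotone (by omega : n + 1 ≤ m)
    linarith

theorem specialFlow_val (hf : IsFlowRoof a f M c₀ c₁) {p : SpecialSpace f} {t : ℝ} {n : ℤ}
    (hn : cocycle a f n p.1.1 ≤ p.1.2 + t ∧ p.1.2 + t < cocycle a f (n + 1) p.1.1) :
    (specialFlow a f t p).1 = (p.1.1 + n • a, p.1.2 + t - cocycle a f n p.1.1) := by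
  have hex : ∃ n : ℤ, cocycle a f n p.1.1 ≤ p.1.2 + t ∧ p.1.2 + t < cocycle a f (n + 1) p.1.1 :=
    ⟨n, hn⟩
  have := hf.index_unique hex.choose_spec hn
  rw [specialFlow, dif_pos hex]
  simp only [this]

/-- The integer `n` with `f⁽ⁿ⁾(x) ≤ s < f⁽ⁿ⁺¹⁾(x)`. -/
def index (hf : IsFlowRoof a f M c₀ c₁) (x : UnitAddCircle) (s : ℝ) : ℤ :=
  (hf.exists_index x s).choose

theorem index_spec (hf : IsFlowRoof a f M c₀ c₁) (x : UnitAddCircle) (s : ℝ) :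
    cocycle a f (hf.index x s) x ≤ s ∧ s < cocycle a f (hf.index x s + 1) x :=
  (hf.exists_index x s).choose_spec

/-- The projection of `𝕋 × ℝ` onto the space under the graph along the orbits of the skew product
`(x, s) ↦ (x + a, s - f x)`. -/
def proj (hf : IsFlowRoof a f M c₀ c₁) (q : UnitAddCircle × ℝ) : SpecialSpace f :=
  ⟨(q.1 + hf.index q.1 q.2 • a, q.2 - cocycle a f (hf.index q.1 q.2) q.1), by
    have h := hf.index_spec q.1 q.2
    rw [cocycle_succ] at h
    exact ⟨sub_nonneg.2 h.1, by simp only; linarith [h.2]⟩⟩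

theorem proj_eq (hf : IsFlowRoof a f M c₀ c₁) {q : UnitAddCircle × ℝ} {n : ℤ}
    (hn : cocycle a f n q.1 ≤ q.2 ∧ q.2 < cocycle a f (n + 1) q.1) :
    (hf.proj q).1 = (q.1 + n • a, q.2 - cocycle a f n q.1) := by
  rw [← hf.index_unique (hf.index_spec q.1 q.2) hn]
  rfl

theorem specialFlow_eq_proj (hf : IsFlowRoof a f M c₀ c₁) (t : ℝ) (p : SpecialSpace f) :
    specialFlow a f t p = hf.proj (p.1.1, p.1.2 + t) := by
  apply Subtype.ext
  rw [hf.specialFlow_val (hf.index_spec p.1.1 (p.1.2 + t))]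
  rfl

theorem proj_val (hf : IsFlowRoof a f M c₀ c₁) (p : SpecialSpace f) : hf.proj p.1 = p := by
  apply Subtype.ext
  rw [hf.proj_eq (n := 0)]
  · simp [cocycle_zero]
  · rw [cocycle_zero, cocycle_succ, cocycle_zero]
    simpa using p.2

/-- The skew product, iterated `n` times, followed by a translation of the fibre by `t`. -/
theorem proj_skew (hf : IsFlowRoof a f M c₀ c₁) (q : UnitAddCircle × ℝ) (n : ℤ) :
    hf.proj (q.1 + n • a, q.2 - cocycle a f n q.1) = hf.proj q := by
  apply Subtype.ext
  have h := hf.index_spec q.1 q.2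
  set m := hf.index q.1 q.2
  have e : ∀ k : ℤ, cocycle a f (k - n) (q.1 + n • a) = cocycle a f k q.1 - cocycle a f n q.1 := by
    intro k
    have := cocycle_add (a := a) (f := f) n (k - n) q.1
    rw [add_sub_cancel] at this
    linarith
  rw [hf.proj_eq h, hf.proj_eq (n := m - n)]
  · simp only [e]
    rw [add_assoc, ← add_zsmul, add_sub_cancel]
    congr 1
    ring
  · have e2 : m - n + 1 = (m + 1) - n := by ring
    simp only [e2, e]
    exact ⟨by linarith [h.1], by linarith [h.2]⟩

theorem specialFlow_proj (hf : IsFlowRoof a f M c₀ c₁) (t : ℝ) (q : UnitAddCircle × ℝ) :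
    specialFlow a f t (hf.proj q) = hf.proj (q.1, q.2 + t) := by
  rw [specialFlow_eq_proj hf]
  have := hf.proj_skew (q.1, q.2 + t) (hf.index q.1 q.2)
  simp only at this
  rw [← this]
  congr 2
  simp only [proj]
  ring

theorem specialFlow_add (hf : IsFlowRoof a f M c₀ c₁) (t s : ℝ) (p : SpecialSpace f) :
    specialFlow a f t (specialFlow a f s p) = specialFlow a f (s + t) p := by
  rw [hf.specialFlow_eq_proj s, hf.specialFlow_proj, hf.specialFlow_eq_proj, add_assoc]

theorem specialFlow_zero (hf : IsFlowRoof a f M c₀ c₁) (p : SpecialSpace f) :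
    specialFlow a f 0 p = p := by
  rw [hf.specialFlow_eq_proj, add_zero]
  exact hf.proj_val p

theorem iterate_specialFlow (hf : IsFlowRoof a f M c₀ c₁) (t : ℝ) (n : ℕ) (p : SpecialSpace f) :
    (specialFlow a f t)^[n] p = specialFlow a f (n * t) p := by
  induction n with
  | zero => simp [hf.specialFlow_zero]
  | succ n ih =>
    rw [Function.iterate_succ_apply', ih, hf.specialFlow_add]
    congr 1
    push_cast; ring

/-! ### Measurability -/

theorem measurable_cocycle (hf : IsFlowRoof a f M c₀ c₁) (n : ℤ) :
    Measurable (cocycle a f n) := by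
  rcases n with n | n
  · exact Finset.measurable_sum _ fun i _ => hf.meas.comp (measurable_id.add_const _)
  · exact (Finset.measurable_sum _ fun i _ => hf.meas.comp (measurable_id.sub_const _)).neg

theorem measurable_index (hf : IsFlowRoof a f M c₀ c₁) :
    Measurable fun q : UnitAddCircle × ℝ => hf.index q.1 q.2 := by
  refine measurable_to_countable' fun n => ?_
  have : (fun q : UnitAddCircle × ℝ => hf.index q.1 q.2) ⁻¹' {n} =
      {q | cocycle a f n q.1 ≤ q.2} ∩ {q | q.2 < cocycle a f (n + 1) q.1} := by
    ext q
    simp only [Set.mem_preimage, Set.mem_singleton_iff, Set.mem_inter_iff, Set.mem_ofPred_eq]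
    constructor
    · rintro rfl; exact hf.index_spec q.1 q.2
    · intro h; exact hf.index_unique (hf.index_spec q.1 q.2) h
  rw [this]
  exact (measurableSet_le ((hf.measurable_cocycle n).comp measurable_fst) measurable_snd).inter
    (measurableSet_lt measurable_snd ((hf.measurable_cocycle (n + 1)).comp measurable_fst))

theorem measurable_proj (hf : IsFlowRoof a f M c₀ c₁) : Measurable hf.proj := by
  refine Measurable.subtype_mk ?_
  have h : Measurable fun z : ℤ × (UnitAddCircle × ℝ) =>
      (z.2.1 + z.1 • a, z.2.2 - cocycle a f z.1 z.2.1) := by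
    refine measurable_from_prod_countable_right fun n => ?_
    have h1 : Measurable fun q : UnitAddCircle × ℝ => q.1 + n • a := measurable_fst.add_const _
    have h2 : Measurable fun q : UnitAddCircle × ℝ => q.2 - cocycle a f n q.1 :=
      measurable_snd.sub ((hf.measurable_cocycle n).comp measurable_fst)
    exact h1.prodMk h2
  exact h.comp (hf.measurable_index.prodMk measurable_id)

theorem measurable_specialFlow_uncurry (hf : IsFlowRoof a f M c₀ c₁) :
    Measurable fun z : ℝ × SpecialSpace f => specialFlow a f z.1 z.2 := by
  simp_rw [hf.specialFlow_eq_proj]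
  refine hf.measurable_proj.comp ?_
  have h : Measurable fun z : ℝ × SpecialSpace f => z.2.1 :=
    measurable_subtype_coe.comp measurable_snd
  exact (measurable_fst.comp h).prodMk ((measurable_snd.comp h).add measurable_fst)

theorem measurable_specialFlow (hf : IsFlowRoof a f M c₀ c₁) (t : ℝ) :
    Measurable (specialFlow a f t) :=
  hf.measurable_specialFlow_uncurry.comp (measurable_const.prodMk measurable_id)

/-! ### The invariant measure -/

theorem measurableSet_space (hf : IsFlowRoof a f M c₀ c₁) :
    MeasurableSet {p : UnitAddCircle × ℝ | 0 ≤ p.2 ∧ p.2 < f p.1} :=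
  (measurableSet_le measurable_const measurable_snd).inter
    (measurableSet_lt measurable_snd (hf.meas.comp measurable_fst))

theorem measurableEmbedding_val (hf : IsFlowRoof a f M c₀ c₁) :
    MeasurableEmbedding (Subtype.val : SpecialSpace f → UnitAddCircle × ℝ) :=
  MeasurableEmbedding.subtype_coe hf.measurableSet_space

theorem comap_apply (hf : IsFlowRoof a f M c₀ c₁) (E : Set (SpecialSpace f)) :
    (Measure.comap Subtype.val (volume : Measure (UnitAddCircle × ℝ)) : Measure (SpecialSpace f)) E
      = volume (Subtype.val '' E) :=
  hf.measurableEmbedding_val.comap_apply _ _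

theorem measurePreserving_skew (hf : IsFlowRoof a f M c₀ c₁) (n : ℤ) (t : ℝ) :
    MeasurePreserving (fun q : UnitAddCircle × ℝ => (q.1 + n • a, q.2 + (t - cocycle a f n q.1)))
      volume volume := by
  have h1 : MeasurePreserving (fun x : UnitAddCircle => x + n • a) volume volume :=
    measurePreserving_add_right _ _
  refine h1.skew_product (g := fun x s => s + (t - cocycle a f n x)) ?_ ?_
  · exact measurable_snd.add (measurable_const.sub ((hf.measurable_cocycle n).comp measurable_fst))
  · exact Eventually.of_forall fun x => (measurePreserving_add_right volume _).map_eq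

theorem measurePreserving_specialFlow_comap (hf : IsFlowRoof a f M c₀ c₁) (t : ℝ) :
    MeasurePreserving (specialFlow a f t)
      (Measure.comap Subtype.val (volume : Measure (UnitAddCircle × ℝ)))
      (Measure.comap Subtype.val (volume : Measure (UnitAddCircle × ℝ))) := by
  refine ⟨hf.measurable_specialFlow t, ?_⟩
  ext E hE
  rw [Measure.map_apply (hf.measurable_specialFlow t) hE, hf.comap_apply, hf.comap_apply]
  set Ω : Set (UnitAddCircle × ℝ) := {p | 0 ≤ p.2 ∧ p.2 < f p.1} with hΩ
  have hΩm : MeasurableSet Ω := hf.measurableSet_space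
  set Ev : Set (UnitAddCircle × ℝ) := Subtype.val '' E with hE'
  have hE'm : MeasurableSet Ev := hf.measurableEmbedding_val.measurableSet_image' hE
  have hE'Ω : Ev ⊆ Ω := by rintro _ ⟨p, -, rfl⟩; exact p.2
  set Φ : ℤ → UnitAddCircle × ℝ → UnitAddCircle × ℝ :=
    fun n q => (q.1 + n • a, q.2 + (t - cocycle a f n q.1)) with hΦ
  set Ψ : ℤ → UnitAddCircle × ℝ → UnitAddCircle × ℝ :=
    fun n q => (q.1 + (-n) • a, q.2 + (-t - cocycle a f (-n) q.1)) with hΨ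
  have hΨΦ : ∀ n q, Ψ n (Φ n q) = q := by
    intro n q
    simp only [hΨ, hΦ]
    rw [cocycle_neg, add_sub_cancel_right, neg_zsmul, add_neg_cancel_right]
    refine Prod.ext rfl ?_
    simp only
    ring
  have hΦm : ∀ n, MeasurePreserving (Φ n) volume volume := fun n => hf.measurePreserving_skew n t
  have hΨm : ∀ n, MeasurePreserving (Ψ n) volume volume :=
    fun n => hf.measurePreserving_skew (-n) (-t)
  have hΦΩ : ∀ n q, Φ n q ∈ Ω ↔
      cocycle a f n q.1 ≤ q.2 + t ∧ q.2 + t < cocycle a f (n + 1) q.1 := by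
    intro n q
    simp only [hΦ, hΩ, Set.mem_ofPred_eq]
    rw [cocycle_succ]
    constructor <;> rintro ⟨h1, h2⟩ <;> constructor <;> linarith
  have hΨΩ : ∀ n q, Ψ n q ∈ Ω ↔
      cocycle a f (-n) q.1 ≤ q.2 - t ∧ q.2 - t < cocycle a f (-n + 1) q.1 := by
    intro n q
    simp only [hΨ, hΩ, Set.mem_ofPred_eq]
    rw [cocycle_succ]
    constructor <;> rintro ⟨h1, h2⟩ <;> constructor <;> linarith
  have hpre : Subtype.val '' (specialFlow a f t ⁻¹' E) = ⋃ n, Ω ∩ Φ n ⁻¹' Ev := by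
    ext q
    constructor
    · rintro ⟨p, hp, rfl⟩
      have hi := hf.index_spec p.1.1 (p.1.2 + t)
      refine Set.mem_iUnion.2 ⟨hf.index p.1.1 (p.1.2 + t), p.2, _, hp, ?_⟩
      rw [hf.specialFlow_val hi]
      simp only [hΦ]
      congr 1
      ring
    · intro hq
      obtain ⟨n, hqΩ, hqE⟩ := Set.mem_iUnion.1 hq
      have hn := (hΦΩ n q).1 (hE'Ω hqE)
      obtain ⟨r, hr, hrq⟩ := hqE
      refine ⟨⟨q, hqΩ⟩, ?_, rfl⟩
      have : specialFlow a f t ⟨q, hqΩ⟩ = r := by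
        apply Subtype.ext
        rw [hf.specialFlow_val (p := ⟨q, hqΩ⟩) hn, hrq]
        simp only [hΦ]
        congr 1
        ring
      rw [Set.mem_preimage, this]
      exact hr
  have hdisj1 : Pairwise (Function.onFun Disjoint fun n => Ω ∩ Φ n ⁻¹' Ev) := by
    intro m n hmn
    rw [Function.onFun, Set.disjoint_left]
    rintro q ⟨-, h1⟩ ⟨-, h2⟩
    exact hmn (hf.index_unique ((hΦΩ m q).1 (hE'Ω h1)) ((hΦΩ n q).1 (hE'Ω h2)))
  have hdisj2 : Pairwise (Function.onFun Disjoint fun n => Ψ n ⁻¹' Ω ∩ Ev) := by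
    intro m n hmn
    rw [Function.onFun, Set.disjoint_left]
    rintro q ⟨h1, -⟩ ⟨h2, -⟩
    exact hmn (neg_injective (hf.index_unique ((hΨΩ m q).1 h1) ((hΨΩ n q).1 h2)))
  have hE'' : Ev = ⋃ n, Ψ n ⁻¹' Ω ∩ Ev := by
    ext q
    constructor
    · intro hq
      refine Set.mem_iUnion.2 ⟨-hf.index q.1 (q.2 - t), ?_, hq⟩
      rw [Set.mem_preimage, hΨΩ, neg_neg]
      exact hf.index_spec q.1 (q.2 - t)
    · intro hq
      obtain ⟨n, -, h⟩ := Set.mem_iUnion.1 hq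
      exact h
  have hm2 : ∀ n, MeasurableSet (Ψ n ⁻¹' Ω ∩ Ev) :=
    fun n => ((hΨm n).measurable hΩm).inter hE'm
  rw [hpre, measure_iUnion hdisj1 fun n => hΩm.inter ((hΦm n).measurable hE'm), hE'',
    measure_iUnion hdisj2 hm2, ← hE'']
  refine tsum_congr fun n => ?_
  rw [← (hΦm n).measure_preimage (hm2 n).nullMeasurableSet]
  congr 1
  ext q
  simp only [Set.mem_inter_iff, Set.mem_preimage, hΨΦ]

theorem volume_image_eq_lintegral (hf : IsFlowRoof a f M c₀ c₁) {E : Set (SpecialSpace f)}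
    (hE : MeasurableSet E) : volume (Subtype.val '' E) =
      ∫⁻ x, volume {s : ℝ | (x, s) ∈ Subtype.val '' E} := by
  have := hf.measurableEmbedding_val.measurableSet_image' hE
  exact Measure.prod_apply this

theorem volume_univ_eq (hf : IsFlowRoof a f M c₀ c₁) :
    volume (Subtype.val '' (Set.univ : Set (SpecialSpace f))) =
      ∫⁻ x, ENNReal.ofReal (f x) := by
  rw [hf.volume_image_eq_lintegral MeasurableSet.univ]
  refine lintegral_congr fun x => ?_
  have : {s : ℝ | (x, s) ∈ Subtype.val '' (Set.univ : Set (SpecialSpace f))} = Set.Ico 0 (f x) := by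
    ext s
    simp
  rw [this, Real.volume_Ico, sub_zero]

theorem volume_univ_ne_zero (hf : IsFlowRoof a f M c₀ c₁) :
    volume (Subtype.val '' (Set.univ : Set (SpecialSpace f))) ≠ 0 := by
  rw [hf.volume_univ_eq, Ne, lintegral_eq_zero_iff hf.meas.ennreal_ofReal]
  intro h
  have h2 : ∀ᵐ x : UnitAddCircle, False := by
    filter_upwards [h] with x hx
    have := hf.pos x
    simp at hx
    linarith
  rw [eventually_false_iff_eq_bot, ae_eq_bot] at h2
  have := UnitAddCircle.measure_univ
  rw [h2] at this
  simp at this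

theorem volume_univ_ne_top (hf : IsFlowRoof a f M c₀ c₁) :
    volume (Subtype.val '' (Set.univ : Set (SpecialSpace f))) ≠ ⊤ := by
  rw [hf.volume_univ_eq]
  refine ne_of_lt (lt_of_le_of_lt (lintegral_mono fun x => ENNReal.ofReal_le_ofReal (hf.le x)) ?_)
  rw [lintegral_const, UnitAddCircle.measure_univ, mul_one]
  exact ENNReal.ofReal_lt_top

theorem specialMeasure_apply (hf : IsFlowRoof a f M c₀ c₁) (E : Set (SpecialSpace f)) :
    specialMeasure f E = (volume (Subtype.val '' (Set.univ : Set (SpecialSpace f))))⁻¹ *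
      volume (Subtype.val '' E) := by
  rw [specialMeasure, Measure.smul_apply, hf.comap_apply, hf.comap_apply, smul_eq_mul]

theorem isProbabilityMeasure (hf : IsFlowRoof a f M c₀ c₁) :
    IsProbabilityMeasure (specialMeasure f) :=
  ⟨by rw [hf.specialMeasure_apply, ENNReal.inv_mul_cancel hf.volume_univ_ne_zero
    hf.volume_univ_ne_top]⟩

theorem measurePreserving_specialFlow (hf : IsFlowRoof a f M c₀ c₁) (t : ℝ) :
    MeasurePreserving (specialFlow a f t) (specialMeasure f) (specialMeasure f) :=
  (hf.measurePreserving_specialFlow_comap t).smul_measure _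

theorem specialMeasure_eq_zero_iff (hf : IsFlowRoof a f M c₀ c₁) (E : Set (SpecialSpace f)) :
    specialMeasure f E = 0 ↔ volume (Subtype.val '' E) = 0 := by
  rw [hf.specialMeasure_apply, mul_eq_zero, or_iff_right]
  exact ENNReal.inv_ne_zero.2 hf.volume_univ_ne_top

/-- The projection pulls null sets back to null sets. -/
theorem quasiMeasurePreserving_proj (hf : IsFlowRoof a f M c₀ c₁) :
    Measure.QuasiMeasurePreserving hf.proj volume (specialMeasure f) := by
  refine ⟨hf.measurable_proj, Measure.AbsolutelyContinuous.mk fun E hE h0 => ?_⟩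
  rw [hf.specialMeasure_eq_zero_iff] at h0
  rw [Measure.map_apply hf.measurable_proj hE]
  have hsub : hf.proj ⁻¹' E ⊆ ⋃ n : ℤ,
      (fun q : UnitAddCircle × ℝ => (q.1 + n • a, q.2 + (0 - cocycle a f n q.1))) ⁻¹'
        (Subtype.val '' E) := by
    intro q hq
    refine Set.mem_iUnion.2 ⟨hf.index q.1 q.2, hf.proj q, hq, ?_⟩
    rw [hf.proj_eq (hf.index_spec q.1 q.2)]
    simp only
    congr 1
    ring
  refine measure_mono_null hsub (measure_iUnion_null fun n => ?_)
  rw [(hf.measurePreserving_skew n 0).measure_preimage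
    (hf.measurableEmbedding_val.measurableSet_image' hE).nullMeasurableSet]
  exact h0

end IsFlowRoof

end

noncomputable section

/-! ### Ergodic averages along windows -/

section Ergodic

variable {X : Type*} {T : X → X}

/-- The maximum of `0` and the first `n` Birkhoff sums of `u`. -/
def birkhoffMax (T : X → X) (u : X → ℝ) : ℕ → X → ℝ
  | 0, _ => 0
  | n + 1, x => max 0 (u x + birkhoffMax T u n (T x))

theorem birkhoffMax_nonneg (u : X → ℝ) (n : ℕ) (x : X) : 0 ≤ birkhoffMax T u n x := by
  cases n with
  | zero => exact le_rfl
  | succ n => exact le_max_left _ _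

theorem birkhoffMax_le_succ (u : X → ℝ) (n : ℕ) (x : X) :
    birkhoffMax T u n x ≤ birkhoffMax T u (n + 1) x := by
  induction n generalizing x with
  | zero => exact birkhoffMax_nonneg u 1 x
  | succ n ih =>
    rw [birkhoffMax, birkhoffMax]
    exact max_le_max le_rfl (by linarith [ih (T x)])

theorem birkhoffSum_le_birkhoffMax (u : X → ℝ) (n : ℕ) (x : X) :
    birkhoffSum T u n x ≤ birkhoffMax T u n x := by
  induction n generalizing x with
  | zero => rw [birkhoffSum_zero]; exact le_rfl
  | succ n ih =>
    rw [birkhoffSum_succ', birkhoffMax]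
    exact (add_le_add_right (ih (T x)) _).trans (le_max_right _ _)

variable [MeasurableSpace X] {μ : Measure X}

theorem measurable_birkhoffMax (hT : Measurable T) {u : X → ℝ} (hu : Measurable u) (n : ℕ) :
    Measurable (birkhoffMax T u n) := by
  induction n with
  | zero => exact measurable_const
  | succ n ih => exact measurable_const.max (hu.add (ih.comp hT))

theorem integrable_birkhoffMax [IsFiniteMeasure μ] (hT : MeasurePreserving T μ μ) {u : X → ℝ}
    (hu : Integrable u μ) (n : ℕ) : Integrable (birkhoffMax T u n) μ := by
  induction n with
  | zero => exact integrable_const 0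
  | succ n ih =>
    exact (integrable_const (0 : ℝ)).sup (hu.add (hT.integrable_comp_of_integrable ih))

theorem setIntegral_birkhoffMax_nonneg [IsFiniteMeasure μ] (hT : MeasurePreserving T μ μ)
    {u : X → ℝ} (hum : Measurable u) (hu : Integrable u μ) (n : ℕ) :
    0 ≤ ∫ x in {x | 0 < birkhoffMax T u n x}, u x ∂μ := by
  cases n with
  | zero => simp [birkhoffMax]
  | succ n =>
    set m := birkhoffMax T u (n + 1) with hm
    have hmi : Integrable m μ := integrable_birkhoffMax hT hu _
    have hmm : Measurable m := measurable_birkhoffMax hT.measurable hum _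
    have hmT : Integrable (fun x => m (T x)) μ := hT.integrable_comp_of_integrable hmi
    have hS : MeasurableSet {x | 0 < m x} := measurableSet_lt measurable_const hmm
    have h0 : ∀ x, 0 ≤ m x := birkhoffMax_nonneg u _
    have h1 : ∀ x ∈ {x | 0 < m x}, m x - m (T x) ≤ u x := by
      intro x hx
      have hx' : 0 < m x := hx
      have e : m x = max 0 (u x + birkhoffMax T u n (T x)) := rfl
      have e2 : m x = u x + birkhoffMax T u n (T x) := by
        rw [e]
        rcases le_total (u x + birkhoffMax T u n (T x)) 0 with h | h
        · rw [e, max_eq_left h] at hx'; exact absurd hx' (lt_irrefl _)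
        · exact max_eq_right h
      have e3 : birkhoffMax T u n (T x) ≤ m (T x) := birkhoffMax_le_succ u n (T x)
      linarith
    have h2 : ∫ x in {x | 0 < m x}, (m x - m (T x)) ∂μ ≤ ∫ x in {x | 0 < m x}, u x ∂μ :=
      setIntegral_mono_on (hmi.sub hmT).integrableOn hu.integrableOn hS h1
    refine le_trans ?_ h2
    rw [integral_sub hmi.integrableOn hmT.integrableOn]
    have h3 : ∫ x in {x | 0 < m x}, m x ∂μ = ∫ x, m x ∂μ := by
      refine setIntegral_eq_integral_of_forall_compl_eq_zero fun x hx => ?_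
      exact le_antisymm (not_lt.1 hx) (h0 x)
    have h4 : ∫ x in {x | 0 < m x}, m (T x) ∂μ ≤ ∫ x, m (T x) ∂μ :=
      setIntegral_le_integral hmT (Eventually.of_forall fun x => h0 (T x))
    have h5 : ∫ x, m (T x) ∂μ = ∫ x, m x ∂μ := by
      conv_rhs => rw [← hT.map_eq]
      rw [integral_map hT.measurable.aemeasurable hmm.aestronglyMeasurable]
    linarith

/-- The maximal ergodic inequality. -/
theorem measureReal_exists_lt_birkhoffSum_le [IsFiniteMeasure μ] (hT : MeasurePreserving T μ μ)
    {g : X → ℝ} (hgm : Measurable g) (hg : Integrable g μ) (hg0 : ∀ x, 0 ≤ g x) {l : ℝ}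
    (hl : 0 < l) :
    μ.real {x | ∃ n : ℕ, l * n < birkhoffSum T g n x} ≤ (∫ x, g x ∂μ) / l := by
  set u : X → ℝ := fun x => g x - l with hu
  have hum : Measurable u := hgm.sub measurable_const
  have hui : Integrable u μ := hg.sub (integrable_const l)
  set S : ℕ → Set X := fun n => {x | 0 < birkhoffMax T u n x} with hS
  have hSm : ∀ n, MeasurableSet (S n) :=
    fun n => measurableSet_lt measurable_const (measurable_birkhoffMax hT.measurable hum n)
  have hmono : Monotone S := monotone_nat_of_le_succ fun n x hx =>
    lt_of_lt_of_le (show 0 < birkhoffMax T u n x from hx) (birkhoffMax_le_succ u n x)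
  have hbound : ∀ n, μ.real (S n) ≤ (∫ x, g x ∂μ) / l := by
    intro n
    have h1 := setIntegral_birkhoffMax_nonneg hT hum hui n
    rw [hu, integral_sub hg.integrableOn (integrable_const l).integrableOn, setIntegral_const,
      smul_eq_mul] at h1
    have h2 : ∫ x in S n, g x ∂μ ≤ ∫ x, g x ∂μ :=
      setIntegral_le_integral hg (Eventually.of_forall hg0)
    rw [le_div_iff₀ hl]
    change 0 ≤ (∫ x in S n, g x ∂μ) - μ.real (S n) * l at h1
    linarith
  have hsub : {x | ∃ n : ℕ, l * n < birkhoffSum T g n x} ⊆ ⋃ n, S n := by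
    rintro x ⟨n, hn⟩
    refine Set.mem_iUnion.2 ⟨n, lt_of_lt_of_le ?_ (birkhoffSum_le_birkhoffMax u n x)⟩
    have : birkhoffSum T u n x = birkhoffSum T g n x - l * n := by
      simp only [birkhoffSum, hu, Finset.sum_sub_distrib, Finset.sum_const, Finset.card_range,
        nsmul_eq_mul]
      ring
    rw [this]; linarith
  have hlim : Tendsto (fun n => μ.real (S n)) atTop (𝓝 (μ.real (⋃ n, S n))) := by
    have := tendsto_measure_iUnion_atTop (μ := μ) hmono
    exact (ENNReal.tendsto_toReal (measure_ne_top μ _)).comp this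
  exact (measureReal_mono hsub).trans (le_of_tendsto' hlim hbound)

theorem koopman_birkhoffSum_ae_eq (hT : MeasurePreserving T μ μ) (φ : Lp ℝ 2 μ) (n : ℕ) :
    (birkhoffSum (Lp.compMeasurePreservingₗᵢ ℝ T hT) id n φ : Lp ℝ 2 μ) =ᵐ[μ]
      birkhoffSum T φ n := by
  have hit : ∀ n : ℕ, ((Lp.compMeasurePreservingₗᵢ ℝ T hT)^[n] φ : Lp ℝ 2 μ) =ᵐ[μ]
      fun x => φ (T^[n] x) := by
    intro n
    induction n with
    | zero => exact EventuallyEq.rfl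
    | succ n ih =>
      rw [Function.iterate_succ_apply']
      have h1 := Lp.coeFn_compMeasurePreserving ((Lp.compMeasurePreservingₗᵢ ℝ T hT)^[n] φ) hT
      have h2 := hT.quasiMeasurePreserving.ae_eq_comp ih
      refine h1.trans (h2.trans (Eventually.of_forall fun x => ?_))
      simp only [Function.comp_apply]
      rw [← Function.iterate_succ_apply]
  induction n with
  | zero =>
    rw [birkhoffSum_zero, birkhoffSum_zero']
    exact Lp.coeFn_zero ℝ 2 μ
  | succ n ih =>
    rw [birkhoffSum_succ]
    filter_upwards [Lp.coeFn_add (birkhoffSum (Lp.compMeasurePreservingₗᵢ ℝ T hT) id n φ)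
      (id ((Lp.compMeasurePreservingₗᵢ ℝ T hT)^[n] φ)), ih, hit n] with x h1 h2 h3
    rw [h1, birkhoffSum_succ, Pi.add_apply, h2]
    congr 1

theorem exists_integral_abs_average_sub_le [IsProbabilityMeasure μ] (hT : Ergodic T μ) {B : Set X}
    (hB : MeasurableSet B) {τ : ℝ} (hτ : 0 < τ) :
    ∃ (c : ℝ) (n : ℕ), 0 < n ∧
      ∫ x, |(n : ℝ)⁻¹ * birkhoffSum T (B.indicator 1) n x - c| ∂μ ≤ τ := by
  have hmp := hT.toMeasurePreserving
  set φ : Lp ℝ 2 μ := indicatorConstLp 2 hB (measure_ne_top μ B) (1 : ℝ) with hφ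
  have hφae : φ =ᵐ[μ] B.indicator 1 := indicatorConstLp_coeFn
  set U : Lp ℝ 2 μ →L[ℝ] Lp ℝ 2 μ :=
    (Lp.compMeasurePreservingₗᵢ ℝ T hmp).toContinuousLinearMap with hU
  have hlim := U.tendsto_birkhoffAverage_orthogonalProjection
    (LinearIsometry.norm_toContinuousLinearMap_le _) φ
  set ψ : Lp ℝ 2 μ :=
    ((U.eqLocus (1 : Lp ℝ 2 μ →L[ℝ] Lp ℝ 2 μ)).orthogonalProjectionOnto φ).val with hψ
  have hψfix : U ψ = ψ := ((U.eqLocus (1 : Lp ℝ 2 μ →L[ℝ] Lp ℝ 2 μ)).orthogonalProjectionOnto φ).2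
  obtain ⟨c, hc⟩ : ∃ c, ψ =ᵐ[μ] Function.const X c := by
    refine hT.ae_eq_const_of_ae_eq_comp_ae (Lp.aestronglyMeasurable ψ) ?_
    have h1 := Lp.coeFn_compMeasurePreserving ψ hmp
    refine h1.symm.trans ?_
    change (U ψ : X → ℝ) =ᵐ[μ] ψ
    rw [hψfix]
  obtain ⟨n, hn0, hn⟩ := ((eventually_gt_atTop 0).and (Metric.tendsto_nhds.1 hlim τ hτ)).exists
  refine ⟨c, n, hn0, ?_⟩
  rw [dist_eq_norm] at hn
  set v : Lp ℝ 2 μ := birkhoffAverage ℝ U id n φ - ψ with hv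
  have hvae : (fun x => (n : ℝ)⁻¹ * birkhoffSum T (B.indicator 1) n x - c) =ᵐ[μ] v := by
    filter_upwards [Lp.coeFn_sub (birkhoffAverage ℝ U id n φ) ψ, hc,
      Lp.coeFn_smul ((n : ℝ)⁻¹) (birkhoffSum U id n φ), koopman_birkhoffSum_ae_eq hmp φ n,
      Measure.QuasiMeasurePreserving.birkhoffSum_ae_eq_of_ae_eq hmp.quasiMeasurePreserving hφae n]
      with x h1 h2 h3 h4 h5
    rw [h1, Pi.sub_apply, h2, Function.const_apply]
    congr 1
    change _ = ((n : ℝ)⁻¹ • birkhoffSum U id n φ : Lp ℝ 2 μ) x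
    rw [h3, Pi.smul_apply, smul_eq_mul, ← h5, ← h4]
    rfl
  calc ∫ x, |(n : ℝ)⁻¹ * birkhoffSum T (B.indicator 1) n x - c| ∂μ = ∫ x, ‖v x‖ ∂μ :=
        integral_congr_ae (hvae.fun_comp fun y => |y|)
    _ = (eLpNorm v 1 μ).toReal := by
        rw [eLpNorm_one_eq_lintegral_enorm,
          integral_norm_eq_lintegral_enorm (Lp.aestronglyMeasurable v)]
    _ ≤ (eLpNorm v 2 μ).toReal := by
        refine ENNReal.toReal_mono (Lp.eLpNorm_ne_top v) ?_
        exact eLpNorm_le_eLpNorm_of_exponent_le (by norm_num) (Lp.aestronglyMeasurable v)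
    _ = ‖v‖ := (Lp.norm_def v).symm
    _ ≤ τ := hn.le

/-- Outside a set of small measure, the frequency of visits to `B` in all long windows
`[M, M + L]` with `L / M` bounded below exceeds `μ B` by little. -/
theorem Ergodic.exists_sum_window_le [IsProbabilityMeasure μ] (hT : Ergodic T μ) {B : Set X}
    (hB : MeasurableSet B) {ε κ : ℝ} (hε : 0 < ε) (hκ : 0 < κ) :
    ∃ (N : ℕ) (Z : Set X), MeasurableSet Z ∧ 1 - ε < μ.real Z ∧ ∀ x ∈ Z, ∀ M L : ℕ, N ≤ L →
      κ * M ≤ L →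
      ∑ i ∈ Finset.range (L + 1), B.indicator (1 : X → ℝ) (T^[M + i] x) ≤ (μ.real B + ε) * L := by
  have hmp := hT.toMeasurePreserving
  set l : ℝ := ε / (4 * (1 / κ + 2)) with hl
  have hl0 : 0 < l := by positivity
  set τ : ℝ := min (ε * l / 2) (ε / 4) with hτ
  have hτ0 : 0 < τ := by positivity
  obtain ⟨c, n, hn0, hn⟩ := exists_integral_abs_average_sub_le hT hB hτ0
  set φ : X → ℝ := B.indicator 1 with hφ
  have hφm : Measurable φ := measurable_one.indicator hB
  have hφ01 : ∀ x, 0 ≤ φ x ∧ φ x ≤ 1 := by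
    intro x
    by_cases hx : x ∈ B
    · simp [hφ, hx]
    · simp [hφ, hx]
  have hφi : Integrable φ μ := (integrable_const (1 : ℝ)).indicator hB
  have hnR : (0 : ℝ) < n := by exact_mod_cast hn0
  have hbm : Measurable (birkhoffSum T φ n) :=
    Finset.measurable_sum _ fun i _ => hφm.comp (hmp.measurable.iterate i)
  have hbi : Integrable (birkhoffSum T φ n) μ :=
    integrable_finsetSum _ fun i _ => (hmp.iterate i).integrable_comp_of_integrable hφi
  have hbint : ∫ x, birkhoffSum T φ n x ∂μ = n * μ.real B := by
    simp only [birkhoffSum]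
    rw [integral_finsetSum (f := fun i x => φ (T^[i] x)) _
      fun i _ => (hmp.iterate i).integrable_comp_of_integrable hφi]
    have : ∀ i, ∫ x, φ (T^[i] x) ∂μ = μ.real B := by
      intro i
      have h1 : ∫ x, φ (T^[i] x) ∂μ = ∫ x, φ x ∂μ := by
        conv_rhs => rw [← (hmp.iterate i).map_eq]
        rw [integral_map (hmp.iterate i).measurable.aemeasurable hφm.aestronglyMeasurable]
      rw [h1, hφ, integral_indicator_one hB]
    simp [this]
  set g : X → ℝ := fun x => |(n : ℝ)⁻¹ * birkhoffSum T φ n x - c| with hg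
  have hgm : Measurable g := by
    have : Measurable fun x => (n : ℝ)⁻¹ * birkhoffSum T φ n x - c :=
      (hbm.const_mul _).sub_const _
    exact this.abs
  have hgi : Integrable g μ := ((hbi.const_mul _).sub (integrable_const c)).abs
  have hcB : c ≤ μ.real B + ε / 4 := by
    have h1 : ∫ x, ((n : ℝ)⁻¹ * birkhoffSum T φ n x - c) ∂μ = μ.real B - c := by
      rw [integral_sub (hbi.const_mul _) (integrable_const c), integral_const_mul, hbint]
      simp only [integral_const, probReal_univ, smul_eq_mul, one_mul]
      field_simp
    have h2 := abs_integral_le_integral_abs (μ := μ)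
      (f := fun x => (n : ℝ)⁻¹ * birkhoffSum T φ n x - c)
    rw [h1] at h2
    have h3 := (abs_le.1 (h2.trans (hn.trans (min_le_right _ _)))).1
    linarith
  have hmax := measureReal_exists_lt_birkhoffSum_le hmp hgm hgi (fun x => abs_nonneg _) hl0
  set S : Set X := {x | ∃ n : ℕ, l * n < birkhoffSum T g n x} with hS
  have hSm : MeasurableSet S := by
    have : S = ⋃ k : ℕ, {x | l * k < birkhoffSum T g k x} := by
      ext x; simp [hS]
    rw [this]
    refine MeasurableSet.iUnion fun k => measurableSet_lt measurable_const ?_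
    exact Finset.measurable_sum _ fun i _ => hgm.comp (hmp.measurable.iterate i)
  have hSle : μ.real S < ε := by
    refine lt_of_le_of_lt hmax ?_
    rw [div_lt_iff₀ hl0]
    refine lt_of_le_of_lt (hn.trans (min_le_left _ _)) ?_
    have : 0 < ε * l := by positivity
    linarith
  refine ⟨⌈(4 * (n + 1 + c + l)) / ε⌉₊, Sᶜ, hSm.compl, ?_, ?_⟩
  · rw [probReal_compl_eq_one_sub hSm]; linarith
  intro x hx M L hL hML
  have hgx : ∀ k : ℕ, birkhoffSum T g k x ≤ l * k := by
    intro k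
    by_contra hcon
    exact hx ⟨k, not_le.1 hcon⟩
  have hLε : n + 1 + c + l ≤ ε / 4 * L := by
    have h1 : (4 * (n + 1 + c + l)) / ε ≤ L := (Nat.le_ceil _).trans (by exact_mod_cast hL)
    rw [div_le_iff₀ hε] at h1
    linarith
  -- replacing the sum by a sum of averages costs at most `n`
  have hshift : ∀ j : ℕ, ∑ i ∈ Finset.range (L + 1), φ (T^[M + i] x) ≤
      ∑ i ∈ Finset.range (L + 1), φ (T^[M + i + j] x) + j := by
    intro j
    induction j with
    | zero => simp
    | succ j ih =>
      have h1 : ∑ i ∈ Finset.range (L + 1), φ (T^[M + i + j] x) ≤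
          ∑ i ∈ Finset.range (L + 1), φ (T^[M + i + (j + 1)] x) + 1 := by
        have e1 := Finset.sum_range_succ' (fun i => φ (T^[M + i + j] x)) (L + 1)
        have e2 := Finset.sum_range_succ (fun i => φ (T^[M + i + j] x)) (L + 1)
        have e3 : ∀ i, φ (T^[M + (i + 1) + j] x) = φ (T^[M + i + (j + 1)] x) := fun i => by
          congr 2; omega
        simp only [e3] at e1
        have := (hφ01 (T^[M + 0 + j] x)).2
        have := (hφ01 (T^[M + (L + 1) + j] x)).1
        linarith
      push_cast
      linarith
  have havg : ∑ i ∈ Finset.range (L + 1), φ (T^[M + i] x) ≤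
      ∑ i ∈ Finset.range (L + 1), (n : ℝ)⁻¹ * birkhoffSum T φ n (T^[M + i] x) + n := by
    have e1 : ∑ i ∈ Finset.range (L + 1), (n : ℝ)⁻¹ * birkhoffSum T φ n (T^[M + i] x) =
        (n : ℝ)⁻¹ * ∑ j ∈ Finset.range n, ∑ i ∈ Finset.range (L + 1), φ (T^[M + i + j] x) := by
      rw [← Finset.mul_sum, Finset.sum_comm]
      congr 1
      refine Finset.sum_congr rfl fun i _ => ?_
      rw [birkhoffSum]
      refine Finset.sum_congr rfl fun j _ => ?_
      rw [← Function.iterate_add_apply, add_comm j]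
    have e2 : n * ∑ i ∈ Finset.range (L + 1), φ (T^[M + i] x) ≤
        ∑ j ∈ Finset.range n, ∑ i ∈ Finset.range (L + 1), φ (T^[M + i + j] x) + n * n := by
      have e3 : ∀ j ∈ Finset.range n, ∑ i ∈ Finset.range (L + 1), φ (T^[M + i] x) ≤
          ∑ i ∈ Finset.range (L + 1), φ (T^[M + i + j] x) + n := by
        intro j hj
        have : (j : ℝ) ≤ n := by exact_mod_cast (Finset.mem_range.1 hj).le
        linarith [hshift j]
      have := Finset.sum_le_sum e3
      rw [Finset.sum_add_distrib, Finset.sum_const, Finset.sum_const, Finset.card_range,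
        nsmul_eq_mul, nsmul_eq_mul] at this
      exact this
    rw [e1, inv_mul_eq_div, ← sub_le_iff_le_add, le_div_iff₀ hnR]
    linarith
  have hsumg : ∑ i ∈ Finset.range (L + 1), (n : ℝ)⁻¹ * birkhoffSum T φ n (T^[M + i] x) ≤
      (L + 1) * c + birkhoffSum T g (M + (L + 1)) x := by
    have e1 : ∑ i ∈ Finset.range (L + 1), g (T^[M + i] x) ≤ birkhoffSum T g (M + (L + 1)) x := by
      rw [birkhoffSum, Finset.sum_range_add _ M (L + 1)]
      have : 0 ≤ ∑ i ∈ Finset.range M, g (T^[i] x) := Finset.sum_nonneg fun i _ => abs_nonneg _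
      linarith
    have e2 : ∀ i ∈ Finset.range (L + 1), (n : ℝ)⁻¹ * birkhoffSum T φ n (T^[M + i] x) ≤
        c + g (T^[M + i] x) := by
      intro i _
      have := le_abs_self ((n : ℝ)⁻¹ * birkhoffSum T φ n (T^[M + i] x) - c)
      simp only [hg]
      linarith
    have e3 := Finset.sum_le_sum e2
    rw [Finset.sum_add_distrib, Finset.sum_const, Finset.card_range, nsmul_eq_mul] at e3
    push_cast at e3
    linarith
  have hfin := hgx (M + (L + 1))
  push_cast at hfin
  have hl2 : l * (1 / κ + 2) = ε / 4 := by rw [hl]; field_simp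
  have hMκ : (M : ℝ) ≤ 1 / κ * L := by
    rw [one_div_mul_eq_div, le_div_iff₀ hκ]; linarith
  have hlM : l * M ≤ l * (1 / κ * L) := mul_le_mul_of_nonneg_left hMκ hl0.le
  have hL0 : (0 : ℝ) ≤ L := Nat.cast_nonneg L
  have hcL : c * L ≤ (μ.real B + ε / 4) * L := mul_le_mul_of_nonneg_right hcB hL0
  have hexp : l * (1 / κ * L) + l * L + l * L = ε / 4 * L := by rw [← hl2]; ring
  have hεL : 0 ≤ ε * L := by positivity
  have hlL : 0 ≤ l * L := by positivity
  linarith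

end Ergodic

end

noncomputable section

/-! ### Regularity of the roof -/

theorem IsACOnCircle.continuous_coe {fa : UnitAddCircle → ℝ} (h : IsACOnCircle fa) :
    Continuous fun x : ℝ => fa (x : UnitAddCircle) := by
  obtain ⟨g, -, hgint, -, hg⟩ := h.exists_deriv
  have : (fun x : ℝ => fa (x : UnitAddCircle)) =
      fun x : ℝ => (∫ t in (0 : ℝ)..x, g t) + fa ((0 : ℝ) : UnitAddCircle) := by
    ext x; rw [← hg]; ring
  rw [this]
  exact (intervalIntegral.continuous_primitive hgint 0).add continuous_const

theorem measurable_of_continuousAt_off_finite {X : Type*} [TopologicalSpace X] [T1Space X]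
    [MeasurableSpace X] [BorelSpace X] {f : X → ℝ} {s : Set X} (hs : s.Finite)
    (hf : ∀ x ∉ s, ContinuousAt f x) : Measurable f := by
  refine measurable_of_isOpen fun U hU => ?_
  have h1 : IsOpen (f ⁻¹' U ∩ sᶜ) := by
    rw [isOpen_iff_mem_nhds]
    rintro x ⟨hxU, hxs⟩
    exact inter_mem ((hf x hxs).preimage_mem_nhds (hU.mem_nhds hxU))
      (hs.isClosed.isOpen_compl.mem_nhds hxs)
  have h2 : (f ⁻¹' U ∩ s).Finite := hs.subset Set.inter_subset_right
  have : f ⁻¹' U = (f ⁻¹' U ∩ sᶜ) ∪ (f ⁻¹' U ∩ s) := by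
    rw [Set.union_comm, Set.inter_union_compl]
  rw [this]
  exact h1.measurableSet.union h2.measurableSet

namespace IsDriftRoof

variable {f fa : UnitAddCircle → ℝ} {J G : ℝ → ℝ} {σ g b : ℝ} {F : Finset UnitAddCircle}

theorem exists_arc_free (F : Finset UnitAddCircle) {y : ℝ} (hy : (y : UnitAddCircle) ∉ F) :
    ∃ r : ℝ, 0 < r ∧ ∀ z, |z - y| < r → (z : UnitAddCircle) ∉ F := by
  have hopen : IsOpen {z : ℝ | (z : UnitAddCircle) ∉ F} :=
    F.finite_toSet.isClosed.isOpen_compl.preimage (AddCircle.continuous_mk' 1)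
  obtain ⟨r, hr, hball⟩ := Metric.isOpen_iff.1 hopen y hy
  exact ⟨r, hr, fun z hz => hball (by rwa [Metric.mem_ball, Real.dist_eq])⟩

theorem continuousAt (hf : IsDriftRoof f fa J G σ g b F) {x : UnitAddCircle} (hx : x ∉ F) :
    ContinuousAt f x := by
  obtain ⟨y, rfl⟩ := QuotientAddGroup.mk_surjective x
  obtain ⟨r, hr, hfree⟩ := exists_arc_free F hx
  have h1 : ContinuousAt (fun z : ℝ => fa (z : UnitAddCircle) + J y + σ * G z) y :=
    ((hf.ac.continuous_coe.add continuous_const).add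
      (continuous_const.mul hf.dist.cont)).continuousAt
  have hJ : ∀ z, |z - y| < r → J z = J y := by
    intro z hz
    rw [abs_lt] at hz
    rcases le_total y z with h | h
    · have := hf.const y (z - y) (by linarith) (by
        rintro ⟨t, ⟨h1, h2⟩, h3⟩
        exact hfree t (by rw [abs_lt]; constructor <;> linarith) h3)
      rwa [add_sub_cancel] at this
    · have := hf.const z (y - z) (by linarith) (by
        rintro ⟨t, ⟨h1, h2⟩, h3⟩
        exact hfree t (by rw [abs_lt]; constructor <;> linarith) h3)
      rw [add_sub_cancel] at this
      exact this.symm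
  have h2 : ContinuousAt (f ∘ (QuotientAddGroup.mk : ℝ → UnitAddCircle)) y := by
    refine h1.congr ?_
    filter_upwards [Metric.ball_mem_nhds y hr] with z hz
    rw [Metric.mem_ball, Real.dist_eq] at hz
    rw [← hJ z hz]
    exact (hf.eq z).symm
  exact (QuotientAddGroup.isOpenQuotientMap_mk.continuousAt_comp_iff).1 h2

theorem measurable (hf : IsDriftRoof f fa J G σ g b F) : Measurable f :=
  measurable_of_continuousAt_off_finite F.finite_toSet fun _ hx => hf.continuousAt hx

theorem exists_arc_lower_bound (hf : IsDriftRoof f fa J G σ g b F) (hpos : ∀ x, 0 < f x) :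
    ∃ y h e : ℝ, 0 < h ∧ h ≤ 1 ∧ 0 < e ∧ ∀ z ∈ Set.Ico y (y + h), e ≤ f (z : UnitAddCircle) := by
  obtain ⟨x, hx⟩ : ∃ x : UnitAddCircle, x ∉ F := by
    by_contra hcon
    push Not at hcon
    have hinj : Set.InjOn (fun x : ℝ => (x : UnitAddCircle)) (Set.Ico 0 1) := by
      intro x hx y hy hxy
      refine (AddCircle.coe_eq_coe_iff_of_mem_Ico (p := (1 : ℝ)) (a := 0) ?_ ?_).1 hxy <;>
        simpa
    refine (Set.Ico_infinite (zero_lt_one (α := ℝ))) (Set.Finite.of_finite_image ?_ hinj)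
    exact F.finite_toSet.subset fun x _ => hcon x
  obtain ⟨y, rfl⟩ := QuotientAddGroup.mk_surjective x
  change (y : UnitAddCircle) ∉ F at hx
  have hcont := hf.continuousAt hx
  have h2 : ContinuousAt (fun z : ℝ => f (z : UnitAddCircle)) y :=
    ContinuousAt.comp (f := fun z : ℝ => (z : UnitAddCircle)) hcont
      (AddCircle.continuous_mk' 1).continuousAt
  have h3 := h2.eventually (lt_mem_nhds (half_lt_self (hpos y)))
  obtain ⟨r, hr, hball⟩ := Metric.eventually_nhds_iff.1 h3
  refine ⟨y, min r 1, f y / 2, by positivity, min_le_right _ _, half_pos (hpos _), ?_⟩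
  rintro z ⟨hz1, hz2⟩
  refine (hball ?_).le
  rw [Real.dist_eq, abs_of_nonneg (by linarith)]
  linarith [min_le_left r 1]

theorem isFlowRoof (hf : IsDriftRoof f fa J G σ g b F) {α c : ℝ} (hc : BadlyApproximable α c)
    (hpos : ∀ x, 0 < f x) {M : ℝ} (hM : ∀ x, f x ≤ M) :
    ∃ c₀ c₁, IsFlowRoof (α : UnitAddCircle) f M c₀ c₁ := by
  obtain ⟨y, h, e, h0, h1, he, harc⟩ := hf.exists_arc_lower_bound hpos
  have hc0 := hc.1
  obtain ⟨n₀, hn₀⟩ := exists_nat_ge (2 * (2 + 1 / c) / h)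
  rw [div_le_iff₀ h0] at hn₀
  have hn₀pos : (0 : ℝ) < n₀ := by
    by_contra hcon
    have : 0 < 2 * (2 + 1 / c) := by positivity
    nlinarith
  have hn₀' : 0 < n₀ := by exact_mod_cast hn₀pos
  have hblock : ∀ x : UnitAddCircle, e ≤ cocycle (α : UnitAddCircle) f n₀ x := by
    intro x
    obtain ⟨x, rfl⟩ := QuotientAddGroup.mk_surjective x
    obtain ⟨i, hi, k, hk⟩ := hc.exists_mem_Ico h0 h1 hn₀ x y
    rw [cocycle_natCast]
    refine le_trans ?_ (Finset.single_le_sum (f := fun i : ℕ =>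
      f ((x : UnitAddCircle) + (i : ℤ) • (α : UnitAddCircle)))
      (fun j _ => (hpos _).le) (Finset.mem_range.2 hi))
    have hk0 : ((k : ℝ) : UnitAddCircle) = 0 :=
      (AddCircle.coe_eq_zero_iff (1 : ℝ)).2 ⟨k, by simp⟩
    have e1 : ((x + i * α + k : ℝ) : UnitAddCircle) =
        (x : UnitAddCircle) + (i : ℤ) • (α : UnitAddCircle) := by
      rw [AddCircle.coe_add, AddCircle.coe_add, hk0, add_zero, ← AddCircle.coe_zsmul, zsmul_eq_mul,
        Int.cast_natCast]
    exact (harc _ hk).trans_eq (congrArg f e1)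
  have hmul : ∀ (k : ℕ) (x : UnitAddCircle), k * e ≤
      cocycle (α : UnitAddCircle) f ((k * n₀ : ℕ) : ℤ) x := by
    intro k
    induction k with
    | zero => intro x; simp [cocycle_zero]
    | succ k ih =>
      intro x
      have e1 : (((k + 1) * n₀ : ℕ) : ℤ) = ((k * n₀ : ℕ) : ℤ) + (n₀ : ℤ) := by push_cast; ring
      rw [e1, cocycle_add]
      push_cast
      have := ih x
      push_cast at this
      linarith [hblock (x + ((k : ℤ) * (n₀ : ℤ)) • (α : UnitAddCircle))]
  refine ⟨e / n₀, e, hpos, hf.measurable, hM, by positivity, fun n x => ?_⟩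
  have hle : cocycle (α : UnitAddCircle) f ((n / n₀ * n₀ : ℕ) : ℤ) x ≤
      cocycle (α : UnitAddCircle) f n x :=
    (strictMono_cocycle hpos x).monotone (by exact_mod_cast Nat.div_mul_le_self n n₀)
  have h3 := hmul (n / n₀) x
  have h4 : (n : ℝ) / n₀ ≤ (n / n₀ : ℕ) + 1 := by
    rw [div_le_iff₀ hn₀pos]
    have := (Nat.lt_div_mul_add (a := n) hn₀').le
    have h5 : (n : ℝ) ≤ ((n / n₀ : ℕ) : ℝ) * n₀ + n₀ := by exact_mod_cast this
    linarith
  have h6 : e / n₀ * n = e * (n / n₀) := by ring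
  rw [h6]
  nlinarith

end IsDriftRoof

/-! ### The cohomological equation -/

/-- `exp (2 π i y)`. -/
def expTwoPi (y : ℝ) : ℂ := Complex.exp (2 * Real.pi * Complex.I * y)

theorem expTwoPi_add (x y : ℝ) : expTwoPi (x + y) = expTwoPi x * expTwoPi y := by
  rw [expTwoPi, expTwoPi, expTwoPi, ← Complex.exp_add]
  push_cast; ring_nf

theorem expTwoPi_zero : expTwoPi 0 = 1 := by simp [expTwoPi]

theorem expTwoPi_eq (y : ℝ) : expTwoPi y = Complex.exp (Complex.I * (2 * Real.pi * y : ℝ)) := by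
  rw [expTwoPi]; push_cast; ring_nf

theorem norm_expTwoPi (y : ℝ) : ‖expTwoPi y‖ = 1 := by
  rw [expTwoPi_eq, mul_comm, Complex.norm_exp_ofReal_mul_I]

theorem expTwoPi_ne_zero (y : ℝ) : expTwoPi y ≠ 0 := Complex.exp_ne_zero _

theorem continuous_expTwoPi : Continuous expTwoPi := by unfold expTwoPi; fun_prop

theorem four_mul_abs_le_norm_expTwoPi_sub_one {y : ℝ} (hy : |y| ≤ 1 / 2) :
    4 * |y| ≤ ‖expTwoPi y - 1‖ := by
  rw [expTwoPi_eq, Complex.norm_exp_I_mul_ofReal_sub_one, Real.norm_eq_abs, abs_mul,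
    abs_of_pos (by norm_num : (0 : ℝ) < 2), show 2 * Real.pi * y / 2 = Real.pi * y by ring]
  have hpi := Real.pi_pos
  have key : ∀ z : ℝ, 0 ≤ z → z ≤ 1 / 2 → 2 * z ≤ Real.sin (Real.pi * z) := by
    intro z h0 h1
    have := Real.mul_le_sin (x := Real.pi * z) (by positivity) (by nlinarith)
    have e : 2 / Real.pi * (Real.pi * z) = 2 * z := by field_simp
    linarith
  have h2 : 2 * |y| ≤ |Real.sin (Real.pi * y)| := by
    rcases abs_cases y with ⟨h, h'⟩ | ⟨h, h'⟩
    · rw [h] at hy ⊢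
      exact (key y h' hy).trans (le_abs_self _)
    · rw [h] at hy ⊢
      have := key (-y) (by linarith) hy
      simp only [mul_neg, Real.sin_neg] at this
      rw [mul_neg]
      exact this.trans (neg_le_abs _)
  linarith

theorem exists_integral_norm_translate_sub_le {ψ : UnitAddCircle → ℂ} (hψ : Integrable ψ volume)
    {ε : ℝ} (hε : 0 < ε) : ∃ δ : ℝ, 0 < δ ∧ ∀ h : ℝ, 0 < h → h < δ →
      ∫ x : UnitAddCircle, ‖ψ (x + (h : UnitAddCircle)) - ψ x‖ ≤ ε := by
  obtain ⟨P, hP, hPi⟩ := hψ.exists_boundedContinuous_lintegral_sub_le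
    (ε := ENNReal.ofReal (ε / 4)) (by simpa using hε)
  have hPL : ∫ x : UnitAddCircle, ‖ψ x - P x‖ ≤ ε / 4 := by
    have e2 := integral_norm_eq_lintegral_enorm (hψ.sub hPi).aestronglyMeasurable
    simp only [Pi.sub_apply] at e2
    rw [e2]
    exact ENNReal.toReal_le_of_le_ofReal (by positivity) hP
  have hunif : UniformContinuous P := CompactSpace.uniformContinuous_of_continuous P.continuous
  obtain ⟨δ, hδ, hunif⟩ := Metric.uniformContinuous_iff.1 hunif (ε / 2) (by positivity)
  refine ⟨δ, hδ, fun h h0 hh => ?_⟩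
  have hmp : MeasurePreserving (fun x : UnitAddCircle => x + (h : UnitAddCircle)) volume volume :=
    measurePreserving_add_right _ _
  have hi1 : Integrable (fun x : UnitAddCircle => ‖ψ (x + h) - P (x + h)‖) volume :=
    (hmp.integrable_comp_of_integrable (hψ.sub hPi)).norm
  have hi2 : Integrable (fun x : UnitAddCircle => ‖ψ x - P x‖) volume := (hψ.sub hPi).norm
  have hi3 : Integrable (fun x : UnitAddCircle => ‖ψ (x + h) - ψ x‖) volume :=
    ((hmp.integrable_comp_of_integrable hψ).sub hψ).norm
  have hpt : ∀ x : UnitAddCircle, ‖ψ (x + h) - ψ x‖ ≤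
      ‖ψ (x + h) - P (x + h)‖ + ‖ψ x - P x‖ + ε / 2 := by
    intro x
    have h1 : ‖P (x + h) - P x‖ ≤ ε / 2 := by
      rw [← dist_eq_norm]
      refine (hunif ?_).le
      rw [dist_eq_norm, add_sub_cancel_left]
      calc ‖(h : UnitAddCircle)‖ ≤ |h| := by
            rw [UnitAddCircle.norm_eq]
            simpa using round_le h 0
        _ = h := abs_of_pos h0
        _ < δ := hh
    have e : ψ (x + h) - ψ x = (ψ (x + h) - P (x + h)) + (P (x + h) - P x) - (ψ x - P x) := by
      ring
    rw [e]
    have := norm_sub_le ((ψ (x + h) - P (x + h)) + (P (x + h) - P x)) (ψ x - P x)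
    have := norm_add_le (ψ (x + h) - P (x + h)) (P (x + h) - P x)
    linarith
  have hshift : ∫ x : UnitAddCircle, ‖ψ (x + h) - P (x + h)‖ = ∫ x : UnitAddCircle, ‖ψ x - P x‖ :=
    integral_add_right_eq_self (μ := (volume : Measure UnitAddCircle))
      (fun x => ‖ψ x - P x‖) (h : UnitAddCircle)
  have hi4 : Integrable (fun x : UnitAddCircle => ‖ψ (x + h) - P (x + h)‖ + ‖ψ x - P x‖) volume :=
    hi1.add hi2
  calc ∫ x : UnitAddCircle, ‖ψ (x + h) - ψ x‖
      ≤ ∫ x : UnitAddCircle, (‖ψ (x + h) - P (x + h)‖ + ‖ψ x - P x‖ + ε / 2) :=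
        integral_mono hi3 (hi4.add (integrable_const _)) hpt
    _ = (∫ x : UnitAddCircle, ‖ψ (x + h) - P (x + h)‖) + (∫ x : UnitAddCircle, ‖ψ x - P x‖) +
          ε / 2 := by
        rw [integral_add hi4 (integrable_const _), integral_add hi1 hi2,
          integral_const, UnitAddCircle.volume_real_univ, one_smul]
    _ ≤ ε := by rw [hshift]; linarith

theorem ergodic_rotation {α : ℝ} (hα : Irrational α) :
    Ergodic (fun x : UnitAddCircle => x + (α : UnitAddCircle)) volume :=
  AddCircle.ergodic_add_right.2 (addOrderOf_coe_eq_zero_of_irrational hα)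

theorem iterate_cohomological {a : UnitAddCircle} {f : UnitAddCircle → ℝ} {ψ : UnitAddCircle → ℂ}
    {r : ℝ} {x : UnitAddCircle}
    (h : ∀ n : ℕ, ψ (x + n • a + a) = expTwoPi (r * f (x + n • a)) * ψ (x + n • a)) (n : ℕ) :
    ψ (x + n • a) = expTwoPi (r * cocycle a f n x) * ψ x := by
  induction n with
  | zero =>
    have := cocycle_zero (a := a) (f := f) x
    simp only [Nat.cast_zero, this, mul_zero, expTwoPi_zero, one_mul, zero_smul, add_zero]
  | succ n ih =>
    have e1 : x + (n + 1) • a = x + n • a + a := by rw [succ_nsmul, add_assoc]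
    rw [e1, h n, ih, ← mul_assoc, ← expTwoPi_add, ← mul_add]
    congr 3
    push_cast
    rw [cocycle_succ, natCast_zsmul]
    ring

theorem ae_iterate_cohomological {a : UnitAddCircle} {f : UnitAddCircle → ℝ}
    {ψ : UnitAddCircle → ℂ} {r : ℝ}
    (hψ : ∀ᵐ x : UnitAddCircle, ψ (x + a) = expTwoPi (r * f x) * ψ x) :
    ∀ᵐ x : UnitAddCircle, ∀ n : ℕ, ψ (x + n • a) = expTwoPi (r * cocycle a f n x) * ψ x := by
  have h1 : ∀ᵐ x : UnitAddCircle, ∀ n : ℕ,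
      ψ (x + n • a + a) = expTwoPi (r * f (x + n • a)) * ψ (x + n • a) := by
    refine ae_all_iff.2 fun n => ?_
    generalize n • a = b
    have hmp : MeasurePreserving (fun x : UnitAddCircle => x + b) volume volume :=
      measurePreserving_add_right _ _
    have := hmp.quasiMeasurePreserving.ae hψ
    exact this
  filter_upwards [h1] with x hx n
  exact iterate_cohomological hx n

theorem mul_norm_expTwoPi_sub_one_le {z w : ℂ} (s t : ℝ) :
    ‖z‖ * ‖expTwoPi (t - s) - 1‖ ≤ ‖expTwoPi t * w - expTwoPi s * z‖ + ‖w - z‖ := by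
  have e : expTwoPi s * ((expTwoPi (t - s) - 1) * z) =
      (expTwoPi t * w - expTwoPi s * z) - expTwoPi t * (w - z) := by
    have : expTwoPi t = expTwoPi s * expTwoPi (t - s) := by rw [← expTwoPi_add]; congr 1; ring
    rw [this]; ring
  have h1 := norm_sub_le (expTwoPi t * w - expTwoPi s * z) (expTwoPi t * (w - z))
  rw [← e, norm_mul, norm_mul, norm_mul, norm_expTwoPi, norm_expTwoPi, one_mul, one_mul] at h1
  rwa [mul_comm]

theorem exists_mem_window_mul_le {d : ℕ → ℝ} (hd : ∀ n, 0 ≤ d n) {N W n₁ : ℕ} {B : ℝ}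
    (hsum : ∑ n ∈ Finset.range (N + 1), d n ≤ B) (hW : n₁ + W ≤ N) :
    ∃ n, n₁ ≤ n ∧ n ≤ n₁ + W ∧ d n * W ≤ B := by
  by_contra hcon
  push Not at hcon
  have h1 : ∑ n ∈ Finset.Icc n₁ (n₁ + W), d n ≤ ∑ n ∈ Finset.range (N + 1), d n := by
    refine Finset.sum_le_sum_of_subset_of_nonneg (fun n hn => ?_) fun n _ _ => hd n
    rw [Finset.mem_Icc] at hn
    rw [Finset.mem_range]; omega
  have hB : 0 ≤ B := (Finset.sum_nonneg fun n _ => hd n).trans hsum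
  rcases Nat.eq_zero_or_pos W with h0 | h0
  · have := hcon n₁ le_rfl (by omega)
    rw [h0] at this
    simp only [Nat.cast_zero, mul_zero] at this
    linarith
  have hW0 : (0 : ℝ) < W := by exact_mod_cast h0
  have h2 : ∑ _n ∈ Finset.Icc n₁ (n₁ + W), B / W ≤ ∑ n ∈ Finset.Icc n₁ (n₁ + W), d n := by
    refine Finset.sum_le_sum fun n hn => ?_
    rw [Finset.mem_Icc] at hn
    rw [div_le_iff₀ hW0]
    exact (hcon n hn.1 hn.2).le
  have h3 : B / W < d n₁ := by
    rw [div_lt_iff₀ hW0]; exact hcon n₁ le_rfl (by omega)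
  have h4 : ∑ _n ∈ Finset.Icc n₁ (n₁ + W), B / W < ∑ n ∈ Finset.Icc n₁ (n₁ + W), d n := by
    refine Finset.sum_lt_sum (fun n hn => ?_) ⟨n₁, by simp, h3⟩
    rw [Finset.mem_Icc] at hn
    rw [div_le_iff₀ hW0]
    exact (hcon n hn.1 hn.2).le
  rw [Finset.sum_const, Nat.card_Icc, nsmul_eq_mul] at h4
  have h5 : ((n₁ + W + 1 - n₁ : ℕ) : ℝ) = W + 1 := by
    rw [show n₁ + W + 1 - n₁ = W + 1 by omega]; push_cast; ring
  rw [h5] at h4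
  have h6 : (W + 1) * (B / W) = B + B / W := by field_simp
  have : 0 ≤ B / W := by positivity
  linarith

theorem exists_point_displacement_le {ψ : UnitAddCircle → ℂ} (hψ : Integrable ψ volume)
    {h : UnitAddCircle} {ω : ℝ} (hω : ∫ x : UnitAddCircle, ‖ψ (x + h) - ψ x‖ ≤ ω)
    (b : ℕ → UnitAddCircle) {N : ℕ} (hN : 1 ≤ N) {p : UnitAddCircle → Prop} (hp : ∀ᵐ x, p x) :
    ∃ x, p x ∧ ‖ψ (x + h) - ψ x‖ ≤ 3 * ω ∧
      ∑ n ∈ Finset.range (2 * N + 1), ‖ψ (x + b n + h) - ψ (x + b n)‖ ≤ 6 * N * ω := by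
  have hN1 : (1 : ℝ) ≤ N := by exact_mod_cast hN
  have hi0 : Integrable (fun x : UnitAddCircle => ‖ψ (x + h) - ψ x‖) volume :=
    ((hψ.comp_add_right h).sub hψ).norm
  have hi : ∀ n, Integrable (fun x : UnitAddCircle => ‖ψ (x + b n + h) - ψ (x + b n)‖) volume :=
    fun n => hi0.comp_add_right (b n)
  have hInt : ∀ n, ∫ x : UnitAddCircle, ‖ψ (x + b n + h) - ψ (x + b n)‖ ≤ ω := fun n =>
    (integral_add_right_eq_self (μ := (volume : Measure UnitAddCircle))
        (fun x => ‖ψ (x + h) - ψ x‖) (b n)).trans_le hω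
  have hω0 : 0 ≤ ω := (integral_nonneg fun x => norm_nonneg _).trans hω
  have hi1 : Integrable (fun x : UnitAddCircle => 2 * N * ‖ψ (x + h) - ψ x‖) volume :=
    hi0.const_mul _
  have hi2 : Integrable (fun x : UnitAddCircle =>
      ∑ n ∈ Finset.range (2 * N + 1), ‖ψ (x + b n + h) - ψ (x + b n)‖) volume :=
    integrable_finsetSum _ fun n _ => hi n
  have : IsProbabilityMeasure (volume : Measure UnitAddCircle) := ⟨UnitAddCircle.measure_univ⟩
  obtain ⟨x, hx, hxQ⟩ := exists_notMem_null_le_integral (hi1.add hi2) (ae_iff.1 hp)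
  rw [Set.mem_ofPred_eq, not_not] at hx
  have hQ : 2 * N * ‖ψ (x + h) - ψ x‖ +
      ∑ n ∈ Finset.range (2 * N + 1), ‖ψ (x + b n + h) - ψ (x + b n)‖ ≤ 6 * N * ω := by
    refine hxQ.trans ?_
    rw [integral_add' hi1 hi2, integral_const_mul, integral_finsetSum _ fun n _ => hi n]
    have e2 : ∑ n ∈ Finset.range (2 * N + 1),
        ∫ x : UnitAddCircle, ‖ψ (x + b n + h) - ψ (x + b n)‖ ≤ (2 * N + 1) * ω := by
      calc _ ≤ ∑ n ∈ Finset.range (2 * N + 1), ω := Finset.sum_le_sum fun n _ => hInt n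
        _ = _ := by rw [Finset.sum_const, Finset.card_range, nsmul_eq_mul]; push_cast; ring
    have e3 := mul_le_mul_of_nonneg_left hω (by positivity : (0 : ℝ) ≤ 2 * N)
    nlinarith
  have h0 : 0 ≤ ∑ n ∈ Finset.range (2 * N + 1), ‖ψ (x + b n + h) - ψ (x + b n)‖ :=
    Finset.sum_nonneg fun n _ => norm_nonneg _
  have h1 : 0 ≤ 2 * N * ‖ψ (x + h) - ψ x‖ := by positivity
  exact ⟨x, hx, by nlinarith, by linarith⟩

/-- The drift of a roof prevents nontrivial solutions of the cohomological equation. -/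
theorem IsDriftRoof.cohomological_eq_zero {f fa : UnitAddCircle → ℝ} {J G : ℝ → ℝ} {σ g b : ℝ}
    {F : Finset UnitAddCircle} (hf : IsDriftRoof f fa J G σ g b F) {α c : ℝ}
    (hirr : Irrational α) (hc : BadlyApproximable α c) {r : ℝ} (hr : r ≠ 0)
    {ψ : UnitAddCircle → ℂ} (hψm : AEStronglyMeasurable ψ volume)
    (hψ : ∀ᵐ x : UnitAddCircle, ψ (x + (α : UnitAddCircle)) = expTwoPi (r * f x) * ψ x) :
    ∀ᵐ x : UnitAddCircle, ψ x = 0 := by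
  have herg := ergodic_rotation hirr
  obtain ⟨ρ, hρ⟩ : ∃ ρ : ℝ, (fun x => ‖ψ x‖) =ᵐ[volume] Function.const _ ρ := by
    refine herg.ae_eq_const_of_ae_eq_comp_ae hψm.norm ?_
    filter_upwards [hψ] with x hx
    simp only [Function.comp_apply]
    rw [hx, norm_mul, norm_expTwoPi, one_mul]
  rcases eq_or_ne ρ 0 with h0 | hρ0
  · filter_upwards [hρ] with x hx
    rw [h0] at hx
    exact norm_eq_zero.1 hx
  exfalso
  have hρpos : 0 < ρ := by
    have hne : (ae (volume : Measure UnitAddCircle)).NeBot := by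
      rw [ae_neBot]
      intro h
      have := UnitAddCircle.measure_univ
      rw [h] at this; simp at this
    obtain ⟨x, hx⟩ := hρ.exists
    have h1 : ‖ψ x‖ = ρ := hx
    exact lt_of_le_of_ne (h1 ▸ norm_nonneg _) hρ0.symm
  have hψi : Integrable ψ (volume : Measure UnitAddCircle) := by
    refine Integrable.of_bound hψm ρ ?_
    filter_upwards [hρ] with x hx
    exact le_of_eq hx
  have hwin := hf.exists_windows hirr hc
  have hdrift : ∀ (n : ℕ) (x h : ℝ), drift α f n x h =
      cocycle (α : UnitAddCircle) f n ((x : UnitAddCircle) + h) - cocycle (α : UnitAddCircle) f n x :=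
    fun n x h => by rw [drift_eq_cocycle_sub, AddCircle.coe_add]
  clear herg hirr hc
  generalize (α : UnitAddCircle) = a at hψ hdrift
  have hgood := ae_iterate_cohomological hψ
  obtain ⟨A, hA, ℓ₀, hℓ₀, K₀, hwin⟩ := hwin
  have hr0 : 0 < |r| := abs_pos.2 hr
  set ℓ : ℝ := min ℓ₀ (1 / (3 * |r|)) with hℓ
  have hℓpos : 0 < ℓ := by positivity
  have hℓr : |r| * ℓ ≤ 1 / 3 := by
    have : ℓ ≤ 1 / (3 * |r|) := min_le_right _ _
    rw [le_div_iff₀ (by positivity)] at this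
    linarith
  obtain ⟨κ, hκ, δ₁, hδ₁, hwin⟩ := hwin ℓ hℓpos (min_le_left _ _) (ℓ / 6) (by positivity)
  set θ : ℝ := |r| * ℓ / 2 with hθ
  have hθ0 : 0 < θ := by positivity
  set ω : ℝ := ρ * θ / (3 + 6 / κ) with hω
  have hω0 : 0 < ω := by positivity
  obtain ⟨δ₂, hδ₂, htr⟩ := exists_integral_norm_translate_sub_le hψi hω0
  set h : ℝ := min (min δ₁ δ₂) A / 2 with hh
  have hmin : 0 < min (min δ₁ δ₂) A := by positivity
  have hh0 : 0 < h := by positivity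
  have hhδ₁ : h < δ₁ := (half_lt_self hmin).trans_le ((min_le_left _ _).trans (min_le_left _ _))
  have hhδ₂ : h < δ₂ := (half_lt_self hmin).trans_le ((min_le_left _ _).trans (min_le_right _ _))
  have hhA : h ≤ A := ((half_lt_self hmin).trans_le (min_le_right _ _)).le
  set N : ℕ := ⌈A / h⌉₊ with hN
  have hN1 : (1 : ℝ) ≤ N := by
    have h1 : 1 ≤ A / h := by rw [le_div_iff₀ hh0]; linarith
    exact h1.trans (Nat.le_ceil _)
  have hgood2 : ∀ᵐ x : UnitAddCircle, (∀ n : ℕ,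
      ψ (x + n • a) = expTwoPi (r * cocycle a f n x) * ψ x) ∧
      (∀ n : ℕ, ψ (x + h + n • a) = expTwoPi (r * cocycle a f n (x + h)) * ψ (x + h)) ∧
        ‖ψ x‖ = ρ := by
    have hmp : MeasurePreserving (fun x : UnitAddCircle => x + h) volume volume :=
      measurePreserving_add_right _ _
    have hgood' := hmp.quasiMeasurePreserving.ae hgood
    filter_upwards [hgood, hgood', hρ] with x h1 h2 h3
    exact ⟨h1, h2, h3⟩
  obtain ⟨x, ⟨hx1, hx2, hxρ⟩, hdx0, hdsum⟩ := exists_point_displacement_le hψi (htr h hh0 hhδ₂)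
    (fun n => n • a) (by exact_mod_cast hN1) hgood2
  obtain ⟨y, rfl⟩ := QuotientAddGroup.mk_surjective x
  obtain ⟨W, n₁, n₂, hW, -, hn₁, -, hn₂, u, v, -, -, huv, hu, hv⟩ := hwin h hh0 hhδ₁ y
  have hNpos : (0 : ℝ) < N := by linarith
  have hWpos : (0 : ℝ) < W := lt_of_lt_of_le (by positivity) hW
  set d : ℕ → ℝ := fun n => ‖ψ ((y : UnitAddCircle) + n • a + h) - ψ ((y : UnitAddCircle) + n • a)‖
    with hd
  have hd0 : ∀ n, 0 ≤ d n := fun n => norm_nonneg _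
  have hsmall : ∀ n : ℕ, d n * W ≤ 6 * N * ω → ‖expTwoPi (r * drift α f n y h) - 1‖ ≤ θ := by
    intro n hn
    have h1 : d n ≤ 6 / κ * ω := by
      have h2 : d n * (κ * N) ≤ 6 * N * ω :=
        (mul_le_mul_of_nonneg_left hW (hd0 n)).trans hn
      rw [div_mul_eq_mul_div, le_div_iff₀ hκ]
      nlinarith
    have h2 := mul_norm_expTwoPi_sub_one_le (z := ψ y) (w := ψ ((y : UnitAddCircle) + h))
      (r * cocycle a f n y) (r * cocycle a f n ((y : UnitAddCircle) + h))
    have e1 : expTwoPi (r * cocycle a f n ((y : UnitAddCircle) + h)) * ψ ((y : UnitAddCircle) + h) -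
        expTwoPi (r * cocycle a f n y) * ψ y =
        ψ ((y : UnitAddCircle) + n • a + h) - ψ ((y : UnitAddCircle) + n • a) := by
      rw [add_right_comm]
      exact congrArg₂ (· - ·) (hx2 n).symm (hx1 n).symm
    have h3 : ‖ψ (y : UnitAddCircle)‖ = ρ := hxρ
    rw [e1, h3, ← mul_sub, ← hdrift] at h2
    have h4 : ρ * ‖expTwoPi (r * drift α f n y h) - 1‖ ≤ ρ * θ := by
      have e3 : (3 + 6 / κ) * ω = ρ * θ := by rw [hω]; field_simp
      have h5 : ‖ψ ((y : UnitAddCircle) + n • a + h) - ψ ((y : UnitAddCircle) + n • a)‖ = d n := rfl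
      have h6 : ‖ψ ((y : UnitAddCircle) + h) - ψ y‖ ≤ 3 * ω := hdx0
      rw [h5] at h2
      nlinarith
    exact le_of_mul_le_mul_left h4 hρpos
  obtain ⟨n, hn1, hn2, hn3⟩ := exists_mem_window_mul_le hd0 hdsum hn₁
  obtain ⟨m, hm1, hm2, hm3⟩ := exists_mem_window_mul_le hd0 hdsum hn₂
  have hen := hsmall n hn3
  have hem := hsmall m hm3
  have hDn := abs_le.1 (hu n hn1 hn2)
  have hDm := abs_le.1 (hv m hm1 hm2)
  have huv' := abs_le.1 huv
  set D : ℝ := drift α f n y h - drift α f m y h with hD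
  have hDlow : ℓ / 2 ≤ |D| := by
    rcases abs_cases (u - v) with ⟨h1, h2⟩ | ⟨h1, h2⟩ <;> rcases abs_cases D with ⟨h3, h4⟩ | ⟨h3, h4⟩ <;>
      linarith
  have hDup : |D| ≤ 3 / 2 * ℓ := by
    rcases abs_cases (u - v) with ⟨h1, h2⟩ | ⟨h1, h2⟩ <;> rcases abs_cases D with ⟨h3, h4⟩ | ⟨h3, h4⟩ <;>
      linarith
  have h1 : |r * D| ≤ 1 / 2 := by rw [abs_mul]; nlinarith
  have h2 := four_mul_abs_le_norm_expTwoPi_sub_one h1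
  have h3 : ‖expTwoPi (r * D) - 1‖ ≤ θ + θ := by
    have e : expTwoPi (r * drift α f n y h) = expTwoPi (r * drift α f m y h) * expTwoPi (r * D) := by
      rw [← expTwoPi_add]; congr 1; rw [hD]; ring
    have e2 : expTwoPi (r * drift α f m y h) * (expTwoPi (r * D) - 1) =
        (expTwoPi (r * drift α f n y h) - 1) - (expTwoPi (r * drift α f m y h) - 1) := by
      rw [e]; ring
    have := norm_sub_le (expTwoPi (r * drift α f n y h) - 1) (expTwoPi (r * drift α f m y h) - 1)
    rw [← e2, norm_mul, norm_expTwoPi, one_mul] at this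
    linarith
  rw [abs_mul] at h2
  have h4 : |r| * (ℓ / 2) ≤ |r| * |D| := mul_le_mul_of_nonneg_left hDlow hr0.le
  linarith

end

noncomputable section

/-! ### Weak mixing -/

/-- The equation `ψ (x + a) = exp (2 π i r f(x)) ψ x` has no nonzero solution for `r ≠ 0`. -/
def HasTrivialEigenvalues (a : UnitAddCircle) (f : UnitAddCircle → ℝ) : Prop :=
  ∀ r : ℝ, r ≠ 0 → ∀ ψ : UnitAddCircle → ℂ, AEStronglyMeasurable ψ volume →
    (∀ᵐ x : UnitAddCircle, ψ (x + a) = expTwoPi (r * f x) * ψ x) → ∀ᵐ x : UnitAddCircle, ψ x = 0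

/-- A function on `X × ℝ` that is a.e. invariant under each translation of the second coordinate
depends on the first coordinate only. -/
theorem exists_ae_eq_of_translation_invariant {X : Type*} [MeasureSpace X]
    [SFinite (volume : Measure X)] {H : X × ℝ → ℂ} (hH : Measurable H)
    (hinv : ∀ t : ℝ, ∀ᵐ q : X × ℝ, H (q.1, q.2 + t) = H q) :
    ∃ ψ : X → ℂ, StronglyMeasurable ψ ∧ ∀ᵐ x : X, ∀ᵐ s : ℝ, H (x, s) = ψ x := by
  have hm : MeasurableSet {z : ℝ × (X × ℝ) | H (z.2.1, z.2.2 + z.1) = H z.2} :=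
    measurableSet_eq_fun (by fun_prop) (by fun_prop)
  have h1 : ∀ᵐ q : X × ℝ, ∀ᵐ t : ℝ, H (q.1, q.2 + t) = H q :=
    (Measure.ae_ae_comm (μ := (volume : Measure ℝ)) (p := fun t q => H (q.1, q.2 + t) = H q) hm).1
      (ae_of_all _ hinv)
  rw [Measure.volume_eq_prod] at h1
  have h2 := Measure.ae_ae_of_ae_prod h1
  refine ⟨fun x => ∫ s in Set.Icc (0 : ℝ) 1, H (x, s), hH.stronglyMeasurable.integral_prod_right', ?_⟩
  filter_upwards [h2] with x hx
  obtain ⟨s, hs⟩ := hx.exists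
  have hmp : MeasurePreserving (fun u : ℝ => u + -s) volume volume :=
    measurePreserving_add_right _ _
  have h3 := hmp.quasiMeasurePreserving.ae hs
  have h4 : ∀ᵐ u : ℝ, H (x, u) = H (x, s) := by
    filter_upwards [h3] with u hu
    rwa [add_neg_cancel_comm_assoc] at hu
  have h5 : ∫ s in Set.Icc (0 : ℝ) 1, H (x, s) = H (x, s) := by
    rw [integral_congr_ae (ae_restrict_of_ae h4), setIntegral_const]
    simp
  filter_upwards [h4] with u hu
  rw [hu, h5]

namespace IsFlowRoof

variable {a : UnitAddCircle} {f : UnitAddCircle → ℝ} {M c₀ c₁ : ℝ}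

theorem cocycle_one (x : UnitAddCircle) : cocycle a f 1 x = f x := by
  rw [← zero_add (1 : ℤ), cocycle_succ, cocycle_zero, zero_add, zero_smul, add_zero]

theorem proj_add_sub (hf : IsFlowRoof a f M c₀ c₁) (x : UnitAddCircle) (s : ℝ) :
    hf.proj (x + a, s - f x) = hf.proj (x, s) := by
  have := hf.proj_skew (x, s) 1
  rwa [cocycle_one, one_smul] at this

theorem ae_of_ae_proj (hf : IsFlowRoof a f M c₀ c₁) {p : SpecialSpace f → Prop}
    (h : ∀ᵐ q : UnitAddCircle × ℝ, p (hf.proj q)) : ∀ᵐ z ∂specialMeasure f, p z := by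
  rw [ae_iff, hf.specialMeasure_eq_zero_iff]
  refine measure_mono_null ?_ (ae_iff.1 h)
  rintro _ ⟨z, hz, rfl⟩
  simpa only [Set.mem_ofPred_eq, hf.proj_val] using hz

theorem isWeaklyMixingFlow (hf : IsFlowRoof a f M c₀ c₁) (htriv : HasTrivialEigenvalues a f)
    (herg : Ergodic (fun x : UnitAddCircle => x + a) volume) :
    IsWeaklyMixingFlow (specialMeasure f) (specialFlow a f) := by
  intro r F hF heig
  obtain ⟨F', hF'm, hFF'⟩ := hF.aestronglyMeasurable
  have hF'meas := hF'm.measurable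
  have heig' : ∀ t : ℝ, ∀ᵐ p ∂specialMeasure f,
      F' (specialFlow a f t p) = expTwoPi (r * t) * F' p := by
    intro t
    have h1 := (hf.measurePreserving_specialFlow t).quasiMeasurePreserving.ae hFF'
    filter_upwards [hFF', h1, heig t] with p h1 h2 h3
    rw [← h1, ← h2, h3, expTwoPi]
    push_cast
    ring_nf
  set H : UnitAddCircle × ℝ → ℂ := fun q => expTwoPi (-(r * q.2)) * F' (hf.proj q) with hH
  have hHm : Measurable H := by
    refine Measurable.mul ?_ (hF'meas.comp hf.measurable_proj)
    exact continuous_expTwoPi.measurable.comp (by fun_prop)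
  obtain ⟨ψ, hψm, hψ⟩ := exists_ae_eq_of_translation_invariant hHm fun t => by
    filter_upwards [hf.quasiMeasurePreserving_proj.ae (heig' t)] with q hq
    rw [hf.specialFlow_proj] at hq
    simp only [hH]
    rw [hq, ← mul_assoc, ← expTwoPi_add]
    congr 2
    ring
  have hcoh : ∀ᵐ x : UnitAddCircle, ψ (x + a) = expTwoPi (r * f x) * ψ x := by
    have hmp : MeasurePreserving (fun x : UnitAddCircle => x + a) volume volume :=
      measurePreserving_add_right _ _
    have hψ' := hmp.quasiMeasurePreserving.ae hψ
    filter_upwards [hψ, hψ'] with x h1 h2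
    have hmp2 : MeasurePreserving (fun s : ℝ => s - f x) volume volume := by
      simpa only [sub_eq_add_neg] using measurePreserving_add_right volume (-f x)
    have h3 := hmp2.quasiMeasurePreserving.ae h2
    obtain ⟨s, hs1, hs2⟩ := (h1.and h3).exists
    rw [← hs2, ← hs1]
    simp only [hH]
    rw [hf.proj_add_sub, ← mul_assoc, ← expTwoPi_add]
    congr 2
    ring
  have hprod : ∀ᵐ q : UnitAddCircle × ℝ, H q = ψ q.1 := by
    rw [Measure.volume_eq_prod]
    exact (Measure.ae_prod_iff_ae_ae (measurableSet_eq_fun hHm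
      (hψm.measurable.comp measurable_fst))).2 hψ
  have hconst : ∃ c : ℂ, ∀ᵐ q : UnitAddCircle × ℝ, F' (hf.proj q) = c := by
    rcases eq_or_ne r 0 with hr | hr
    · obtain ⟨c, hc⟩ := herg.ae_eq_const_of_ae_eq_comp_ae hψm.aestronglyMeasurable (by
        filter_upwards [hcoh] with x hx
        rw [hr, zero_mul, expTwoPi_zero, one_mul] at hx
        exact hx)
      refine ⟨c, ?_⟩
      have hc' : ∀ᵐ q : UnitAddCircle × ℝ, ψ q.1 = c :=
        Measure.quasiMeasurePreserving_fst.ae hc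
      filter_upwards [hprod, hc'] with q h1 h2
      simp only [hH, hr, zero_mul, neg_zero, expTwoPi_zero, one_mul] at h1
      rw [h1, h2]
    · refine ⟨0, ?_⟩
      have hc := htriv r hr ψ hψm.aestronglyMeasurable hcoh
      have hc' : ∀ᵐ q : UnitAddCircle × ℝ, ψ q.1 = 0 :=
        Measure.quasiMeasurePreserving_fst.ae hc
      filter_upwards [hprod, hc'] with q h1 h2
      rw [h2] at h1
      exact (mul_eq_zero.1 h1).resolve_left (expTwoPi_ne_zero _)
  obtain ⟨c, hc⟩ := hconst
  refine ⟨c, ?_⟩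
  filter_upwards [hFF', hf.ae_of_ae_proj (p := fun z => F' z = c) hc] with z h1 h2
  rw [h1, h2]

end IsFlowRoof

/-! ### Ergodicity of the time maps -/

theorem volume_inter_Ioc_eq_zero_or_eq {A : Set ℝ} (hA : MeasurableSet A) {T : ℝ} (hT : 0 < T)
    (h : ∀ k : ℤ, k ≠ 0 →
      ∫ u in (0 : ℝ)..T, expTwoPi (-(k / T * u)) * A.indicator (fun _ => (1 : ℂ)) u = 0) :
    ∫ u in (0 : ℝ)..T, A.indicator (fun _ => (1 : ℝ)) u = 0 ∨
      ∫ u in (0 : ℝ)..T, A.indicator (fun _ => (1 : ℝ)) u = T := by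
  set χ : ℝ → ℂ := A.indicator fun _ => (1 : ℂ) with hχ
  set m : ℝ := ∫ u in (0 : ℝ)..T, A.indicator (fun _ => (1 : ℝ)) u with hm
  have hmem : MemLp χ 2 (volume.restrict (Set.Ioc 0 T)) :=
    (memLp_const (1 : ℂ)).indicator hA
  have hsum := hasSum_sq_fourierCoeffOn hT hmem
  have hcoef : ∀ k : ℤ, fourierCoeffOn hT χ k =
      (1 / T) • ∫ u in (0 : ℝ)..T, expTwoPi (-(k / T * u)) * χ u := by
    intro k
    rw [fourierCoeffOn_eq_integral, sub_zero]
    congr 1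
    refine intervalIntegral.integral_congr fun u _ => ?_
    simp only [fourier_coe_apply, smul_eq_mul, expTwoPi]
    congr 2
    push_cast
    ring
  have hχm : ∀ u, χ u = ((A.indicator (fun _ => (1 : ℝ)) u : ℝ) : ℂ) := by
    intro u
    by_cases hu : u ∈ A <;> simp [hχ, hu]
  have h0 : fourierCoeffOn hT χ 0 = ((m / T : ℝ) : ℂ) := by
    rw [hcoef]
    have : ∫ u in (0 : ℝ)..T, expTwoPi (-(((0 : ℤ) : ℝ) / T * u)) * χ u = ((m : ℝ) : ℂ) := by
      rw [hm, ← intervalIntegral.integral_ofReal]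
      refine intervalIntegral.integral_congr fun u _ => ?_
      simp only [Int.cast_zero, zero_div, zero_mul, neg_zero, expTwoPi_zero, one_mul, hχm]
    rw [this, Complex.real_smul]
    push_cast
    ring
  have hsum0 : HasSum (fun i => ‖fourierCoeffOn hT χ i‖ ^ 2) (‖fourierCoeffOn hT χ 0‖ ^ 2) := by
    refine hasSum_single 0 fun k hk => ?_
    rw [hcoef, h k hk, smul_zero, norm_zero, zero_pow two_ne_zero]
  have heq := hsum.unique hsum0
  have hsq : ∫ u in (0 : ℝ)..T, ‖χ u‖ ^ 2 = m := by
    refine intervalIntegral.integral_congr fun u _ => ?_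
    by_cases hu : u ∈ A <;> simp [hχ, hu]
  rw [hsq, h0, sub_zero, smul_eq_mul, Complex.norm_real, Real.norm_eq_abs, sq_abs] at heq
  have h1 : m * (m - T) = 0 := by
    field_simp at heq
    nlinarith
  rcases mul_eq_zero.1 h1 with h | h
  · exact Or.inl h
  · exact Or.inr (by linarith)

theorem volume_eq_zero_of_periodic {A : Set ℝ} {T : ℝ} (hT : 0 < T)
    (hper : ∀ (n : ℤ) (u : ℝ), u + n * T ∈ A ↔ u ∈ A) (h0 : volume (A ∩ Set.Ioc 0 T) = 0) :
    volume A = 0 := by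
  have hsub : A ⊆ ⋃ n : ℤ, (fun u : ℝ => u + n * T) ⁻¹' (A ∩ Set.Ioc 0 T) := by
    intro u hu
    obtain ⟨n, hn, -⟩ := existsUnique_add_zsmul_mem_Ioc hT u 0
    rw [zero_add, zsmul_eq_mul] at hn
    exact Set.mem_iUnion.2 ⟨n, (hper n u).2 hu, hn⟩
  refine measure_mono_null hsub (measure_iUnion_null fun n => ?_)
  rw [measure_preimage_add_right, h0]

namespace IsFlowRoof

variable {a : UnitAddCircle} {f : UnitAddCircle → ℝ} {M c₀ c₁ : ℝ}

/-- The fibre `{u : T_u (x, 0) ∈ s}`. -/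
def fibre (hf : IsFlowRoof a f M c₀ c₁) (s : Set (SpecialSpace f)) (x : UnitAddCircle) : Set ℝ :=
  {u | hf.proj (x, u) ∈ s}

theorem measurableSet_fibre (hf : IsFlowRoof a f M c₀ c₁) {s : Set (SpecialSpace f)}
    (hs : MeasurableSet s) (x : UnitAddCircle) : MeasurableSet (hf.fibre s x) :=
  (hf.measurable_proj.comp measurable_prodMk_left) hs

theorem add_zsmul_mem_fibre (hf : IsFlowRoof a f M c₀ c₁) {s : Set (SpecialSpace f)} {T : ℝ}
    (hinv : specialFlow a f T ⁻¹' s = s) (x : UnitAddCircle) (n : ℤ) (u : ℝ) :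
    u + n * T ∈ hf.fibre s x ↔ u ∈ hf.fibre s x := by
  have h1 : ∀ u, u + T ∈ hf.fibre s x ↔ u ∈ hf.fibre s x := by
    intro u
    change hf.proj (x, u + T) ∈ s ↔ hf.proj (x, u) ∈ s
    rw [← hf.specialFlow_proj T (x, u)]
    exact Set.ext_iff.1 hinv _
  induction n using Int.induction_on generalizing u with
  | zero => simp
  | succ n ih =>
    refine Iff.trans ?_ (ih u)
    rw [show u + ((n + 1 : ℤ) : ℝ) * T = u + ((n : ℤ) : ℝ) * T + T by push_cast; ring]
    exact h1 _
  | pred n ih =>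
    refine Iff.trans ?_ (ih u)
    rw [show u + ((-n : ℤ) : ℝ) * T = u + ((-n - 1 : ℤ) : ℝ) * T + T by push_cast; ring]
    exact (h1 _).symm

theorem specialMeasure_eq_zero_of_fibre (hf : IsFlowRoof a f M c₀ c₁) {s : Set (SpecialSpace f)}
    (hs : MeasurableSet s) {T : ℝ} (hT : 0 < T) (hinv : specialFlow a f T ⁻¹' s = s)
    (h : ∀ᵐ x : UnitAddCircle,
      ∫ u in (0 : ℝ)..T, (hf.fibre s x).indicator (fun _ => (1 : ℝ)) u = 0) :
    specialMeasure f s = 0 := by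
  have h1 : ∀ᵐ q : UnitAddCircle × ℝ, hf.proj q ∉ s := by
    rw [Measure.volume_eq_prod]
    refine (Measure.ae_prod_iff_ae_ae (hf.measurable_proj hs).compl).2 ?_
    filter_upwards [h] with x hx
    have h2 : volume (hf.fibre s x) = 0 := by
      refine volume_eq_zero_of_periodic hT (hf.add_zsmul_mem_fibre hinv x) ?_
      have hA := hf.measurableSet_fibre hs x
      rw [intervalIntegral.integral_of_le hT.le, integral_indicator hA, setIntegral_const,
        smul_eq_mul, mul_one, measureReal_def, Measure.restrict_apply hA] at hx
      rw [ENNReal.toReal_eq_zero_iff] at hx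
      exact hx.resolve_right (measure_inter_lt_top_of_right_ne_top measure_Ioc_lt_top.ne).ne
    rw [ae_iff]
    refine measure_mono_null (fun u hu => ?_) h2
    exact not_not.1 hu
  have h2 := hf.ae_of_ae_proj (p := fun z => z ∉ s) h1
  rw [ae_iff] at h2
  simpa using h2

theorem ergodic_specialFlow (hf : IsFlowRoof a f M c₀ c₁) (htriv : HasTrivialEigenvalues a f)
    (herg : Ergodic (fun x : UnitAddCircle => x + a) volume) {T : ℝ} (hT : 0 < T) :
    Ergodic (specialFlow a f T) (specialMeasure f) := by
  refine ⟨hf.measurePreserving_specialFlow T, ⟨fun s hs hinv => ?_⟩⟩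
  set ψ : ℤ → UnitAddCircle → ℂ := fun k x =>
    ∫ u in (0 : ℝ)..T, expTwoPi (-(k / T * u)) * (hf.fibre s x).indicator (fun _ => (1 : ℂ)) u
    with hψ
  have hψm : ∀ k, AEStronglyMeasurable (ψ k) volume := by
    intro k
    refine StronglyMeasurable.aestronglyMeasurable ?_
    simp only [hψ, intervalIntegral.integral_of_le hT.le]
    refine StronglyMeasurable.integral_prod_right'
      (f := fun q : UnitAddCircle × ℝ => expTwoPi (-(k / T * q.2)) *
        (hf.proj ⁻¹' s).indicator (fun _ => (1 : ℂ)) q) (Measurable.stronglyMeasurable ?_)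
    refine Measurable.mul ?_ (measurable_const.indicator (hf.measurable_proj hs))
    exact continuous_expTwoPi.measurable.comp (by fun_prop)
  have hcoh : ∀ (k : ℤ) (x : UnitAddCircle), ψ k (x + a) = expTwoPi (k / T * f x) * ψ k x := by
    intro k x
    set w : ℝ → ℂ := fun u => expTwoPi (-(k / T * u)) *
      (hf.fibre s (x + a)).indicator (fun _ => (1 : ℂ)) u with hw
    have hper : Function.Periodic w T := by
      intro u
      simp only [hw]
      congr 1
      · have e : -((k : ℝ) / T * (u + T)) = -(k / T * u) + (-k : ℤ) := by
          field_simp; push_cast; ring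
        rw [e, expTwoPi_add]
        have : expTwoPi ((-k : ℤ) : ℝ) = 1 := by
          rw [expTwoPi, Complex.exp_eq_one_iff]
          exact ⟨-k, by push_cast; ring⟩
        rw [this, mul_one]
      · have := hf.add_zsmul_mem_fibre hinv (x + a) 1 u
        rw [Int.cast_one, one_mul] at this
        by_cases hu : u ∈ hf.fibre s (x + a)
        · rw [Set.indicator_of_mem hu, Set.indicator_of_mem (this.2 hu)]
        · rw [Set.indicator_of_notMem hu, Set.indicator_of_notMem (mt this.1 hu)]
    have h1 : ψ k (x + a) = ∫ u in (0 : ℝ)..T, w (u - f x) := by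
      rw [intervalIntegral.integral_comp_sub_right]
      have := hper.intervalIntegral_add_eq 0 (0 - f x)
      rw [zero_add] at this
      rw [show T - f x = 0 - f x + T by ring, ← this]
    rw [h1, hψ]
    simp only
    rw [← intervalIntegral.integral_const_mul]
    refine intervalIntegral.integral_congr fun u _ => ?_
    have h2 : u - f x ∈ hf.fibre s (x + a) ↔ u ∈ hf.fibre s x := by
      change hf.proj (x + a, u - f x) ∈ s ↔ hf.proj (x, u) ∈ s
      rw [hf.proj_add_sub]
    simp only [hw]
    rw [← mul_assoc, ← expTwoPi_add]
    congr 1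
    · congr 1; ring
    · by_cases hu : u ∈ hf.fibre s x
      · rw [Set.indicator_of_mem hu, Set.indicator_of_mem (h2.2 hu)]
      · rw [Set.indicator_of_notMem hu, Set.indicator_of_notMem (mt h2.1 hu)]
  have hzero : ∀ᵐ x : UnitAddCircle, ∀ k : ℤ, k ≠ 0 → ψ k x = 0 := by
    rw [ae_all_iff]
    intro k
    by_cases hk : k = 0
    · exact ae_of_all _ fun x h => absurd hk h
    · filter_upwards [htriv (k / T) (by
        have : (k : ℝ) ≠ 0 := by exact_mod_cast hk
        positivity) (ψ k) (hψm k) (ae_of_all _ (hcoh k))] with x hx _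
      exact hx
  obtain ⟨c, hc⟩ := herg.ae_eq_const_of_ae_eq_comp_ae (hψm 0) (ae_of_all _ fun x => by
    simp only [Function.comp_apply]
    rw [hcoh, Int.cast_zero, zero_div, zero_mul, expTwoPi_zero, one_mul])
  have hψ0 : ∀ x, ψ 0 x =
      ((∫ u in (0 : ℝ)..T, (hf.fibre s x).indicator (fun _ => (1 : ℝ)) u : ℝ) : ℂ) := by
    intro x
    rw [← intervalIntegral.integral_ofReal]
    refine intervalIntegral.integral_congr fun u _ => ?_
    simp only [Int.cast_zero, zero_div, zero_mul, neg_zero, expTwoPi_zero, one_mul]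
    by_cases hu : u ∈ hf.fibre s x <;> simp [hu]
  have hdich : ∀ᵐ x : UnitAddCircle, ψ 0 x = c ∧ (ψ 0 x = 0 ∨ ψ 0 x = T) := by
    filter_upwards [hzero, hc] with x hx hxc
    refine ⟨hxc, ?_⟩
    rw [hψ0]
    rcases volume_inter_Ioc_eq_zero_or_eq (hf.measurableSet_fibre hs x) hT hx with h | h
    · left; rw [h, Complex.ofReal_zero]
    · right; rw [h]
  have hT0 : (T : ℂ) ≠ 0 := by exact_mod_cast hT.ne'
  rw [eventuallyConst_set']
  by_cases hc0 : c = 0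
  · left
    rw [ae_eq_empty]
    refine hf.specialMeasure_eq_zero_of_fibre hs hT hinv ?_
    filter_upwards [hc] with x hx
    have : ψ 0 x = 0 := by rw [hx, hc0]; rfl
    rw [hψ0] at this
    exact_mod_cast this
  · right
    rw [ae_eq_univ]
    refine hf.specialMeasure_eq_zero_of_fibre hs.compl hT (by rw [Set.preimage_compl, hinv]) ?_
    filter_upwards [hdich] with x hx
    have h1 : ψ 0 x = T := hx.2.resolve_left (by rw [hx.1]; exact hc0)
    rw [hψ0] at h1
    have h2 : ∫ u in (0 : ℝ)..T, (hf.fibre s x).indicator (fun _ => (1 : ℝ)) u = T := by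
      exact_mod_cast h1
    have hA := hf.measurableSet_fibre hs x
    have hInt : IntervalIntegrable ((hf.fibre s x).indicator fun _ => (1 : ℝ)) volume 0 T := by
      rw [intervalIntegrable_iff_integrableOn_Ioc_of_le hT.le]
      exact (integrableOn_const measure_Ioc_lt_top.ne).indicator hA
    have e : ∀ u, (hf.fibre sᶜ x).indicator (fun _ => (1 : ℝ)) u =
        1 - (hf.fibre s x).indicator (fun _ => (1 : ℝ)) u := by
      intro u
      have h3 : u ∈ hf.fibre sᶜ x ↔ u ∉ hf.fibre s x := Iff.rfl
      by_cases hu : u ∈ hf.fibre s x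
      · rw [Set.indicator_of_mem hu, Set.indicator_of_notMem (by rw [h3]; simpa using hu), sub_self]
      · rw [Set.indicator_of_notMem hu, Set.indicator_of_mem (h3.2 hu), sub_zero]
    simp only [e]
    rw [intervalIntegral.integral_sub (by simp) hInt, h2]
    simp

end IsFlowRoof

end

noncomputable section

/-! ### The weak Ratner property -/

/-- Every two nearby points of the circle have long time windows on which the cocycles differ by an
almost constant amount of size between `ℓ / 3` and `K`. -/
def HasDriftWindows (a : UnitAddCircle) (f : UnitAddCircle → ℝ) (ℓ K : ℝ) : Prop :=
  ∀ ε : ℝ, 0 < ε → ∃ κ : ℝ, 0 < κ ∧ ∀ R : ℕ, ∃ δ : ℝ, 0 < δ ∧ ∀ x x' : UnitAddCircle, x ≠ x' →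
    dist x x' < δ → ∃ (N W n₁ : ℕ) (w : ℝ), R ≤ N ∧ κ * N ≤ W ∧ N ≤ n₁ ∧ n₁ + W ≤ 2 * N ∧
      ℓ / 3 ≤ |w| ∧ |w| ≤ K ∧ ∀ n : ℕ, n₁ ≤ n → n ≤ n₁ + W →
        |cocycle a f n x' - cocycle a f n x - w| ≤ ε

theorem UnitAddCircle.exists_real_sub_eq (x x' : UnitAddCircle) :
    ∃ h : ℝ, x' = x + (h : UnitAddCircle) ∧ |h| = dist x x' := by
  obtain ⟨y, hy⟩ := QuotientAddGroup.mk_surjective (x' - x)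
  refine ⟨y - round y, ?_, ?_⟩
  · have h0 : ((round y : ℝ) : UnitAddCircle) = 0 :=
      (AddCircle.coe_eq_zero_iff (1 : ℝ)).2 ⟨round y, by simp⟩
    have h1 : ((y : ℝ) : UnitAddCircle) = x' - x := hy
    rw [AddCircle.coe_sub, h0, sub_zero, h1]
    abel
  · have h1 : ((y : ℝ) : UnitAddCircle) = x' - x := hy
    rw [dist_comm, dist_eq_norm, ← h1, UnitAddCircle.norm_eq]

theorem IsDriftRoof.exists_hasDriftWindows {f fa : UnitAddCircle → ℝ} {J G : ℝ → ℝ} {σ g b : ℝ}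
    {F : Finset UnitAddCircle} (hf : IsDriftRoof f fa J G σ g b F) {α c : ℝ}
    (hirr : Irrational α) (hc : BadlyApproximable α c) :
    ∃ ℓ K : ℝ, 0 < ℓ ∧ HasDriftWindows (α : UnitAddCircle) f ℓ K := by
  obtain ⟨A, hA, ℓ, hℓ, K, hwin⟩ := hf.exists_windows hirr hc
  refine ⟨ℓ, K, hℓ, fun ε hε => ?_⟩
  obtain ⟨κ, hκ, δ₀, hδ₀, hwin⟩ := hwin ℓ hℓ le_rfl (min ε (ℓ / 3)) (by positivity)
  refine ⟨κ, hκ, fun R => ⟨min δ₀ (A / (R + 1)), by positivity, ?_⟩⟩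
  have hreal : ∀ y h : ℝ, 0 < h → h < min δ₀ (A / (R + 1)) →
      ∃ (N W n₁ : ℕ) (w : ℝ), R ≤ N ∧ κ * N ≤ W ∧ N ≤ n₁ ∧ n₁ + W ≤ 2 * N ∧
      ℓ / 3 ≤ |w| ∧ |w| ≤ K ∧ ∀ n : ℕ, n₁ ≤ n → n ≤ n₁ + W → |drift α f n y h - w| ≤ ε := by
    intro y h h0 hh
    obtain ⟨W, n₁, n₂, hW, hn₁, hn₁', hn₂, hn₂', u, v, huK, hvK, huv, hu, hv⟩ :=
      hwin h h0 (hh.trans_le (min_le_left _ _)) y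
    have hR : R ≤ ⌈A / h⌉₊ := by
      have h1 : h * (R + 1) < A := by
        have := hh.trans_le (min_le_right _ _)
        rwa [lt_div_iff₀ (by positivity)] at this
      have h2 : (R : ℝ) ≤ A / h := by
        rw [le_div_iff₀ h0]; linarith
      exact_mod_cast h2.trans (Nat.le_ceil _)
    have hε1 : min ε (ℓ / 3) ≤ ε := min_le_left _ _
    have huv' : 2 / 3 * ℓ ≤ |u - v| := by
      have := (abs_le.1 huv).1
      linarith [min_le_right ε (ℓ / 3)]
    have h1 : |u - v| ≤ |u| + |v| := abs_sub _ _
    rcases le_or_gt (ℓ / 3) |u| with h2 | h2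
    · exact ⟨_, W, n₁, u, hR, hW, hn₁, hn₁', h2, huK, fun n h3 h4 => (hu n h3 h4).trans hε1⟩
    · exact ⟨_, W, n₂, v, hR, hW, hn₂, hn₂', by linarith, hvK,
        fun n h3 h4 => (hv n h3 h4).trans hε1⟩
  intro x x' hne hdist
  obtain ⟨h, hx', hh⟩ := UnitAddCircle.exists_real_sub_eq x x'
  rw [← hh] at hdist
  rcases lt_trichotomy h 0 with h0 | h0 | h0
  · obtain ⟨y, rfl⟩ := QuotientAddGroup.mk_surjective x'
    rw [abs_of_neg h0] at hdist
    obtain ⟨N, W, n₁, w, h1, h2, h3, h4, h5, h6, h7⟩ := hreal y (-h) (by linarith) hdist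
    refine ⟨N, W, n₁, -w, h1, h2, h3, h4, by rwa [abs_neg], by rwa [abs_neg], fun n h8 h9 => ?_⟩
    have h10 := h7 n h8 h9
    have hx : x = ((y + -h : ℝ) : UnitAddCircle) := by
      have : (y : UnitAddCircle) = x + (h : UnitAddCircle) := hx'
      rw [AddCircle.coe_add, AddCircle.coe_neg, this, add_neg_cancel_right]
    rw [drift_eq_cocycle_sub, ← hx] at h10
    rw [← abs_neg]
    refine le_trans (le_of_eq ?_) h10
    congr 1
    change -(cocycle _ f n (y : UnitAddCircle) - _ - _) = _
    ring
  · exact absurd (by rw [hx', h0, AddCircle.coe_zero, add_zero]) hne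
  · obtain ⟨y, rfl⟩ := QuotientAddGroup.mk_surjective x
    rw [abs_of_pos h0] at hdist
    obtain ⟨N, W, n₁, w, h1, h2, h3, h4, h5, h6, h7⟩ := hreal y h h0 hdist
    refine ⟨N, W, n₁, w, h1, h2, h3, h4, h5, h6, fun n h8 h9 => ?_⟩
    have h10 := h7 n h8 h9
    have hx : x' = ((y + h : ℝ) : UnitAddCircle) := by
      rw [hx', AddCircle.coe_add]
    rw [drift_eq_cocycle_sub, ← hx] at h10
    exact h10

/-- Points of the special space near the floor or near the roof. -/
def SpecialSpace.boundaryLayer (f : UnitAddCircle → ℝ) (η : ℝ) : Set (SpecialSpace f) :=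
  {p | p.1.2 < η ∨ f p.1.1 - η ≤ p.1.2}

namespace IsFlowRoof

variable {a : UnitAddCircle} {f : UnitAddCircle → ℝ} {M c₀ c₁ : ℝ}

theorem measurableSet_boundaryLayer (hf : IsFlowRoof a f M c₀ c₁) (η : ℝ) :
    MeasurableSet (SpecialSpace.boundaryLayer f η) := by
  have h1 : Measurable fun p : SpecialSpace f => p.1.2 := measurable_snd.comp measurable_subtype_coe
  have h2 : Measurable fun p : SpecialSpace f => f p.1.1 :=
    hf.meas.comp (measurable_fst.comp measurable_subtype_coe)
  exact (measurableSet_lt h1 measurable_const).union (measurableSet_le (h2.sub measurable_const) h1)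

theorem exists_boundaryLayer_measure_le (hf : IsFlowRoof a f M c₀ c₁) {ε : ℝ} (hε : 0 < ε) :
    ∃ η₀ : ℝ, 0 < η₀ ∧ ∀ η, 0 < η → η ≤ η₀ →
      (specialMeasure f).real (SpecialSpace.boundaryLayer f η) ≤ ε := by
  set V := volume (Subtype.val '' (Set.univ : Set (SpecialSpace f))) with hV
  have hV0 : 0 < V.toReal := ENNReal.toReal_pos hf.volume_univ_ne_zero hf.volume_univ_ne_top
  refine ⟨V.toReal * ε / 2, by positivity, fun η h0 hη => ?_⟩
  have h1 : volume (Subtype.val '' SpecialSpace.boundaryLayer f η) ≤ ENNReal.ofReal (2 * η) := by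
    rw [hf.volume_image_eq_lintegral (hf.measurableSet_boundaryLayer η)]
    calc _ ≤ ∫⁻ _ : UnitAddCircle, ENNReal.ofReal (2 * η) := by
          refine lintegral_mono fun x => ?_
          have hsub : {s : ℝ | (x, s) ∈ Subtype.val '' SpecialSpace.boundaryLayer f η} ⊆
              Set.Ico 0 η ∪ Set.Ico (f x - η) (f x) := by
            rintro s ⟨⟨q, hp⟩, hb, hq⟩
            obtain rfl : q = (x, s) := hq
            rcases hb with h | h
            · exact Or.inl ⟨hp.1, h⟩
            · exact Or.inr ⟨h, hp.2⟩
          refine (measure_mono hsub).trans ((measure_union_le _ _).trans ?_)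
          rw [Real.volume_Ico, Real.volume_Ico, ← ENNReal.ofReal_add (by linarith) (by linarith)]
          exact ENNReal.ofReal_le_ofReal (by linarith)
      _ = _ := by rw [lintegral_const, UnitAddCircle.measure_univ, mul_one]
  rw [measureReal_def, hf.specialMeasure_apply, ENNReal.toReal_mul, ENNReal.toReal_inv]
  have h2 : (volume (Subtype.val '' SpecialSpace.boundaryLayer f η)).toReal ≤ 2 * η :=
    ENNReal.toReal_le_of_le_ofReal (by linarith) h1
  rw [inv_mul_le_iff₀ hV0]
  linarith

theorem cocycle_le (hf : IsFlowRoof a f M c₀ c₁) (n : ℕ) (x : UnitAddCircle) :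
    cocycle a f n x ≤ n * M := by
  rw [cocycle_natCast]
  refine (Finset.sum_le_sum fun i _ => hf.le _).trans_eq ?_
  rw [Finset.sum_const, Finset.card_range, nsmul_eq_mul]

theorem bound_pos (hf : IsFlowRoof a f M c₀ c₁) : 0 < M := (hf.pos 0).trans_le (hf.le 0)

/-- A long window of indices contains all the passages during a long window of times. -/
theorem exists_time_window (hf : IsFlowRoof a f M c₀ c₁) {T : ℝ} (hT : 0 < T) {κ : ℝ} (hκ : 0 < κ)
    (N₀ : ℕ) : ∃ R : ℕ, ∀ (N W n₁ : ℕ) (x : UnitAddCircle), R ≤ N → κ * N ≤ W → N ≤ n₁ →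
      n₁ + W ≤ 2 * N → ∃ m L : ℕ, N₀ ≤ m ∧ N₀ ≤ L ∧ c₀ * κ / (6 * M) * m ≤ L ∧
        ∀ (s : ℝ) (j : ℕ), 0 ≤ s → s < M → m ≤ j → j ≤ m + L →
          cocycle a f n₁ x ≤ s + j * T ∧ s + j * T < cocycle a f ((n₁ + W : ℕ) : ℤ) x := by
  have hc0 := hf.growth_pos
  have hM := hf.bound_pos
  obtain ⟨R, hR⟩ := exists_nat_ge (max (max ((N₀ * T + c₁) / c₀) (T / M))
    (max ((2 * (c₁ + M + 2 * T)) / (c₀ * κ)) ((2 * T * N₀) / (c₀ * κ))))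
  refine ⟨R, fun N W n₁ x hN hW hn₁ hn₂ => ?_⟩
  have hRN : (R : ℝ) ≤ N := by exact_mod_cast hN
  have hR1 : N₀ * T + c₁ ≤ c₀ * N := by
    have : (N₀ * T + c₁) / c₀ ≤ N := ((le_max_left _ _).trans (le_max_left _ _)).trans (hR.trans hRN)
    rw [div_le_iff₀ hc0] at this; linarith
  have hR2 : T ≤ M * N := by
    have : T / M ≤ N := ((le_max_right _ _).trans (le_max_left _ _)).trans (hR.trans hRN)
    rw [div_le_iff₀ hM] at this; linarith
  have hcW : c₀ * κ * N ≤ c₀ * W := by nlinarith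
  have hR3 : 2 * (c₁ + M + 2 * T) ≤ c₀ * W := by
    have : (2 * (c₁ + M + 2 * T)) / (c₀ * κ) ≤ N :=
      ((le_max_left _ _).trans (le_max_right _ _)).trans (hR.trans hRN)
    rw [div_le_iff₀ (by positivity)] at this; linarith
  have hR4 : 2 * T * N₀ ≤ c₀ * W := by
    have : (2 * T * N₀) / (c₀ * κ) ≤ N :=
      ((le_max_right _ _).trans (le_max_right _ _)).trans (hR.trans hRN)
    rw [div_le_iff₀ (by positivity)] at this; linarith
  have hn₁' : (N : ℝ) ≤ n₁ := by exact_mod_cast hn₁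
  have hn₂' : (n₁ : ℝ) ≤ 2 * N := by exact_mod_cast (by omega : n₁ ≤ 2 * N)
  set S : ℝ := cocycle a f n₁ x with hS
  have hS1 : c₀ * N - c₁ ≤ S := by
    have := hf.growth n₁ x
    nlinarith
  have hS2 : S ≤ 2 * N * M := (hf.cocycle_le n₁ x).trans (by nlinarith)
  have hS0 : 0 ≤ S := by
    have : 0 ≤ (N₀ : ℝ) * T := by positivity
    linarith
  have hm1 : S / T ≤ ⌈S / T⌉₊ := Nat.le_ceil _
  have hm2 : (⌈S / T⌉₊ : ℝ) < S / T + 1 := Nat.ceil_lt_add_one (by positivity)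
  rw [div_le_iff₀ hT] at hm1
  have hm2' : (⌈S / T⌉₊ : ℝ) * T < S + T := by
    calc (⌈S / T⌉₊ : ℝ) * T < (S / T + 1) * T := by gcongr
      _ = S + T := by field_simp
  set Y : ℝ := c₀ * W - c₁ - M - T with hY
  have hY0 : 0 ≤ Y := by
    have := hf.growth 0 x
    simp only [Nat.cast_zero, mul_zero, zero_sub, cocycle_zero] at this
    linarith
  have hL1 : (⌊Y / T⌋₊ : ℝ) ≤ Y / T := Nat.floor_le (by positivity)
  rw [le_div_iff₀ hT] at hL1
  have hL2 : Y < (⌊Y / T⌋₊ + 1) * T := by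
    have := Nat.lt_floor_add_one (Y / T)
    rwa [div_lt_iff₀ hT] at this
  have hL3 : c₀ * W / 2 ≤ ⌊Y / T⌋₊ * T := by linarith
  refine ⟨⌈S / T⌉₊, ⌊Y / T⌋₊, ?_, ?_, ?_, ?_⟩
  · have : (N₀ : ℝ) * T ≤ ⌈S / T⌉₊ * T := by linarith
    exact_mod_cast le_of_mul_le_mul_right this hT
  · have : (N₀ : ℝ) * T ≤ ⌊Y / T⌋₊ * T := by linarith
    exact_mod_cast le_of_mul_le_mul_right this hT
  · refine le_of_mul_le_mul_right ?_ hT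
    have h1 : (⌈S / T⌉₊ : ℝ) * T ≤ 3 * M * N := by linarith
    have h2 : c₀ * κ / (6 * M) * (⌈S / T⌉₊ * T) ≤ c₀ * κ / (6 * M) * (3 * M * N) := by gcongr
    have h3 : c₀ * κ / (6 * M) * (3 * M * N) = c₀ * κ * N / 2 := by field_simp; ring
    rw [mul_assoc]
    linarith
  · intro s j hs0 hsM hj1 hj2
    have h1 : (⌈S / T⌉₊ : ℝ) ≤ j := by exact_mod_cast hj1
    have h2 : (j : ℝ) ≤ ⌈S / T⌉₊ + ⌊Y / T⌋₊ := by exact_mod_cast hj2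
    constructor
    · nlinarith
    · have h3 : (j : ℝ) * T ≤ (⌈S / T⌉₊ + ⌊Y / T⌋₊) * T := by gcongr
      have h4 := hf.growth W (x + (n₁ : ℤ) • a)
      push_cast
      rw [cocycle_add]
      linarith

theorem specialDist_specialFlow_lt (hf : IsFlowRoof a f M c₀ c₁) {p p' : SpecialSpace f}
    {t w ε₁ δ η : ℝ} {n₁ W : ℕ} (hw : ∀ n : ℕ, n₁ ≤ n → n ≤ n₁ + W →
      |cocycle a f n p'.1.1 - cocycle a f n p.1.1 - w| ≤ ε₁)
    (ht₁ : cocycle a f n₁ p.1.1 ≤ p.1.2 + t) (ht₂ : p.1.2 + t < cocycle a f ((n₁ + W : ℕ) : ℤ) p.1.1)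
    (hd : specialDist f p p' < δ) (hη : ε₁ + δ ≤ η)
    (hgood : specialFlow a f t p ∉ SpecialSpace.boundaryLayer f η) :
    specialDist f (specialFlow a f t p) (specialFlow a f (t + w) p') < δ + ε₁ := by
  obtain ⟨n, hn⟩ := hf.exists_index p.1.1 (p.1.2 + t)
  have hmono := strictMono_cocycle (a := a) hf.pos p.1.1
  have hn1 : (n₁ : ℤ) ≤ n := by
    by_contra hcon
    have : cocycle a f (n + 1) p.1.1 ≤ cocycle a f n₁ p.1.1 := hmono.monotone (by omega)
    linarith [hn.2]
  have hn2 : n < ((n₁ + W : ℕ) : ℤ) := by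
    by_contra hcon
    have : cocycle a f ((n₁ + W : ℕ) : ℤ) p.1.1 ≤ cocycle a f n p.1.1 := hmono.monotone (by omega)
    linarith [hn.1]
  obtain ⟨k, rfl⟩ := Int.eq_ofNat_of_zero_le (by omega : 0 ≤ n)
  have hk := abs_le.1 (hw k (by omega) (by omega))
  have hk1 := abs_le.1 (hw (k + 1) (by omega) (by omega))
  push_cast at hk1
  have hval := hf.specialFlow_val hn
  rw [specialDist] at hd
  have hd1 : |p.1.2 - p'.1.2| < δ := by linarith [dist_nonneg (x := p.1.1) (y := p'.1.1)]
  have hd1' := abs_lt.1 hd1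
  rw [SpecialSpace.boundaryLayer, Set.mem_ofPred_eq, not_or, not_lt, not_le, hval] at hgood
  obtain ⟨hg1, hg2⟩ := hgood
  simp only at hg1 hg2
  have hsucc := cocycle_succ a f k p.1.1
  have hval' := hf.specialFlow_val (p := p') (t := t + w) (n := k) ⟨by linarith, by linarith⟩
  rw [specialDist, hval, hval']
  simp only
  rw [dist_add_right]
  have h1 : |p.1.2 + t - cocycle a f k p.1.1 - (p'.1.2 + (t + w) - cocycle a f k p'.1.1)| ≤
      |p.1.2 - p'.1.2| + ε₁ := by
    have e : p.1.2 + t - cocycle a f k p.1.1 - (p'.1.2 + (t + w) - cocycle a f k p'.1.1) =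
        (p.1.2 - p'.1.2) + (cocycle a f k p'.1.1 - cocycle a f k p.1.1 - w) := by ring
    rw [e]
    exact (abs_add_le _ _).trans (add_le_add le_rfl (abs_le.2 hk))
  linarith

theorem specialFlow_of_fst_eq (hf : IsFlowRoof a f M c₀ c₁) {p p' : SpecialSpace f}
    (h : p.1.1 = p'.1.1) : specialFlow a f (p'.1.2 - p.1.2) p = p' := by
  rw [hf.specialFlow_eq_proj, h, add_sub_cancel]
  exact hf.proj_val p'

end IsFlowRoof

theorem le_ncard_of_sum_indicator_le {X : Type*} {B : Set X} {x : ℕ → X} {m L : ℕ} {ε : ℝ}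
    {E : Set ℤ} (hE : ∀ i : ℕ, i ≤ L → x (m + i) ∉ B → ((m + i : ℕ) : ℤ) ∈ E)
    (hEL : E ⊆ Set.Icc (m : ℤ) (m + L))
    (hB : ∑ i ∈ Finset.range (L + 1), B.indicator (fun _ => (1 : ℝ)) (x (m + i)) ≤ ε * L) :
    L + 1 - ε * L ≤ E.ncard := by
  classical
  set good : Finset ℕ := (Finset.range (L + 1)).filter fun i => x (m + i) ∉ B with hg
  set bad : Finset ℕ := (Finset.range (L + 1)).filter fun i => x (m + i) ∈ B with hb
  have hcard : bad.card + good.card = L + 1 := by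
    rw [hg, hb, Finset.card_filter_add_card_filter_not, Finset.card_range]
  have hbad : (bad.card : ℝ) ≤ ε * L := by
    refine le_trans (le_of_eq ?_) hB
    rw [hb, Finset.card_filter]
    push_cast
    refine Finset.sum_congr rfl fun i _ => ?_
    by_cases h : x (m + i) ∈ B <;> simp [h]
  have hinj : Function.Injective fun i : ℕ => ((m + i : ℕ) : ℤ) := by
    intro i j hij
    simp only at hij
    omega
  have hgood : good.card ≤ E.ncard := by
    rw [← Finset.card_image_of_injective good hinj, ← Set.ncard_coe_finset]
    refine Set.ncard_le_ncard ?_ ((Set.finite_Icc _ _).subset hEL)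
    intro z hz
    rw [Finset.coe_image] at hz
    obtain ⟨i, hi, rfl⟩ := hz
    rw [Finset.mem_coe, hg, Finset.mem_filter, Finset.mem_range] at hi
    exact hE i (by omega) hi.2
  have h1 : (good.card : ℝ) ≤ E.ncard := by exact_mod_cast hgood
  have h2 : (bad.card : ℝ) + good.card = L + 1 := by exact_mod_cast hcard
  linarith

namespace IsFlowRoof

variable {a : UnitAddCircle} {f : UnitAddCircle → ℝ} {M c₀ c₁ : ℝ}

theorem hasRatnerProperty (hf : IsFlowRoof a f M c₀ c₁) {ℓ K : ℝ} (hwin : HasDriftWindows a f ℓ K)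
    {T : ℝ} (hT : 0 < T) (herg : Ergodic (specialFlow a f T) (specialMeasure f)) :
    HasRatnerProperty (specialDist f) (specialMeasure f) (specialFlow a f) T
      {w | ℓ / 3 ≤ |w| ∧ |w| ≤ K} := by
  intro ε hε
  have hprob := hf.isProbabilityMeasure
  have hM := hf.bound_pos
  have hc0 := hf.growth_pos
  obtain ⟨η₀, hη₀, hlayer⟩ := hf.exists_boundaryLayer_measure_le (ε := ε / 4) (by positivity)
  set η : ℝ := min η₀ ε with hη
  have hηpos : 0 < η := by positivity
  have hlayer := hlayer η hηpos (min_le_left _ _)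
  obtain ⟨κ', hκ', hwin⟩ := hwin (η / 2) (by positivity)
  have hκ : 0 < c₀ * κ' / (6 * M) := by positivity
  refine ⟨c₀ * κ' / (6 * M), hκ, fun N => ?_⟩
  obtain ⟨N₁, Z, hZm, hZ, hcount⟩ := herg.exists_sum_window_le (hf.measurableSet_boundaryLayer η)
    (ε := ε / 4) (by positivity) hκ
  obtain ⟨R, hR⟩ := hf.exists_time_window hT hκ' (max (max N N₁) 1)
  obtain ⟨δ, hδ, hwin⟩ := hwin R
  refine ⟨min δ (η / 2), by positivity, Z, hZm, by linarith, fun p hp p' hp' horb hd => ?_⟩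
  have hne : p.1.1 ≠ p'.1.1 := fun h => horb _ (hf.specialFlow_of_fst_eq h)
  have hdist : dist p.1.1 p'.1.1 < δ := by
    refine lt_of_le_of_lt ?_ (hd.trans_le (min_le_left _ _))
    rw [specialDist]
    linarith [abs_nonneg (p.1.2 - p'.1.2)]
  obtain ⟨N', W, n₁, w, h1, h2, h3, h4, h5, h6, h7⟩ := hwin _ _ hne hdist
  obtain ⟨m, L, hm, hL, hmL, htime⟩ := hR N' W n₁ p.1.1 h1 h2 h3 h4
  simp only [max_le_iff] at hm hL
  have hm0 : (0 : ℝ) < m := by exact_mod_cast (by omega : 0 < m)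
  have hL0 : (0 : ℝ) < L := by exact_mod_cast (by omega : 0 < L)
  refine ⟨m, L, hm.1.1, hL.1.1, by rwa [le_div_iff₀ hm0], w, ⟨h5, h6⟩, ?_⟩
  have hsum := hcount p hp m L hL.1.2 hmL
  have hcard := le_ncard_of_sum_indicator_le (B := SpecialSpace.boundaryLayer f η)
    (x := fun j => (specialFlow a f T)^[j] p) (m := m) (L := L) (ε := ε / 2)
    (E := {n : ℤ | (m : ℤ) ≤ n ∧ n ≤ (m : ℤ) + (L : ℤ) ∧
      specialDist f (specialFlow a f (n * T) p) (specialFlow a f (n * T + w) p') < ε})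
    (fun i hi hgood => by
      refine ⟨by push_cast; omega, by push_cast; omega, ?_⟩
      rw [hf.iterate_specialFlow] at hgood
      have ht := htime p.1.2 (m + i) p.2.1 (p.2.2.trans_le (hf.le _)) (by omega) (by omega)
      have := hf.specialDist_specialFlow_lt h7 ht.1 ht.2 (hd.trans_le (min_le_right _ _))
        (by linarith) hgood
      rw [Int.cast_natCast]
      linarith [min_le_right η₀ ε])
    (fun n hn => ⟨hn.1, hn.2.1⟩)
    (by
      refine le_trans hsum ?_
      gcongr
      linarith)
  rw [one_div, ← div_eq_inv_mul, lt_div_iff₀ hL0]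
  nlinarith

theorem hasWeakRatnerProperty (hf : IsFlowRoof a f M c₀ c₁) {ℓ K : ℝ} (hℓ : 0 < ℓ)
    (hwin : HasDriftWindows a f ℓ K) (htriv : HasTrivialEigenvalues a f)
    (herg : Ergodic (fun x : UnitAddCircle => x + a) volume) :
    HasWeakRatnerProperty (specialDist f) (specialMeasure f) (specialFlow a f) := by
  refine ⟨{w | ℓ / 3 ≤ |w| ∧ |w| ≤ K}, ?_, ?_, ?_⟩
  · refine (isCompact_Icc (a := -K) (b := K)).of_isClosed_subset ?_ fun w hw => abs_le.1 hw.2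
    exact (isClosed_le continuous_const continuous_abs).inter
      (isClosed_le continuous_abs continuous_const)
  · rintro ⟨h, -⟩
    rw [abs_zero] at h
    linarith
  · intro hcount
    have h1 : (Set.Ioi (0 : ℝ)).Countable := by
      refine hcount.mono fun T hT => ?_
      have hT' : 0 < T := hT
      exact ⟨hT'.ne', hf.hasRatnerProperty hwin hT' (hf.ergodic_specialFlow htriv herg hT')⟩
    have h2 := h1.measure_zero volume
    rw [Real.volume_Ioi] at h2
    exact ENNReal.top_ne_zero h2

end IsFlowRoof

end

noncomputable section

/-! ### The decomposition of the roof -/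

theorem IsBVOnCircle.exists_le {f : UnitAddCircle → ℝ} (hf : IsBVOnCircle f) :
    ∃ M : ℝ, ∀ x, f x ≤ M := by
  refine ⟨f ((0 : ℝ) : UnitAddCircle) +
    (eVariationOn (fun x : ℝ => f (x : UnitAddCircle)) (Set.Icc 0 1)).toReal, fun x => ?_⟩
  obtain ⟨y, rfl⟩ := QuotientAddGroup.mk_surjective x
  have hy : ((Int.fract y : ℝ) : UnitAddCircle) = y := by
    rw [Int.fract, AddCircle.coe_sub,
      (AddCircle.coe_eq_zero_iff (1 : ℝ) (x := (⌊y⌋ : ℝ))).2 ⟨⌊y⌋, by simp⟩, sub_zero]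
  have h1 := BoundedVariationOn.dist_le hf
    (x := Int.fract y) (y := 0) ⟨Int.fract_nonneg y, (Int.fract_lt_one y).le⟩ (by simp)
  rw [Real.dist_eq, hy] at h1
  have h2 := le_abs_self (f (y : UnitAddCircle) - f ((0 : ℝ) : UnitAddCircle))
  change f (y : UnitAddCircle) ≤ _
  linarith

theorem IsACOnCircle.exists_abs_le {fa : UnitAddCircle → ℝ} (h : IsACOnCircle fa) :
    ∃ K : ℝ, ∀ x, |fa x| ≤ K := by
  have hc : Continuous fa := QuotientAddGroup.isOpenQuotientMap_mk.continuous_comp_iff.1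
    h.continuous_coe
  obtain ⟨K, hK⟩ := isCompact_univ.exists_bound_of_continuousOn hc.continuousOn
  exact ⟨K, fun x => hK x trivial⟩

theorem apply_add_eq_of_eventually_eq {F : Set UnitAddCircle} {fj : UnitAddCircle → ℝ}
    (hF : ∀ x ∉ F, ∀ᶠ y in 𝓝 x, fj y = fj x) {x h : ℝ} (h0 : 0 ≤ h) (hx : ¬ ArcMeets F h x) :
    fj ((x + h : ℝ) : UnitAddCircle) = fj (x : UnitAddCircle) := by
  have hloc : IsLocallyConstant fun t : Set.Icc x (x + h) => fj ((t : ℝ) : UnitAddCircle) := by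
    rw [IsLocallyConstant.iff_eventually_eq]
    intro t
    have hcont : Continuous fun t : Set.Icc x (x + h) => ((t : ℝ) : UnitAddCircle) :=
      (AddCircle.continuous_mk' 1).comp continuous_subtype_val
    exact hcont.continuousAt.eventually (hF _ fun ht => hx ⟨t, t.2, ht⟩)
  have : PreconnectedSpace (Set.Icc x (x + h)) :=
    Subtype.preconnectedSpace isPreconnected_Icc
  exact hloc.apply_eq_of_preconnectedSpace ⟨x + h, by simpa⟩ ⟨x, by simpa⟩

theorem floor_add_eq_of_not_arcMeets {F : Set UnitAddCircle} (hF : (0 : UnitAddCircle) ∈ F)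
    {x h : ℝ} (h0 : 0 ≤ h) (hx : ¬ ArcMeets F h x) : ⌊x + h⌋ = ⌊x⌋ := by
  by_contra hne
  have hlt : ⌊x⌋ < ⌊x + h⌋ := lt_of_le_of_ne (Int.floor_mono (by linarith)) (Ne.symm hne)
  refine hx ⟨⌊x + h⌋, ⟨(Int.floor_lt.1 hlt).le, Int.floor_le _⟩, ?_⟩
  rwa [(AddCircle.coe_eq_zero_iff (1 : ℝ) (x := (⌊x + h⌋ : ℝ))).2 ⟨⌊x + h⌋, by simp⟩]

theorem QuasiSimilarCantor.exists_isDriftRoof (C : QuasiSimilarCantor)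
    {f fa fj : UnitAddCircle → ℝ} {σ s k : ℝ} (hpos : ∀ x, 0 < f x) (hbv : IsBVOnCircle f)
    (hfa : IsACOnCircle fa) (hfj : IsFiniteJumpFunction fj) (hσ : |σ| = 1) (hs : 0 ≤ s)
    (hf : ∀ x ∈ Set.Ico (0 : ℝ) 1, f (x : UnitAddCircle) =
      fa (x : UnitAddCircle) + fj (x : UnitAddCircle) + k + σ * (C.cantorFunction x + s * x)) :
    ∃ (J G : ℝ → ℝ) (g b : ℝ) (F : Finset UnitAddCircle), IsDriftRoof f fa J G σ g b F := by
  classical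
  obtain ⟨M, hM⟩ := hbv.exists_le
  obtain ⟨K, hK⟩ := hfa.exists_abs_le
  obtain ⟨F, hF, hFj⟩ := hfj
  have hdist : IsCircleDistribution (fun x => C.cantorLift x + s * x) (1 + s) :=
    C.isCircleDistribution_cantorLift.add_linear hs
  have heq : ∀ x : ℝ, f (x : UnitAddCircle) = fa (x : UnitAddCircle) +
      (fj (x : UnitAddCircle) + k - σ * (1 + s) * ⌊x⌋) + σ * (C.cantorLift x + s * x) := by
    intro x
    have hx : ((Int.fract x : ℝ) : UnitAddCircle) = x := by
      rw [Int.fract, AddCircle.coe_sub,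
        (AddCircle.coe_eq_zero_iff (1 : ℝ) (x := (⌊x⌋ : ℝ))).2 ⟨⌊x⌋, by simp⟩, sub_zero]
    have h1 := hf (Int.fract x) ⟨Int.fract_nonneg x, Int.fract_lt_one x⟩
    rw [hx] at h1
    rw [h1, cantorLift]
    have h2 : x = ⌊x⌋ + Int.fract x := (Int.floor_add_fract x).symm
    have h3 : σ * (s * x) = σ * (s * (⌊x⌋ + Int.fract x)) := by rw [← h2]
    linear_combination -h3
  refine ⟨fun x => fj (x : UnitAddCircle) + k - σ * (1 + s) * ⌊x⌋, fun x => C.cantorLift x + s * x,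
    1 + s, M + 2 * K + (1 + s), hF.toFinset ∪ {0}, hfa, heq, ?_, ?_, hdist,
    C.hasScaling_cantorLift.add_linear C.isCircleDistribution_cantorLift.mono hs, by positivity, hσ⟩
  · intro x h h0 hx
    have h1 : ¬ ArcMeets F h x := by
      rintro ⟨t, ht, htF⟩
      exact hx ⟨t, ht, by simp [htF]⟩
    rw [apply_add_eq_of_eventually_eq hFj h0 h1, floor_add_eq_of_not_arcMeets (by simp) h0 hx]
  · intro x h h0 h1
    have e1 := heq (x + h)
    have e2 := heq x
    have hG1 : C.cantorLift x + s * x ≤ C.cantorLift (x + h) + s * (x + h) :=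
      hdist.mono (by linarith)
    have hG2 : C.cantorLift (x + h) + s * (x + h) ≤ C.cantorLift x + s * x + (1 + s) :=
      (hdist.mono (by linarith : x + h ≤ x + 1)).trans_eq (hdist.add_one x)
    set Δ : ℝ := C.cantorLift (x + h) + s * (x + h) - (C.cantorLift x + s * x) with hΔ
    have hσΔ : |σ * Δ| ≤ 1 + s := by
      rw [abs_mul, hσ, one_mul, abs_of_nonneg (by linarith)]; linarith
    have hf1 : |f ((x + h : ℝ) : UnitAddCircle) - f (x : UnitAddCircle)| ≤ M := by
      rw [abs_le]
      constructor <;> linarith [hpos ((x + h : ℝ) : UnitAddCircle), hpos (x : UnitAddCircle),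
        hM ((x + h : ℝ) : UnitAddCircle), hM (x : UnitAddCircle)]
    have e3 : fj ((x + h : ℝ) : UnitAddCircle) + k - σ * (1 + s) * ⌊x + h⌋ -
        (fj (x : UnitAddCircle) + k - σ * (1 + s) * ⌊x⌋) =
        f ((x + h : ℝ) : UnitAddCircle) - f (x : UnitAddCircle) -
          (fa ((x + h : ℝ) : UnitAddCircle) - fa (x : UnitAddCircle)) - σ * Δ := by
      rw [e1, e2, hΔ]; ring
    rw [e3]
    have hK1 := abs_le.1 (hK ((x + h : ℝ) : UnitAddCircle))
    have hK2 := abs_le.1 (hK (x : UnitAddCircle))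
    rw [abs_le] at hσΔ hf1 ⊢
    constructor <;> linarith

theorem IsFiniteJumpFunction.zero : IsFiniteJumpFunction 0 :=
  ⟨∅, Set.finite_empty, fun _ _ => Eventually.of_forall fun _ => rfl⟩

end

theorem theorem1
    (α : ℝ) (hα : α ∈ Set.Ico (0 : ℝ) 1) (hirr : Irrational α)
    (hbpq : HasBoundedPartialQuotients α)
    (C : QuasiSimilarCantor)
    (f fa fj : UnitAddCircle → ℝ) (fs : ℝ → ℝ) (S : ℝ)
    (hpos : ∀ x, 0 < f x) (hbv : IsBVOnCircle f)
    (hfa : IsACOnCircle fa)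
    (hfs : fs = C.cantorFunction ∨ fs = fun x => 1 - C.cantorFunction x)
    (hf : ∀ x ∈ Set.Ico (0 : ℝ) 1,
      f (x : UnitAddCircle) =
        fa (x : UnitAddCircle) + fj (x : UnitAddCircle) + fs x + S * Int.fract x)
    (hcase :
      (IsFiniteJumpFunction fj ∧
        ((0 < S ∧ MonotoneOn fs (Set.Icc 0 1)) ∨ (S < 0 ∧ AntitoneOn fs (Set.Icc 0 1)))) ∨
      (fj = 0 ∧ S = 0)) :
    IsWeaklyMixingFlow (specialMeasure f) (specialFlow (α : UnitAddCircle) f) ∧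
      HasWeakRatnerProperty (specialDist f) (specialMeasure f)
        (specialFlow (α : UnitAddCircle) f) := by
  have hroof : ∃ (J G : ℝ → ℝ) (σ g b : ℝ) (F : Finset UnitAddCircle),
      IsDriftRoof f fa J G σ g b F := by
    have hfj : IsFiniteJumpFunction fj := by
      rcases hcase with h | h
      · exact h.1
      · rw [h.1]; exact IsFiniteJumpFunction.zero
    have h0 : (0 : ℝ) ∈ Set.Icc (0 : ℝ) 1 := by simp
    have h1 : (1 : ℝ) ∈ Set.Icc (0 : ℝ) 1 := by simp
    rcases hfs with hfs | hfs
    · have hS : 0 ≤ S := by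
        rcases hcase with ⟨-, h | h⟩ | h
        · exact h.1.le
        · have := h.2 h0 h1 zero_le_one
          rw [hfs, C.cantorFunction_zero, C.cantorFunction_one] at this
          linarith
        · exact h.2.ge
      obtain ⟨J, G, g, b, F, hd⟩ := C.exists_isDriftRoof (σ := 1) (s := S) (k := 0) hpos hbv hfa hfj
        (by simp) hS fun x hx => by
          rw [hf x hx, Int.fract_eq_self.2 hx, hfs]; ring
      exact ⟨J, G, 1, g, b, F, hd⟩
    · have hS : 0 ≤ -S := by
        rcases hcase with ⟨-, h | h⟩ | h
        · have := h.2 h0 h1 zero_le_one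
          simp only [hfs, C.cantorFunction_zero, C.cantorFunction_one] at this
          linarith
        · linarith [h.1]
        · rw [h.2, neg_zero]
      obtain ⟨J, G, g, b, F, hd⟩ := C.exists_isDriftRoof (σ := -1) (s := -S) (k := 1) hpos hbv hfa hfj
        (by simp) hS fun x hx => by
          rw [hf x hx, Int.fract_eq_self.2 hx, hfs]; ring
      exact ⟨J, G, -1, g, b, F, hd⟩
  obtain ⟨J, G, σ, g, b, F, hd⟩ := hroof
  obtain ⟨c, hc⟩ := hbpq.exists_badlyApproximable hirr
  obtain ⟨M, hM⟩ := hbv.exists_le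
  obtain ⟨c₀, c₁, hflow⟩ := hd.isFlowRoof hc hpos hM
  obtain ⟨ℓ, K, hℓ, hwin⟩ := hd.exists_hasDriftWindows hirr hc
  have htriv : HasTrivialEigenvalues (α : UnitAddCircle) f := fun r hr ψ hψm hψ =>
    hd.cohomological_eq_zero hirr hc hr hψm hψ
  have herg := ergodic_rotation hirr
  exact ⟨hflow.isWeaklyMixingFlow htriv herg, hflow.hasWeakRatnerProperty hℓ hwin htriv herg⟩
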